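/- Let $X$ be a complex manifold, $\mathscr D_X$ its sheaf of holomorphic differential operators with the filtration $F_\bullet\mathscr D_X$ by the order, $R_X=R_F\mathscr D_X=\bigoplus_kF_k\mathscr D_X\hbar^k$ and $\widetilde R_X=R_X\langle\hbar^2\partial_\hbar\rangle$. For a left $\widetilde R_X$-module $M$, put $\mathscr M=M/(\hbar-1)M$ (a $\mathscr D_X$-module), and say that $M$ is strict if it has no $\mathbb C[\hbar]$-torsion. A morphism is called strict if its cokernel has no $\mathbb C[\hbar]$-torsion. The rescaling of $M$ is ${}^\tau\!M=\mathscr O_X[\tau,\tau^{-1}]\otimes_{\mathscr O_X}M=\bigoplus_{k\in\mathbb Z}\tau^k\otimes M$, a module over ${}^\tau\!R_X(*\tau)=\mathscr O_X[\tau,\tau^{-1},\hbar]\langle\eth_x,\tau\eth_\tau\rangle$ (where $\eth_x=\hbar\partial_x$, $\eth_\tau=\hbar\partial_\tau$), with $\mathscr O_X$ and $\tau$ acting in the obvious way and $$\hbar(\tau^k\otimes m)=\tau^{k+1}\otimes\hbar m,\quad \eth_x(\tau^k\otimes m)=\tau^{k+1}\otimes\eth_xm,\quad \tau\eth_\tau(\tau^k\otimes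 m)=\tau^{k+1}\otimes(k\hbar-\hbar^2\partial_\hbar)m .$$ Put ${}^\tau\!R'_X=\mathscr O_X[\tau,\hbar]\langle\eth_x\rangle=R_X[\tau]$ and $V_0={}^\tau\!R'_X\langle\tau\eth_\tau\rangle$. The ${}^\tau\!R_X(*\tau)$-module ${}^\tau\!M$ is strictly $\mathbb R$-specializable along $\tau$ if it has an increasing exhaustive filtration $V_\bullet({}^\tau\!M)$ by coherent $V_0$-submodules, indexed by $A+\mathbb Z$ for some $A\subset[0,1)$ without accumulation point in $[0,1)$, such that, for all $a\in A+\mathbb Z$ and $k\in\mathbb Z$: $V_{a+k}=\tau^{-k}V_a$; $\tau\eth_\tau+a\hbar$ is (locally) nilpotent on $\mathrm{gr}_a^V$; multiplication by $\hbar$ is injective on $\mathrm{gr}^V_a$; and, for each compact $K\subset X$, there is a finite $A_K\subset A$ with $\mathrm{gr}^V_a|_K=0$ for $a\notin A_K+\mathbb Z$. For $a\in\mathbb R$, $V_a$ denotes the union of the $V_b$ with $b\in A+\mathbb Z$, $b\le a$. Via $\hbar=\tau$ one has $i^*_{\tau=\hbar}({}^\tau\!M):={}^\tau\!M/(\tau-\hbar){}^\tau\!M=\mathbb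 C[\tau,\tau^{-1}]\otimes_{\mathbb C}\mathscr M$ if $M$ is strict. 1. Let $M$ be an $\widetilde R_X$-module which is $R_X$-coherent and strict and such that ${}^\tau\!M$ is strictly $\mathbb R$-specializable along $\tau$. Then, for each $a\in\mathbb R$, $V_a({}^\tau\!M)$ is a coherent $V_0$-module, it is $\tau$-graded, and it satisfies $$(\tau-\hbar)V_a({}^\tau\!M)=V_a({}^\tau\!M)\cap(\tau-\hbar)\,{}^\tau\!M,\qquad \mathscr O_X[\tau,\tau^{-1},\hbar]\otimes_{\mathscr O_X[\tau,\hbar]}V_a({}^\tau\!M)={}^\tau\!M .$$ 2. For $M$ as in 1, assume moreover that $V_a({}^\tau\!M)$ is ${}^\tau\!R'_X$-coherent for some $a\in\mathbb R$. Then it is so for every $a\in\mathbb R$, and for every $a\in\mathbb R$ there is a unique coherent $\mathbb Z$-indexed filtration $F^{\mathrm{irr}}_{a,\bullet}\mathscr M$ of the $\mathscr D_X$-module $\mathscr M$ (coherent: its Rees module is $R_F\mathscr D_X$-coherent) such that $$\bigoplus_k\tau^k\otimes F^{\mathrm{irr}}_{a,k}\mathscr M=i^*_{\tau=\hbar}V_a({}^\tau\!M)\subset\mathbb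 C[\tau,\tau^{-1}]\otimes_{\mathbb C}\mathscr M,\qquad i^*_{\tau=\hbar}V_a:=V_a/(\tau-\hbar)V_a .$$ Furthermore $F^{\mathrm{irr}}_{a+k,\bullet}\mathscr M=F^{\mathrm{irr}}_{a,\bullet+k}\mathscr M$ for all $a\in\mathbb R$, $k\in\mathbb Z$, and $F^{\mathrm{irr}}_{a,\bullet}\mathscr M\subset F^{\mathrm{irr}}_{b,\bullet}\mathscr M$ if $a\le b$; hence $F^{\mathrm{irr}}_{a+k}\mathscr M:=F^{\mathrm{irr}}_{a,k}\mathscr M$ defines an increasing $\mathbb R$-indexed filtration $F^{\mathrm{irr}}_\bullet\mathscr M$. 3. Let $M_1,M_2$ be as in 2, let $\lambda:M_1\to M_2$ be an $\widetilde R_X$-linear morphism and ${}^\tau\!\lambda:{}^\tau\!M_1\to{}^\tau\!M_2$, $\tau^k\otimes m\mapsto\tau^k\otimes\lambda(m)$, its rescaling. If $\lambda$ is strict and ${}^\tau\!\lambda$ is strictly $\mathbb R$-specializable along $\tau$, that is, $\mathrm{coker}\,\mathrm{gr}_a^V({}^\tau\!\lambda)$ has no $\mathbb C[\hbar]$-torsion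 for every $a$, then $\lambda|_{\hbar=1}:\mathscr M_1\to\mathscr M_2$ is strictly filtered: $$\lambda|_{\hbar=1}(F^{\mathrm{irr}}_a\mathscr M_1)=F^{\mathrm{irr}}_a\mathscr M_2\cap\mathrm{im}(\lambda|_{\hbar=1})\quad\text{for all }a\in\mathbb R .$$ -/

import Mathlib

open TopologicalSpace Set
open scoped Manifold ContDiff DirectSum

universe u v w

namespace IrrHodge

/-! ### Sheaves of abelian groups, presheaves of rings, sheaves of modules -/

section Sheaves

variable {X : Type u} [TopologicalSpace X]

/-- A sheaf of abelian groups on `X`. -/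
structure AbSheaf (X : Type u) [TopologicalSpace X] where
  obj : Opens X → Type v
  [grp : ∀ U, AddCommGroup (obj U)]
  res : ∀ {U V : Opens X}, V ≤ U → obj U →+ obj V
  res_id : ∀ {U : Opens X} (s : obj U), res le_rfl s = s
  res_res : ∀ {U V W : Opens X} (h : V ≤ U) (h' : W ≤ V) (s : obj U),
    res h' (res h s) = res (h'.trans h) s
  sep : ∀ {U : Opens X} (s : obj U),
    (∀ x ∈ U, ∃ (V : Opens X) (h : V ≤ U), x ∈ V ∧ res h s = 0) → s = 0
  glue : ∀ {ι : Type u} (U : Opens X) (V : ι → Opens X) (h : ∀ i, V i ≤ U),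
    (∀ x ∈ U, ∃ i, x ∈ V i) → ∀ s : ∀ i, obj (V i),
    (∀ i j, res (inf_le_left : V i ⊓ V j ≤ V i) (s i) = res inf_le_right (s j)) →
    ∃ t : obj U, ∀ i, res (h i) t = s i

attribute [instance] AbSheaf.grp

/-- The property `p` holds locally for the section `s` over `U`. -/
def AbSheaf.Loc (M : AbSheaf.{u, v} X) (p : ∀ W : Opens X, M.obj W → Prop) {U : Opens X}
    (s : M.obj U) : Prop :=
  ∀ x ∈ U, ∃ (W : Opens X) (h : W ≤ U), x ∈ W ∧ p W (M.res h s)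

/-- A subsheaf of abelian groups. -/
structure SubSheaf (M : AbSheaf.{u, v} X) where
  carrier : ∀ U, AddSubgroup (M.obj U)
  res_mem : ∀ {U V : Opens X} (h : V ≤ U) {s : M.obj U}, s ∈ carrier U → M.res h s ∈ carrier V
  of_loc : ∀ {U : Opens X} {s : M.obj U}, M.Loc (fun W t => t ∈ carrier W) s → s ∈ carrier U

/-- A subsheaf, seen as a sheaf. -/
def SubSheaf.toAb {M : AbSheaf.{u, v} X} (N : SubSheaf M) : AbSheaf.{u, v} X where
  obj U := N.carrier U
  res h := ((M.res h).comp (N.carrier _).subtype).codRestrict _ fun s => N.res_mem h s.2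
  res_id s := Subtype.ext (M.res_id s.1)
  res_res h h' s := Subtype.ext (M.res_res h h' s.1)
  sep s hs := Subtype.ext (M.sep s.1 fun x hx => by
    obtain ⟨V, h, hV, e⟩ := hs x hx
    exact ⟨V, h, hV, congrArg Subtype.val e⟩)
  glue U V h hc s hs := by
    obtain ⟨t, ht⟩ := M.glue U V h hc (fun i => (s i).1) fun i j => congrArg Subtype.val (hs i j)
    refine ⟨⟨t, N.of_loc fun x hx => ?_⟩, fun i => Subtype.ext (ht i)⟩
    obtain ⟨i, hi⟩ := hc x hx
    exact ⟨V i, h i, hi, by rw [ht i]; exact (s i).2⟩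

/-- The quotient sheaf `M / N`. A section over `U` is represented by a family `f` of sections
`f V ∈ M(V)`, `V ⊆ U`, such that near each point of `U` the classes of the `f V` modulo `N` are the
restrictions of one local section of `M`; two families represent the same section if they agree
modulo `N` on all small open sets. -/
def quotPre {M : AbSheaf.{u, v} X} (N : SubSheaf M) (U : Opens X) :
    AddSubgroup (∀ V : {V : Opens X // V ≤ U}, M.obj V.1) where
  carrier := {f | ∀ x ∈ U, ∃ (V : Opens X) (h : V ≤ U), x ∈ V ∧ ∀ (W : Opens X) (k : W ≤ V),
    f ⟨W, k.trans h⟩ - M.res k (f ⟨V, h⟩) ∈ N.carrier W}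
  zero_mem' x hx := ⟨U, le_rfl, hx, fun W k => by simp⟩
  add_mem' {f g} hf hg x hx := by
    obtain ⟨V, h, hV, e⟩ := hf x hx
    obtain ⟨V', h', hV', e'⟩ := hg x hx
    refine ⟨V ⊓ V', inf_le_left.trans h, ⟨hV, hV'⟩, fun W k => ?_⟩
    have a1 := e W (k.trans inf_le_left)
    have a2 := e' W (k.trans inf_le_right)
    have b1 := N.res_mem k (e (V ⊓ V') inf_le_left)
    have b2 := N.res_mem k (e' (V ⊓ V') inf_le_right)
    have := (N.carrier W).sub_mem (add_mem a1 a2) (add_mem b1 b2)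
    simp only [map_sub, M.res_res] at this
    simp only [Pi.add_apply, map_add]
    convert this using 1
    abel
  neg_mem' {f} hf x hx := by
    obtain ⟨V, h, hV, e⟩ := hf x hx
    refine ⟨V, h, hV, fun W k => ?_⟩
    have := (N.carrier W).neg_mem (e W k)
    simp only [Pi.neg_apply, map_neg]
    convert this using 1
    abel

def quotRel {M : AbSheaf.{u, v} X} (N : SubSheaf M) (U : Opens X) :
    AddSubgroup (quotPre N U) where
  carrier := {f | ∀ x ∈ U, ∃ (V : Opens X) (h : V ≤ U), x ∈ V ∧ ∀ (W : Opens X) (k : W ≤ V),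
    f.1 ⟨W, k.trans h⟩ ∈ N.carrier W}
  zero_mem' x hx := ⟨U, le_rfl, hx, fun W k => (N.carrier W).zero_mem⟩
  add_mem' {f g} hf hg x hx := by
    obtain ⟨V, h, hV, e⟩ := hf x hx
    obtain ⟨V', h', hV', e'⟩ := hg x hx
    exact ⟨V ⊓ V', inf_le_left.trans h, ⟨hV, hV'⟩, fun W k =>
      add_mem (e W (k.trans inf_le_left)) (e' W (k.trans inf_le_right))⟩
  neg_mem' {f} hf x hx := by
    obtain ⟨V, h, hV, e⟩ := hf x hx
    exact ⟨V, h, hV, fun W k => neg_mem (e W k)⟩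

/-- Restriction of representatives. -/
def quotPreRes {M : AbSheaf.{u, v} X} (N : SubSheaf M) {U V : Opens X} (h : V ≤ U) :
    quotPre N U →+ quotPre N V where
  toFun f := ⟨fun W => f.1 ⟨W.1, W.2.trans h⟩, fun x hx => by
    obtain ⟨Z, k, hZ, e⟩ := f.2 x (h hx)
    refine ⟨Z ⊓ V, inf_le_right, ⟨hZ, hx⟩, fun W l => ?_⟩
    have a := e W (l.trans inf_le_left)
    have b := N.res_mem l (e (Z ⊓ V) inf_le_left)
    have := sub_mem a b
    simp only [map_sub, M.res_res] at this
    convert this using 1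
    abel⟩
  map_zero' := rfl
  map_add' _ _ := rfl

lemma quotPreRes_mem {M : AbSheaf.{u, v} X} (N : SubSheaf M) {U V : Opens X} (h : V ≤ U)
    (f : quotPre N U) (hf : f ∈ quotRel N U) : quotPreRes N h f ∈ quotRel N V := fun x hx => by
  obtain ⟨Z, k, hZ, e⟩ := hf x (h hx)
  exact ⟨Z ⊓ V, inf_le_right, ⟨hZ, hx⟩, fun W l => e W (l.trans inf_le_left)⟩

/-- The sections of `M / N` over `U`. -/
abbrev QuotObj {M : AbSheaf.{u, v} X} (N : SubSheaf M) (U : Opens X) : Type (max u v) :=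
  quotPre N U ⧸ quotRel N U

def quotRes {M : AbSheaf.{u, v} X} (N : SubSheaf M) {U V : Opens X} (h : V ≤ U) :
    QuotObj N U →+ QuotObj N V :=
  QuotientAddGroup.map _ _ (quotPreRes N h) (quotPreRes_mem N h)

/-- The class in `M / N` of a section of `M`. -/
def quotMk {M : AbSheaf.{u, v} X} (N : SubSheaf M) (U : Opens X) : M.obj U →+ QuotObj N U :=
  (QuotientAddGroup.mk' _).comp
    { toFun := fun m => ⟨fun V => M.res V.2 m, fun x hx => ⟨U, le_rfl, hx, fun W k => by
        simp only [M.res_res, sub_self]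
        exact zero_mem _⟩⟩
      map_zero' := Subtype.ext (funext fun V => map_zero _)
      map_add' := fun a b => Subtype.ext (funext fun V => map_add _ a b) }

lemma quotMk_res {M : AbSheaf.{u, v} X} (N : SubSheaf M) {U V : Opens X} (h : V ≤ U)
    (m : M.obj U) : quotRes N h (quotMk N U m) = quotMk N V (M.res h m) :=
  congrArg (QuotientAddGroup.mk) (Subtype.ext (funext fun W => (M.res_res h W.2 m).symm))

lemma quotMk_eq_zero {M : AbSheaf.{u, v} X} (N : SubSheaf M) {U : Opens X} (m : M.obj U) :
    quotMk N U m = 0 ↔ m ∈ N.carrier U := by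
  refine (QuotientAddGroup.eq_zero_iff _).trans ⟨fun H => N.of_loc fun x hx => ?_, fun H x hx => ?_⟩
  · obtain ⟨V, h, hV, e⟩ := H x hx
    exact ⟨V, h, hV, e V le_rfl⟩
  · exact ⟨U, le_rfl, hx, fun W k => N.res_mem k H⟩

lemma quot_sep {M : AbSheaf.{u, v} X} (N : SubSheaf M) {U : Opens X} (s : QuotObj N U)
    (hs : ∀ x ∈ U, ∃ (V : Opens X) (h : V ≤ U), x ∈ V ∧ quotRes N h s = 0) : s = 0 := by
  induction s using QuotientAddGroup.induction_on with
  | _ f =>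
  refine (QuotientAddGroup.eq_zero_iff f).2 fun x hx => ?_
  obtain ⟨V, h, hV, e⟩ := hs x hx
  obtain ⟨Z, k, hZ, e⟩ := (QuotientAddGroup.eq_zero_iff (quotPreRes N h f)).1 e x hV
  exact ⟨Z, k.trans h, hZ, e⟩

lemma quot_lift {M : AbSheaf.{u, v} X} (N : SubSheaf M) {U : Opens X} (s : QuotObj N U) :
    ∀ x ∈ U, ∃ (V : Opens X) (h : V ≤ U), x ∈ V ∧ ∃ m : M.obj V,
      quotRes N h s = quotMk N V m := by
  intro x hx
  induction s using QuotientAddGroup.induction_on with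
  | _ f =>
  obtain ⟨V, h, hV, e⟩ := f.2 x hx
  refine ⟨V, h, hV, f.1 ⟨V, h⟩, QuotientAddGroup.eq_iff_sub_mem.2 fun y hy => ?_⟩
  exact ⟨V, le_rfl, hy, e⟩

lemma quotRes_res {M : AbSheaf.{u, v} X} (N : SubSheaf M) {U V W : Opens X} (h : V ≤ U)
    (h' : W ≤ V) (s : QuotObj N U) :
    quotRes N h' (quotRes N h s) = quotRes N (h'.trans h) s := by
  induction s using QuotientAddGroup.induction_on; rfl

/-- The quotient sheaf `M / N`. -/
def AbSheaf.quot (M : AbSheaf.{u, v} X) (N : SubSheaf M) : AbSheaf.{u, max u v} X where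
  obj U := QuotObj N U
  res h := quotRes N h
  res_id s := by
    induction s using QuotientAddGroup.induction_on; rfl
  res_res h h' s := quotRes_res N h h' s
  sep s hs := quot_sep N s hs
  glue {ι} U V h hc s hs := by
    classical
    -- `P W m`: the section `m` of `M` over `W` lifts the section to be constructed
    let P : ∀ W : Opens X, M.obj W → Prop := fun W m => ∀ i,
      quotMk N (W ⊓ V i) (M.res inf_le_left m) = quotRes N inf_le_right (s i)
    have hP : ∀ (i) (W : Opens X) (k : W ≤ V i) (m : M.obj W),
        quotMk N W m = quotRes N k (s i) → P W m := by
      intro i W k m e j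
      rw [← quotMk_res, e, quotRes_res]
      have := congrArg (quotRes N (le_inf (inf_le_left.trans k) inf_le_right :
        W ⊓ V j ≤ V i ⊓ V j)) (hs i j)
      rwa [quotRes_res, quotRes_res] at this
    have hP' : ∀ (i) (W : Opens X) (k : W ≤ V i) (m : M.obj W), P W m →
        quotMk N W m = quotRes N k (s i) := by
      intro i W k m e
      have := congrArg (quotRes N (le_inf le_rfl k : W ≤ W ⊓ V i)) (e i)
      rw [quotRes_res, quotMk_res, M.res_res, M.res_id] at this
      exact this
    let g : ∀ W : {W : Opens X // W ≤ U}, M.obj W.1 := fun W =>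
      if H : ∃ m, P W.1 m then H.choose else 0
    have hg : ∀ W, (∃ m, P W.1 m) → P W.1 (g W) := by
      intro W H
      simp only [g, dif_pos H]
      exact H.choose_spec
    have hloc : ∀ i, ∀ x ∈ V i, ∃ (Z : Opens X) (k : Z ≤ V i), x ∈ Z ∧ ∀ (W : Opens X) (m : W ≤ Z),
        quotMk N W (g ⟨W, (m.trans k).trans (h i)⟩) = quotRes N (m.trans k) (s i) := by
      intro i x hx
      obtain ⟨Z, k, hZ, m, e⟩ := quot_lift N (s i) x hx
      refine ⟨Z, k, hZ, fun W l => hP' i W _ _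
        (hg ⟨W, _⟩ ⟨M.res l m, hP i W (l.trans k) _ ?_⟩)⟩
      rw [← quotMk_res, ← e, quotRes_res]
    have hpre : g ∈ quotPre N U := by
      intro x hx
      obtain ⟨i, hi⟩ := hc x hx
      obtain ⟨Z, k, hZ, e⟩ := hloc i x hi
      refine ⟨Z, k.trans (h i), hZ, fun W l => (quotMk_eq_zero N _).1 ?_⟩
      rw [map_sub, e W l, ← quotMk_res, e Z le_rfl, quotRes_res, sub_self]
    refine ⟨QuotientAddGroup.mk ⟨g, hpre⟩, fun i => sub_eq_zero.1 (quot_sep N _ fun x hx => ?_)⟩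
    obtain ⟨Z, k, hZ, e⟩ := hloc i x hx
    refine ⟨Z, k, hZ, ?_⟩
    rw [map_sub, quotRes_res, ← e Z le_rfl, sub_eq_zero]
    refine QuotientAddGroup.eq_iff_sub_mem.2 fun y hy => ⟨Z, le_rfl, hy, fun W l => ?_⟩
    refine (quotMk_eq_zero N _).1 ?_
    change quotMk N W (g ⟨W, _⟩ - M.res l (g ⟨Z, _⟩)) = 0
    rw [map_sub, e W l, ← quotMk_res, e Z le_rfl, quotRes_res, sub_self]

/-- A presheaf of rings on `X`. It stands for its associated sheaf of rings: a sheaf of abelian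
groups which is a module over a presheaf of rings is the same thing as a module over the associated
sheaf of rings, and the local notions below are insensitive to the difference. -/
structure RingPsh (X : Type u) [TopologicalSpace X] where
  obj : Opens X → Type w
  [ring : ∀ U, Ring (obj U)]
  res : ∀ {U V : Opens X}, V ≤ U → obj U →+* obj V
  res_id : ∀ {U : Opens X} (r : obj U), res le_rfl r = r
  res_res : ∀ {U V W : Opens X} (h : V ≤ U) (h' : W ≤ V) (r : obj U),
    res h' (res h r) = res (h'.trans h) r

attribute [instance] RingPsh.ring

/-- A morphism of presheaves of rings. -/
structure RingPsh.Hom (R S : RingPsh.{u, w} X) where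
  app : ∀ U, R.obj U →+* S.obj U
  app_res : ∀ {U V : Opens X} (h : V ≤ U) (r : R.obj U), app V (R.res h r) = S.res h (app U r)

/-- Composition of morphisms of presheaves of rings. -/
def RingPsh.Hom.comp {R S T : RingPsh.{u, w} X} (g : S.Hom T) (f : R.Hom S) : R.Hom T where
  app U := (g.app U).comp (f.app U)
  app_res h r := by simp [f.app_res, g.app_res]

/-- A sheaf of left `R`-modules. -/
structure ModSheaf (R : RingPsh.{u, w} X) extends AbSheaf.{u, v} X where
  [mod : ∀ U, Module (R.obj U) (obj U)]
  res_smul : ∀ {U V : Opens X} (h : V ≤ U) (r : R.obj U) (s : obj U),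
    res h (r • s) = R.res h r • res h s

attribute [instance] ModSheaf.mod

/-- A morphism of sheaves of left `R`-modules. -/
structure ModSheaf.Hom {R : RingPsh.{u, w} X} (M : ModSheaf.{u, v, w} R)
    (N : ModSheaf.{u, v, w} R) where
  app : ∀ U, M.obj U →ₗ[R.obj U] N.obj U
  app_res : ∀ {U V : Opens X} (h : V ≤ U) (s : M.obj U), app V (M.res h s) = N.res h (app U s)

/-- A sheaf of `R`-submodules. -/
structure SubMod {R : RingPsh.{u, w} X} (M : ModSheaf.{u, v, w} R) extends
    SubSheaf M.toAbSheaf where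
  smul_mem : ∀ {U : Opens X} (r : R.obj U) {s : M.obj U}, s ∈ carrier U → r • s ∈ carrier U

/-- A sheaf of `R`-submodules, seen as a sheaf of `R`-modules. -/
def SubMod.toMod {R : RingPsh.{u, w} X} {M : ModSheaf.{u, v, w} R} (N : SubMod M) :
    ModSheaf.{u, v, w} R where
  toAbSheaf := N.toSubSheaf.toAb
  mod U :=
    { smul := fun r s => ⟨r • s.1, N.smul_mem r s.2⟩
      one_smul := fun s => Subtype.ext (one_smul _ s.1)
      mul_smul := fun a b s => Subtype.ext (mul_smul a b s.1)
      smul_zero := fun a => Subtype.ext (smul_zero a)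
      smul_add := fun a s t => Subtype.ext (smul_add a s.1 t.1)
      add_smul := fun a b s => Subtype.ext (add_smul a b s.1)
      zero_smul := fun s => Subtype.ext (zero_smul _ s.1) }
  res_smul h r s := Subtype.ext (M.res_smul h r s.1)

/-- Restriction of scalars. -/
abbrev ModSheaf.restrict {R S : RingPsh.{u, w} X} (f : R.Hom S) (M : ModSheaf.{u, v, w} S) :
    ModSheaf.{u, v, w} R where
  toAbSheaf := M.toAbSheaf
  mod U := Module.compHom (M.obj U) (f.app U)
  res_smul h r s := by
    change M.res h (f.app _ r • s) = f.app _ (R.res h r) • M.res h s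
    rw [M.res_smul, f.app_res]

/-- Restriction of scalars for sheaves of submodules. -/
abbrev SubMod.restrict {R S : RingPsh.{u, w} X} (f : R.Hom S) {M : ModSheaf.{u, v, w} S}
    (N : SubMod M) : SubMod (M.restrict f) where
  toSubSheaf := N.toSubSheaf
  smul_mem r _ hs := N.smul_mem (f.app _ r) hs

/-- `M` is locally generated by finitely many sections over `R`. -/
def ModSheaf.FiniteType {R : RingPsh.{u, w} X} (M : ModSheaf.{u, v, w} R) : Prop :=
  ∀ x : X, ∃ V : Opens X, x ∈ V ∧ ∃ (p : ℕ) (g : Fin p → M.obj V),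
    ∀ W ≤ V, ∀ s : M.obj W,
      M.Loc (fun Z t => ∃ (k : Z ≤ V) (r : Fin p → R.obj Z), t = ∑ i, r i • M.res k (g i)) s

/-- `M` is a coherent `R`-module: it is of finite type and, for every morphism `R^q|_U ⟶ M|_U`
(given by sections `m 0, …, m (q - 1)` over `U`), the kernel is of finite type. -/
def ModSheaf.Coherent {R : RingPsh.{u, w} X} (M : ModSheaf.{u, v, w} R) : Prop :=
  M.FiniteType ∧ ∀ (U : Opens X) (q : ℕ) (m : Fin q → M.obj U), ∀ x ∈ U,
    ∃ (V : Opens X) (h : V ≤ U), x ∈ V ∧ ∃ (p : ℕ) (g : Fin p → Fin q → R.obj V),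
      (∀ j, ∑ i, g j i • M.res h (m i) = 0) ∧
      ∀ (W : Opens X) (k : W ≤ V) (r : Fin q → R.obj W),
        ∑ i, r i • M.res (k.trans h) (m i) = 0 →
        ∀ y ∈ W, ∃ (Z : Opens X) (l : Z ≤ W), y ∈ Z ∧ ∃ c : Fin p → R.obj Z,
          ∀ i, R.res l (r i) = ∑ j, c j * R.res (l.trans k) (g j i)

/-- The action of a ring section on the sections of `M / N`. -/
def quotPreSmul {R : RingPsh.{u, w} X} {M : ModSheaf.{u, v, w} R} (N : SubMod M) {U : Opens X}
    (r : R.obj U) : quotPre N.toSubSheaf U →+ quotPre N.toSubSheaf U where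
  toFun f := ⟨fun V => R.res V.2 r • f.1 V, fun x hx => by
    obtain ⟨V, h, hV, e⟩ := f.2 x hx
    refine ⟨V, h, hV, fun W k => ?_⟩
    rw [M.res_smul, R.res_res, ← smul_sub]
    exact N.smul_mem _ (e W k)⟩
  map_zero' := Subtype.ext (funext fun V => smul_zero _)
  map_add' a b := Subtype.ext (funext fun V => smul_add _ _ _)

def quotSmul {R : RingPsh.{u, w} X} {M : ModSheaf.{u, v, w} R} (N : SubMod M) {U : Opens X}
    (r : R.obj U) : QuotObj N.toSubSheaf U →+ QuotObj N.toSubSheaf U :=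
  QuotientAddGroup.map (quotRel N.toSubSheaf U) (quotRel N.toSubSheaf U) (quotPreSmul N r) (by
    intro f hf x hx
    obtain ⟨V, h, hV, e⟩ := hf x hx
    exact ⟨V, h, hV, fun W k => N.smul_mem _ (e W k)⟩)

/-- The quotient of a sheaf of modules by a sheaf of submodules. -/
def ModSheaf.quot {R : RingPsh.{u, w} X} (M : ModSheaf.{u, v, w} R) (N : SubMod M) :
    ModSheaf.{u, max u v, w} R where
  toAbSheaf := M.toAbSheaf.quot N.toSubSheaf
  mod U :=
    { smul := fun r => quotSmul N r
      one_smul := fun s => by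
        induction s using QuotientAddGroup.induction_on with
        | _ f => exact congrArg QuotientAddGroup.mk (Subtype.ext (funext fun V => by
            change R.res V.2 1 • f.1 V = f.1 V
            rw [map_one, one_smul]))
      mul_smul := fun a b s => by
        induction s using QuotientAddGroup.induction_on with
        | _ f => exact congrArg QuotientAddGroup.mk (Subtype.ext (funext fun V => by
            change R.res V.2 (a * b) • f.1 V = R.res V.2 a • R.res V.2 b • f.1 V
            rw [map_mul, mul_smul]))
      smul_zero := fun a => map_zero (quotSmul N a)
      smul_add := fun a s t => map_add (quotSmul N a) s t
      add_smul := fun a b s => by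
        induction s using QuotientAddGroup.induction_on with
        | _ f => exact congrArg QuotientAddGroup.mk (Subtype.ext (funext fun V => by
            change R.res V.2 (a + b) • f.1 V = R.res V.2 a • f.1 V + R.res V.2 b • f.1 V
            rw [map_add, add_smul]))
      zero_smul := fun s => by
        induction s using QuotientAddGroup.induction_on with
        | _ f => exact congrArg QuotientAddGroup.mk (Subtype.ext (funext fun V => by
            change R.res V.2 0 • f.1 V = 0
            rw [map_zero, zero_smul])) }
  res_smul {U V} h r s := by
    induction s using QuotientAddGroup.induction_on with
    | _ f => exact congrArg QuotientAddGroup.mk (Subtype.ext (funext fun W => by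
        change R.res (W.2.trans h) r • f.1 ⟨W.1, W.2.trans h⟩ =
          R.res W.2 (R.res h r) • f.1 ⟨W.1, W.2.trans h⟩
        rw [R.res_res]))

/-- The class in `M / N` of a section of `M`. -/
def ModSheaf.proj {R : RingPsh.{u, w} X} (M : ModSheaf.{u, v, w} R) (N : SubMod M) (U : Opens X) :
    M.obj U →+ (M.quot N).obj U :=
  quotMk N.toSubSheaf U

lemma ModSheaf.proj_smul {R : RingPsh.{u, w} X} (M : ModSheaf.{u, v, w} R) (N : SubMod M)
    (U : Opens X) (r : R.obj U) (m : M.obj U) : M.proj N U (r • m) = r • M.proj N U m :=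
  congrArg QuotientAddGroup.mk (Subtype.ext (funext fun V => M.res_smul V.2 r m))

/-- The sheaf `⨁_{k ∈ ℤ} τ^k ⊗ M`: its sections are the locally finite families of sections. -/
def famObj (M : AbSheaf.{u, v} X) (U : Opens X) : AddSubgroup (ℤ → M.obj U) where
  carrier := {s | ∀ x ∈ U, ∃ (V : Opens X) (h : V ≤ U), x ∈ V ∧ {k | M.res h (s k) ≠ 0}.Finite}
  zero_mem' x hx := ⟨U, le_rfl, hx, by simp⟩
  add_mem' {s t} hs ht x hx := by
    obtain ⟨V, h, hV, e⟩ := hs x hx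
    obtain ⟨V', h', hV', e'⟩ := ht x hx
    refine ⟨V ⊓ V', inf_le_left.trans h, ⟨hV, hV'⟩, (e.union e').subset fun k hk => ?_⟩
    by_contra H
    simp only [mem_union, mem_ofPred_eq, not_or, not_not] at H
    apply hk
    have a := congrArg (M.res (inf_le_left : V ⊓ V' ≤ V)) H.1
    have b := congrArg (M.res (inf_le_right : V ⊓ V' ≤ V')) H.2
    rw [M.res_res, map_zero] at a b
    rw [Pi.add_apply, map_add, a, b, add_zero]
  neg_mem' {s} hs x hx := by
    obtain ⟨V, h, hV, e⟩ := hs x hx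
    exact ⟨V, h, hV, by simpa using e⟩

def AbSheaf.fam (M : AbSheaf.{u, v} X) : AbSheaf.{u, v} X where
  obj U := famObj M U
  res {U V} h :=
    { toFun := fun s => ⟨fun k => M.res h (s.1 k), fun x hx => by
        obtain ⟨W, l, hW, e⟩ := s.2 x (h hx)
        refine ⟨W ⊓ V, inf_le_right, ⟨hW, hx⟩, e.subset fun k hk H => hk ?_⟩
        have := congrArg (M.res (inf_le_left : W ⊓ V ≤ W)) H
        rw [M.res_res, map_zero] at this
        rwa [M.res_res]⟩
      map_zero' := Subtype.ext (funext fun k => map_zero _)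
      map_add' := fun a b => Subtype.ext (funext fun k => map_add _ _ _) }
  res_id s := Subtype.ext (funext fun k => M.res_id _)
  res_res h h' s := Subtype.ext (funext fun k => M.res_res h h' _)
  sep s hs := Subtype.ext (funext fun k => M.sep _ fun x hx => by
    obtain ⟨V, h, hV, e⟩ := hs x hx
    exact ⟨V, h, hV, congrFun (congrArg Subtype.val e) k⟩)
  glue U V h hc s hs := by
    choose t ht using fun k : ℤ => M.glue U V h hc (fun i => (s i).1 k) fun i j =>
      congrFun (congrArg Subtype.val (hs i j)) k
    refine ⟨⟨t, fun x hx => ?_⟩, fun i => Subtype.ext (funext fun k => ht k i)⟩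
    obtain ⟨i, hi⟩ := hc x hx
    obtain ⟨W, l, hW, e⟩ := (s i).2 x hi
    refine ⟨W, l.trans (h i), hW, e.subset fun k hk H => hk ?_⟩
    rwa [← ht k i, M.res_res] at H

/-- The additive endomorphism `∑_k τ^k ⊗ m_k ↦ ∑_k τ^{k+d} ⊗ g_k(m_k)`. -/
def famEnd (M : AbSheaf.{u, v} X) (U : Opens X) (d : ℤ) (g : ℤ → M.obj U →+ M.obj U)
    (hg : ∀ k (V : Opens X) (h : V ≤ U) m, M.res h m = 0 → M.res h (g k m) = 0) :
    AddMonoid.End (M.fam.obj U) where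
  toFun s := ⟨fun n => g (n - d) (s.1 (n - d)), fun x hx => by
    obtain ⟨V, h, hV, e⟩ := s.2 x hx
    refine ⟨V, h, hV, (e.image (· + d)).subset fun n hn => ⟨n - d, fun H => hn ?_, by simp⟩⟩
    exact hg _ V h _ H⟩
  map_zero' := Subtype.ext (funext fun k => map_zero _)
  map_add' a b := Subtype.ext (funext fun k => map_add _ _ _)

/-- The section `τ^k ⊗ m`. -/
noncomputable def famSingle (M : AbSheaf.{u, v} X) (U : Opens X) (k : ℤ) (m : M.obj U) :
    M.fam.obj U :=
  ⟨Pi.single k m, fun x hx => ⟨U, le_rfl, hx, (finite_singleton k).subset fun j hj => by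
    by_contra H
    exact hj (by rw [Pi.single_eq_of_ne H, map_zero])⟩⟩

end Sheaves
/-! ### Algebra: adjoining `τ`, `τ⁻¹` and `τð_τ` -/

section Algebra

/-- A ring with a distinguished central element `ħ`. -/
class HasHbar (S : Type w) [Ring S] where
  hbar : S
  comm : ∀ s : S, Commute s hbar

open HasHbar Polynomial

variable (S : Type w) [Ring S] [HasHbar S]

variable {S}

lemma thetaShift_comm (k : ℤ) (a : S) : Commute ((C : S →+* S[X]) a) (X - C (k • hbar)) :=
  (commute_X (C a)).symm.sub_right ((Commute.smul_right (HasHbar.comm a) k).map (C : S →+* S[X]))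

/-- Conjugation by `τ^k`: the `S`-automorphism `θ ↦ θ - kħ` of the polynomial ring `S[θ]`, where the
variable `θ`, which commutes with `S`, stands for `τð_τ`, `ð_τ = ħ∂_τ`. -/
noncomputable def thetaShift (k : ℤ) : S[X] →+* S[X] :=
  eval₂RingHom' C (X - C (k • hbar)) (thetaShift_comm k)

lemma thetaShift_C (k : ℤ) (a : S) : thetaShift k (C a) = C a := by simp [thetaShift]

lemma thetaShift_X (k : ℤ) : thetaShift k (X : S[X]) = X - C (k • hbar) := by simp [thetaShift]

/-- The action of the powers of `τ` on `S[θ]`: `τ^k p(θ) τ^{-k} = p(θ - kħ)`, since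
`[τð_τ, τ^k] = kħτ^k`. -/
noncomputable instance : MulSemiringAction (Multiplicative ℤ) (S[X]) where
  smul k p := thetaShift k.toAdd p
  one_smul p := by
    refine RingHom.congr_fun (f := thetaShift 0) (g := RingHom.id S[X]) ?_ p
    refine Polynomial.ringHom_ext (fun a => ?_) ?_ <;> simp [thetaShift]
  mul_smul j k p := by
    refine RingHom.congr_fun (f := thetaShift (j.toAdd + k.toAdd))
      (g := (thetaShift j.toAdd).comp (thetaShift k.toAdd)) ?_ p
    refine Polynomial.ringHom_ext (fun a => ?_) ?_
    · simp [thetaShift_C]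
    · simp only [thetaShift_X, RingHom.comp_apply, map_sub, thetaShift_C, add_smul, map_add]
      abel
  smul_zero k := map_zero (thetaShift k.toAdd)
  smul_add k := map_add (thetaShift k.toAdd)
  smul_one k := map_one (thetaShift k.toAdd)
  smul_mul k := map_mul (thetaShift k.toAdd)

variable (S)

/-- The ring `S[τ, τ⁻¹]⟨τð_τ⟩`: its elements are the finite sums `∑_k p_k(θ) τ^k`, where `θ = τð_τ`
commutes with `S`, `τ` commutes with `S` and `θ τ = τ (θ + ħ)`. -/
abbrev TauLoc : Type w := SkewMonoidAlgebra (S[X]) (Multiplicative ℤ)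

variable {S}

/-- The inclusion of `S[θ]` in `S[τ, τ⁻¹]⟨τð_τ⟩`. -/
noncomputable def ofTheta : S[X] →+* TauLoc S where
  toFun p := SkewMonoidAlgebra.single 1 p
  map_one' := rfl
  map_mul' p q := by
    rw [SkewMonoidAlgebra.single_mul_single]
    congr 1
    rw [one_smul]
  map_zero' := SkewMonoidAlgebra.single_zero _
  map_add' p q := SkewMonoidAlgebra.single_add _ _ _

/-- The element `τ^k`. -/
noncomputable def tauPow (k : ℤ) : TauLoc S :=
  SkewMonoidAlgebra.single (Multiplicative.ofAdd k) (1 : S[X])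

/-- The element `τð_τ`. -/
noncomputable def theta : TauLoc S := ofTheta X

/-- The inclusion of `S`. -/
noncomputable def ofCoef : S →+* TauLoc S := ofTheta.comp C

lemma single_eq (g : Multiplicative ℤ) p :
    (SkewMonoidAlgebra.single g p : TauLoc S) = ofTheta p * tauPow g.toAdd := by
  change _ = SkewMonoidAlgebra.single 1 p * SkewMonoidAlgebra.single g 1
  rw [SkewMonoidAlgebra.single_mul_single]
  simp

lemma tauPow_add (j k : ℤ) : tauPow (S := S) (j + k) = tauPow j * tauPow k := by
  rw [tauPow, tauPow, tauPow, SkewMonoidAlgebra.single_mul_single]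
  simp

lemma tauPow_mul (k : ℤ) p :
    tauPow k * ofTheta p = ofTheta (thetaShift k p) * tauPow (S := S) k := by
  change SkewMonoidAlgebra.single _ _ * SkewMonoidAlgebra.single _ _ =
    SkewMonoidAlgebra.single _ _ * SkewMonoidAlgebra.single _ _
  rw [SkewMonoidAlgebra.single_mul_single, SkewMonoidAlgebra.single_mul_single]
  simp only [one_mul, mul_one, smul_one]
  rfl

/-- An induction principle for `S[τ, τ⁻¹]⟨τð_τ⟩`. -/
lemma TauLoc.induct {P : TauLoc S → Prop} (r : TauLoc S) (hC : ∀ a, P (ofCoef a)) (hX : P theta)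
    (hT : ∀ k, P (tauPow k)) (hadd : ∀ a b, P a → P b → P (a + b))
    (hmul : ∀ a b, P a → P b → P (a * b)) : P r := by
  have h0 : P 0 := by simpa using hC 0
  have hp : ∀ p : S[X], P (ofTheta p) := by
    intro p
    induction p using Polynomial.induction_on with
    | C a => exact hC a
    | add p q hp hq => rw [map_add]; exact hadd _ _ hp hq
    | monomial n a h =>
      rw [pow_succ, ← mul_assoc, map_mul]
      exact hmul _ _ h hX
  induction r using SkewMonoidAlgebra.induction_on with
  | zero => exact h0
  | single g a => rw [single_eq]; exact hmul _ _ (hp _) (hT _)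
  | add a b ha hb => exact hadd _ _ ha hb

/-- A ring homomorphism out of `S[τ, τ⁻¹]⟨τð_τ⟩` from its values on `S`, `τð_τ` and `τ^k`. -/
noncomputable def TauLoc.lift {T : Type v} [Ring T] (f : S →+* T) (t : T) (g : ℤ → T)
    (hf : ∀ a, Commute (f a) t) (g0 : g 0 = 1) (gadd : ∀ j k, g (j + k) = g j * g k)
    (hfg : ∀ a k, Commute (f a) (g k)) (ht : ∀ k, t * g k = g k * (t + k • f hbar)) :
    TauLoc S →+* T :=
  SkewMonoidAlgebra.liftNCRingHom (eval₂RingHom' f t hf : S[X] →+* T)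
    { toFun := fun k => g k.toAdd, map_one' := g0, map_mul' := fun j k => gadd _ _ } (by
    intro p k
    change eval₂RingHom' f t hf (thetaShift k.toAdd p) * g k.toAdd =
      g k.toAdd * eval₂RingHom' f t hf p
    have key : ∀ q : S[X], eval₂RingHom' f t hf (thetaShift k.toAdd q) * g k.toAdd =
        g k.toAdd * eval₂RingHom' f t hf q := by
      intro q
      induction q using Polynomial.induction_on with
      | C a => simpa [thetaShift_C] using (hfg a _).eq
      | add a b ha hb => rw [map_add, map_add, map_add, add_mul, mul_add, ha, hb]
      | monomial n a h =>
        rw [pow_succ, ← mul_assoc]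
        generalize (C a * X ^ n : S[X]) = q at h ⊢
        rw [map_mul, map_mul, map_mul, ← mul_assoc, ← h, mul_assoc, mul_assoc]
        congr 1
        simp only [thetaShift_X, map_sub, eval₂RingHom'_apply, eval₂_X, eval₂_C, sub_mul, ht,
          mul_add, map_zsmul]
        rw [(Commute.smul_left (hfg hbar _) _).eq, add_sub_cancel_right]
    exact key p)

section lift

variable {T : Type v} [Ring T] (f : S →+* T) (t : T) (g : ℤ → T)
    (hf : ∀ a, Commute (f a) t) (g0 : g 0 = 1) (gadd : ∀ j k, g (j + k) = g j * g k)
    (hfg : ∀ a k, Commute (f a) (g k)) (ht : ∀ k, t * g k = g k * (t + k • f hbar))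

lemma TauLoc.lift_coef (a : S) : TauLoc.lift f t g hf g0 gadd hfg ht (ofCoef a) = f a := by
  change SkewMonoidAlgebra.liftNC _ _ (SkewMonoidAlgebra.single _ _) = _
  rw [SkewMonoidAlgebra.liftNC_single]
  change eval₂RingHom' f t hf (C a) * g 0 = _
  simp [g0]

lemma TauLoc.lift_theta : TauLoc.lift f t g hf g0 gadd hfg ht theta = t := by
  change SkewMonoidAlgebra.liftNC _ _ (SkewMonoidAlgebra.single _ _) = _
  rw [SkewMonoidAlgebra.liftNC_single]
  change eval₂RingHom' f t hf X * g 0 = _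
  simp [g0]

lemma TauLoc.lift_tauPow (k : ℤ) : TauLoc.lift f t g hf g0 gadd hfg ht (tauPow k) = g k := by
  change SkewMonoidAlgebra.liftNC _ _ (SkewMonoidAlgebra.single _ _) = _
  rw [SkewMonoidAlgebra.liftNC_single]
  change eval₂RingHom' f t hf 1 * g k = _
  simp

end lift

lemma ofCoef_comm_theta (a : S) : Commute (ofCoef a) (theta : TauLoc S) := by
  rw [commute_iff_eq]
  change ofTheta (C a) * ofTheta X = ofTheta X * ofTheta (C a)
  rw [← map_mul, ← map_mul, (commute_X (C a)).eq]

lemma ofCoef_comm_tauPow (a : S) (k : ℤ) : Commute (ofCoef a) (tauPow (S := S) k) := by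
  rw [commute_iff_eq]
  change ofTheta (C a) * _ = _ * ofTheta (C a)
  rw [tauPow_mul, thetaShift_C]

lemma theta_mul_tauPow (k : ℤ) :
    theta * tauPow (S := S) k = tauPow k * (theta + k • ofCoef hbar) := by
  change ofTheta X * _ = _ * (ofTheta X + k • ofTheta (C hbar))
  rw [← map_zsmul ofTheta, ← map_add, tauPow_mul]
  congr 2
  rw [map_add, map_zsmul, thetaShift_X, thetaShift_C, map_zsmul]
  abel

/-- Functoriality of `S[τ, τ⁻¹]⟨τð_τ⟩`. -/
noncomputable def TauLoc.map {S' : Type v} [Ring S'] [HasHbar S'] (f : S →+* S')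
    (hf : f hbar = hbar) : TauLoc S →+* TauLoc S' :=
  TauLoc.lift (ofCoef.comp f) theta tauPow (fun a => ofCoef_comm_theta _) rfl tauPow_add
    (fun _ _ => ofCoef_comm_tauPow _ _) (fun k => by
      rw [theta_mul_tauPow, RingHom.comp_apply, hf])

section map

variable {S' : Type v} [Ring S'] [HasHbar S'] (f : S →+* S') (hf : f hbar = hbar)

lemma TauLoc.map_coef (a : S) : TauLoc.map f hf (ofCoef a) = ofCoef (f a) :=
  TauLoc.lift_coef _ _ _ _ _ _ _ _ a

lemma TauLoc.map_theta : TauLoc.map f hf theta = theta :=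
  TauLoc.lift_theta _ _ _ _ _ _ _ _

lemma TauLoc.map_tauPow (k : ℤ) : TauLoc.map f hf (tauPow k) = tauPow k :=
  TauLoc.lift_tauPow _ _ _ _ _ _ _ _ k

end map

variable (S)

/-- The subring `V_0 = S[τ]⟨τð_τ⟩` of `S[τ, τ⁻¹]⟨τð_τ⟩`: no negative power of `τ`. -/
def tauZero : Subring (TauLoc S) where
  carrier := {r | ∀ k ∈ r.support, 0 ≤ k.toAdd}
  mul_mem' {a b} ha hb k hk := by
    classical
    obtain ⟨i, hi, j, hj, rfl⟩ := Finset.mem_mul.1 (SkewMonoidAlgebra.support_mul _ _ hk)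
    exact add_nonneg (ha i hi) (hb j hj)
  one_mem' k hk := by
    have := Finset.mem_one.1 (SkewMonoidAlgebra.support_one_subset hk)
    simp [this]
  add_mem' {a b} ha hb k hk := by
    classical
    rcases Finset.mem_union.1 (SkewMonoidAlgebra.support_add hk) with h | h
    exacts [ha k h, hb k h]
  zero_mem' k hk := by simp at hk
  neg_mem' {a} ha k hk := ha k (by rwa [SkewMonoidAlgebra.support_neg] at hk)

variable {S}

lemma ofTheta_mem p : ofTheta p ∈ tauZero S := fun k hk => by
  have := Finset.mem_singleton.1 (SkewMonoidAlgebra.support_single_subset hk)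
  simp [this]

lemma tauPow_mem {k : ℤ} (h : 0 ≤ k) : tauPow k ∈ tauZero S := fun j hj => by
  have := Finset.mem_singleton.1 (SkewMonoidAlgebra.support_single_subset hj)
  simpa [this] using h

lemma TauLoc.map_mem {S' : Type v} [Ring S'] [HasHbar S'] (f : S →+* S') (hf : f hbar = hbar)
    (r : TauLoc S) (hr : r ∈ tauZero S) : TauLoc.map f hf r ∈ tauZero S' := by
  have hT : ∀ p : S[X], TauLoc.map f hf (ofTheta p) ∈ tauZero S' := by
    intro p
    induction p using Polynomial.induction_on with
    | C a =>
      change TauLoc.map f hf (ofCoef a) ∈ _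
      rw [TauLoc.map_coef]
      exact ofTheta_mem _
    | add p q hp hq => rw [map_add, map_add]; exact add_mem hp hq
    | monomial k a h =>
      rw [pow_succ, ← mul_assoc, map_mul, map_mul]
      refine mul_mem h ?_
      change TauLoc.map f hf theta ∈ _
      rw [TauLoc.map_theta]
      exact ofTheta_mem _
  rw [← SkewMonoidAlgebra.sum_single r, SkewMonoidAlgebra.sum_def', map_sum]
  refine sum_mem fun k hk => ?_
  rw [single_eq, map_mul, TauLoc.map_tauPow]
  exact mul_mem (hT _) (tauPow_mem (hr k hk))

/-- The inclusion of `S[τ]` in `V_0 = S[τ]⟨τð_τ⟩`. -/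
noncomputable def polyToZero : S[X] →+* tauZero S :=
  eval₂RingHom' (ofCoef.codRestrict (tauZero S) fun _ => ofTheta_mem _)
    ⟨tauPow 1, tauPow_mem zero_le_one⟩ fun a => Subtype.ext (ofCoef_comm_tauPow a 1).eq

lemma polyToZero_monomial (k : ℕ) (a : S) : polyToZero (Polynomial.monomial k a) =
    ⟨ofCoef a, ofTheta_mem _⟩ * ⟨tauPow 1, tauPow_mem zero_le_one⟩ ^ k :=
  eval₂_monomial _ _

lemma TauLoc.map_polyToZero {S' : Type v} [Ring S'] [HasHbar S'] (f : S →+* S')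
    (hf : f hbar = hbar) (p : S[X]) :
    TauLoc.map f hf (polyToZero p).1 = (polyToZero (p.map f)).1 := by
  induction p using Polynomial.induction_on' with
  | add p q hp hq =>
    rw [Polynomial.map_add, map_add, map_add, Subring.coe_add, Subring.coe_add, map_add, hp, hq]
  | monomial k a =>
    rw [Polynomial.map_monomial, polyToZero_monomial, polyToZero_monomial, Subring.coe_mul,
      Subring.coe_mul, Subring.coe_pow, Subring.coe_pow, map_mul, map_pow, TauLoc.map_coef,
      TauLoc.map_tauPow]

end Algebra

/-! ### Rees rings -/

section ReesRings

open HasHbar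

/-- An increasing filtration of a `ℂ`-algebra, compatible with the product. -/
class AlgFilt {E : Type w} [Ring E] [Algebra ℂ E] (F : ℕ → Submodule ℂ E) : Prop extends
    SetLike.GradedMonoid F where
  mono : Monotone F

variable {E : Type w} [Ring E] [Algebra ℂ E] (F : ℕ → Submodule ℂ E) [AlgFilt F]
variable {E' : Type w} [Ring E'] [Algebra ℂ E'] (F' : ℕ → Submodule ℂ E') [AlgFilt F']

/-- The Rees ring `⨁_k F_k ħ^k`. -/
def Rees : Type w := ⨁ k, F k

noncomputable instance : Ring (Rees F) := inferInstanceAs (Ring (⨁ k, F k))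

noncomputable instance : Algebra ℂ (Rees F) := inferInstanceAs (Algebra ℂ (⨁ k, F k))

/-- The element `P ħ^k`, for `P ∈ F_k`. -/
noncomputable def Rees.of (k : ℕ) : F k →+ Rees F := DirectSum.of (fun k => F k) k

variable {F F'}

lemma Rees.induct {p : Rees F → Prop} (r : Rees F) (h0 : p 0) (h : ∀ k P, p (Rees.of F k P))
    (hadd : ∀ a b, p a → p b → p (a + b)) : p r :=
  DirectSum.induction_on r h0 h hadd

lemma Rees.of_mul_of (j k : ℕ) (P : F j) (Q : F k) :
    Rees.of F j P * Rees.of F k Q =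
      Rees.of F (j + k) ⟨P.1 * Q.1, SetLike.GradedMul.mul_mem P.2 Q.2⟩ :=
  DirectSum.of_mul_of _ _

lemma Rees.of_congr {j k : ℕ} (h : j = k) (P : F j) (Q : F k) (e : P.1 = Q.1) :
    Rees.of F j P = Rees.of F k Q := by
  subst h
  rw [Subtype.ext e]

lemma Rees.one_eq : (1 : Rees F) = Rees.of F 0 ⟨1, SetLike.GradedOne.one_mem⟩ := rfl

/-- A ring homomorphism out of a Rees ring from its values on the homogeneous elements. -/
noncomputable def Rees.lift {T : Type v} [Ring T] (f : ∀ k, F k →+ T)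
    (h1 : f 0 ⟨1, SetLike.GradedOne.one_mem⟩ = 1)
    (hmul : ∀ j k (P : F j) (Q : F k),
      f (j + k) ⟨P.1 * Q.1, SetLike.GradedMul.mul_mem P.2 Q.2⟩ = f j P * f k Q) :
    Rees F →+* T :=
  DirectSum.toSemiring (A := fun k => F k) f h1 (fun P Q => hmul _ _ P Q)

lemma Rees.lift_of {T : Type v} [Ring T] (f : ∀ k, F k →+ T)
    (h1 : f 0 ⟨1, SetLike.GradedOne.one_mem⟩ = 1)
    (hmul : ∀ j k (P : F j) (Q : F k),
      f (j + k) ⟨P.1 * Q.1, SetLike.GradedMul.mul_mem P.2 Q.2⟩ = f j P * f k Q)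
    (k : ℕ) (P : F k) : Rees.lift f h1 hmul (Rees.of F k P) = f k P :=
  DirectSum.toSemiring_of (A := fun k => F k) f h1 (fun P Q => hmul _ _ P Q) k P

/-- The element `ħ`. -/
noncomputable instance : HasHbar (Rees F) where
  hbar := Rees.of F 1 ⟨1, AlgFilt.mono (Nat.zero_le 1) SetLike.GradedOne.one_mem⟩
  comm s := by
    induction s using Rees.induct with
    | h0 => exact Commute.zero_left _
    | h k P =>
      rw [commute_iff_eq, Rees.of_mul_of, Rees.of_mul_of]
      exact Rees.of_congr (add_comm _ _) _ _ (by simp)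
    | hadd a b ha hb => exact ha.add_left hb

/-- Functoriality of Rees rings. -/
noncomputable def Rees.map (f : E →ₐ[ℂ] E') (hf : ∀ k, ∀ P ∈ F k, f P ∈ F' k) :
    Rees F →+* Rees F' :=
  Rees.lift (fun k => (Rees.of F' k).comp
    { toFun := fun P => ⟨f P.1, hf k P.1 P.2⟩
      map_zero' := Subtype.ext (map_zero f)
      map_add' := fun P Q => Subtype.ext (map_add f P.1 Q.1) })
    (Rees.of_congr rfl _ _ (map_one f)) (fun j k P Q => by
      simp only [AddMonoidHom.comp_apply]
      exact (Rees.of_congr rfl _ _ (map_mul f P.1 Q.1)).trans (Rees.of_mul_of _ _ _ _).symm)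

lemma Rees.map_of (f : E →ₐ[ℂ] E') (hf : ∀ k, ∀ P ∈ F k, f P ∈ F' k) (k : ℕ) (P : F k) :
    Rees.map f hf (Rees.of F k P) = Rees.of F' k ⟨f P.1, hf k P.1 P.2⟩ :=
  Rees.lift_of _ _ _ k P

lemma Rees.map_hbar (f : E →ₐ[ℂ] E') (hf : ∀ k, ∀ P ∈ F k, f P ∈ F' k) :
    Rees.map f hf (hbar : Rees F) = (hbar : Rees F') :=
  (Rees.map_of f hf 1 _).trans (Rees.of_congr rfl _ _ (map_one f))

/-- The specialization `ħ = 1`: `P ħ^k ↦ P`. -/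
noncomputable def Rees.toAlg : Rees F →+* E :=
  Rees.lift (fun k => (F k).subtype.toAddMonoidHom) rfl (fun _ _ _ _ => rfl)

lemma Rees.toAlg_of (k : ℕ) (P : F k) : Rees.toAlg (Rees.of F k P) = P.1 :=
  Rees.lift_of _ _ _ k P

/-- The derivation `ħ²∂_ħ`: `P ħ^k ↦ k P ħ^{k+1}`. -/
noncomputable def Rees.der : Rees F →+ Rees F :=
  DirectSum.toAddMonoid fun k => (Rees.of F (k + 1)).comp
    { toFun := fun P => ⟨k • P.1, nsmul_mem (AlgFilt.mono (Nat.le_succ k) P.2) k⟩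
      map_zero' := Subtype.ext (nsmul_zero k)
      map_add' := fun P Q => Subtype.ext (nsmul_add P.1 Q.1 k) }

lemma Rees.der_of (k : ℕ) (P : F k) : Rees.der (Rees.of F k P) =
    Rees.of F (k + 1) ⟨k • P.1, nsmul_mem (AlgFilt.mono (Nat.le_succ k) P.2) k⟩ :=
  DirectSum.toAddMonoid_of _ _ _

end ReesRings

/-! ### Differential operators on a complex manifold -/

section Operators

variable (n : ℕ) {X : Type u} [TopologicalSpace X] [ChartedSpace (EuclideanSpace ℂ (Fin n)) X]

/-- The ring `𝒪_X(U)` of holomorphic functions on `U`. -/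
def Hol (U : Opens X) : Type u :=
  C^ω⟮𝓘(ℂ, EuclideanSpace ℂ (Fin n)), U; 𝓘(ℂ, ℂ), ℂ⟯

noncomputable instance (U : Opens X) : CommRing (Hol n U) :=
  inferInstanceAs (CommRing C^ω⟮𝓘(ℂ, EuclideanSpace ℂ (Fin n)), U; 𝓘(ℂ, ℂ), ℂ⟯)

noncomputable instance (U : Opens X) : Algebra ℂ (Hol n U) :=
  inferInstanceAs (Algebra ℂ C^ω⟮𝓘(ℂ, EuclideanSpace ℂ (Fin n)), U; 𝓘(ℂ, ℂ), ℂ⟯)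

/-- Restriction of holomorphic functions. -/
noncomputable def Hol.res {U V : Opens X} (h : V ≤ U) : Hol n U →ₐ[ℂ] Hol n V where
  __ := ContMDiffMap.restrictRingHom (n := ω) 𝓘(ℂ, EuclideanSpace ℂ (Fin n)) 𝓘(ℂ, ℂ) ℂ h
  commutes' _ := rfl

/-- The `ℂ`-algebra of `ℂ`-linear endomorphisms of the sheaf `𝒪_U`. -/
noncomputable def sheafEnd (U : Opens X) :
    Subalgebra ℂ (∀ V : {V : Opens X // V ≤ U}, Module.End ℂ (Hol n V.1)) where
  carrier := {P | ∀ (V W : {V : Opens X // V ≤ U}) (h : W.1 ≤ V.1) (f : Hol n V.1),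
    Hol.res n h (P V f) = P W (Hol.res n h f)}
  mul_mem' {P Q} hP hQ V W h f := by
    change Hol.res n h (P V (Q V f)) = P W (Q W _)
    rw [hP, hQ]
  add_mem' {P Q} hP hQ V W h f := by
    change Hol.res n h (P V f + Q V f) = P W _ + Q W _
    rw [map_add, hP, hQ]
  algebraMap_mem' c V W h f := rfl

/-- The `ℂ`-algebra of `ℂ`-linear endomorphisms of the sheaf `𝒪_U`. -/
def EndO (U : Opens X) : Type u := sheafEnd n U

noncomputable instance (U : Opens X) : Ring (EndO n U) := inferInstanceAs (Ring (sheafEnd n U))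

noncomputable instance (U : Opens X) : Algebra ℂ (EndO n U) :=
  inferInstanceAs (Algebra ℂ (sheafEnd n U))

/-- Restriction of endomorphisms. -/
noncomputable def EndO.res {U V : Opens X} (h : V ≤ U) : EndO n U →ₐ[ℂ] EndO n V where
  toFun P := ⟨fun W => P.1 ⟨W.1, W.2.trans h⟩, fun W W' k f =>
    P.2 ⟨W.1, W.2.trans h⟩ ⟨W'.1, W'.2.trans h⟩ k f⟩
  map_one' := rfl
  map_mul' _ _ := rfl
  map_zero' := rfl
  map_add' _ _ := rfl
  commutes' _ := rfl

/-- Multiplication by a holomorphic function, as an endomorphism of `𝒪_U`. -/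
noncomputable def mulHol {U : Opens X} (f : Hol n U) : EndO n U :=
  ⟨fun V => LinearMap.mulLeft ℂ (Hol.res n V.2 f), fun V W h g => by
    simp only [LinearMap.mulLeft_apply, map_mul]
    rfl⟩

/-- `P` is a differential operator of order at most `k`. -/
def OrdLE : ℕ → ∀ {U : Opens X}, EndO n U → Prop
  | 0, U, P => ∀ (V : Opens X) (h : V ≤ U) (f : Hol n V),
      EndO.res n h P * mulHol n f - mulHol n f * EndO.res n h P = 0
  | k + 1, U, P => ∀ (V : Opens X) (h : V ≤ U) (f : Hol n V),
      OrdLE k (EndO.res n h P * mulHol n f - mulHol n f * EndO.res n h P)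

lemma OrdLE.zero (k : ℕ) {U : Opens X} : OrdLE n k (0 : EndO n U) := by
  induction k generalizing U with
  | zero => intro V h f; rw [map_zero, zero_mul, mul_zero, sub_zero]
  | succ k ih => intro V h f; rw [map_zero, zero_mul, mul_zero, sub_zero]; exact ih

lemma OrdLE.add {k : ℕ} {U : Opens X} {P Q : EndO n U} (hP : OrdLE n k P) (hQ : OrdLE n k Q) :
    OrdLE n k (P + Q) := by
  induction k generalizing U with
  | zero =>
    intro V h f
    rw [map_add, add_mul, mul_add, add_sub_add_comm, hP V h f, hQ V h f, add_zero]
  | succ k ih =>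
    intro V h f
    rw [map_add, add_mul, mul_add, add_sub_add_comm]
    exact ih (hP V h f) (hQ V h f)

lemma OrdLE.smul {k : ℕ} {U : Opens X} {P : EndO n U} (c : ℂ) (hP : OrdLE n k P) :
    OrdLE n k (c • P) := by
  induction k generalizing U with
  | zero =>
    intro V h f
    rw [map_smul, smul_mul_assoc, mul_smul_comm, ← smul_sub, hP V h f, smul_zero]
  | succ k ih =>
    intro V h f
    rw [map_smul, smul_mul_assoc, mul_smul_comm, ← smul_sub]
    exact ih (hP V h f)

lemma OrdLE.res {k : ℕ} {U V : Opens X} (h : V ≤ U) {P : EndO n U} (hP : OrdLE n k P) :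
    OrdLE n k (EndO.res n h P) := by
  cases k with
  | zero => exact fun W l f => hP W (l.trans h) f
  | succ k => exact fun W l f => hP W (l.trans h) f

lemma OrdLE.succ {k : ℕ} {U : Opens X} {P : EndO n U} (hP : OrdLE n k P) :
    OrdLE n (k + 1) P := by
  induction k generalizing U with
  | zero => intro V h f; rw [hP V h f]; exact OrdLE.zero n 0
  | succ k ih => exact fun V h f => ih (hP V h f)

lemma OrdLE.mono {j k : ℕ} (h : j ≤ k) {U : Opens X} {P : EndO n U} (hP : OrdLE n j P) :
    OrdLE n k P := by
  induction h with
  | refl => exact hP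
  | step _ ih => exact ih.succ

lemma OrdLE.mul {j k : ℕ} {U : Opens X} {P Q : EndO n U} (hP : OrdLE n j P) (hQ : OrdLE n k Q) :
    OrdLE n (j + k) (P * Q) := by
  have leib : ∀ {V : Opens X} (A B C : EndO n V),
      A * B * C - C * (A * B) = A * (B * C - C * B) + (A * C - C * A) * B := by
    intro V A B C
    rw [mul_sub, sub_mul]
    simp only [mul_assoc]
    abel
  obtain ⟨s, hs⟩ : ∃ s, s = j + k := ⟨_, rfl⟩
  induction s generalizing j k U with
  | zero =>
    obtain ⟨rfl, rfl⟩ : j = 0 ∧ k = 0 := by omega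
    intro V h f
    rw [map_mul, leib, hP V h f, hQ V h f, mul_zero, zero_mul, add_zero]
  | succ s ih =>
    rw [← hs]
    intro V h f
    rw [map_mul, leib]
    refine OrdLE.add n ?_ ?_
    · cases k with
      | zero => rw [hQ V h f, mul_zero]; exact OrdLE.zero n s
      | succ k =>
        have := ih (hP.res n h) (hQ V h f) (by omega)
        rwa [show j + k = s by omega] at this
    · cases j with
      | zero => rw [hP V h f, zero_mul]; exact OrdLE.zero n s
      | succ j =>
        have := ih (hP V h f) (hQ.res n h) (by omega)
        rwa [show j + k = s by omega] at this

lemma OrdLE.one {U : Opens X} : OrdLE n 0 (1 : EndO n U) := by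
  intro V h f
  rw [map_one, one_mul, mul_one, sub_self]

/-- `F_k 𝒟_X(U)`: the differential operators on `U` of order at most `k`. -/
noncomputable def FD (U : Opens X) (k : ℕ) : Submodule ℂ (EndO n U) where
  carrier := {P | OrdLE n k P}
  add_mem' := OrdLE.add n
  zero_mem' := OrdLE.zero n k
  smul_mem' c _ hP := OrdLE.smul n c hP

instance (U : Opens X) : AlgFilt (FD n U) where
  one_mem := OrdLE.one n
  mul_mem _ _ _ _ hP hQ := OrdLE.mul n hP hQ
  mono _ _ h _ hP := OrdLE.mono n h hP

lemma FD.res {U V : Opens X} (h : V ≤ U) (k : ℕ) (P : EndO n U) (hP : P ∈ FD n U k) :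
    EndO.res n h P ∈ FD n V k :=
  OrdLE.res n h hP

/-- Restriction in the Rees ring of `𝒟_X`. -/
noncomputable def reesRes {U V : Opens X} (h : V ≤ U) : Rees (FD n U) →+* Rees (FD n V) :=
  Rees.map (EndO.res n h) (FD.res n h)

lemma reesRes_of {U V : Opens X} (h : V ≤ U) (k : ℕ) (P : FD n U k) :
    reesRes n h (Rees.of _ k P) = Rees.of _ k ⟨EndO.res n h P.1, FD.res n h k P.1 P.2⟩ :=
  Rees.map_of _ _ k P

lemma reesRes_hbar {U V : Opens X} (h : V ≤ U) :
    reesRes n h (HasHbar.hbar : Rees (FD n U)) = HasHbar.hbar :=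
  Rees.map_hbar _ _

/-- The ring of differential operators of finite order on `U`. -/
noncomputable def diffOp (U : Opens X) : Subring (EndO n U) where
  carrier := {P | ∃ k, P ∈ FD n U k}
  mul_mem' := fun ⟨j, hj⟩ ⟨k, hk⟩ => ⟨j + k, OrdLE.mul n hj hk⟩
  one_mem' := ⟨0, OrdLE.one n⟩
  add_mem' := fun ⟨j, hj⟩ ⟨k, hk⟩ =>
    ⟨max j k, (OrdLE.mono n (le_max_left _ _) hj).add n (OrdLE.mono n (le_max_right _ _) hk)⟩
  zero_mem' := ⟨0, zero_mem _⟩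
  neg_mem' := fun ⟨k, hk⟩ => ⟨k, neg_mem hk⟩

variable (X)

/-- The ring `𝒟_X`. -/
noncomputable def DPsh : RingPsh.{u, u} X where
  obj U := diffOp n U
  res h := ((EndO.res n h).toRingHom.comp (diffOp n _).subtype).codRestrict (diffOp n _)
    fun P => P.2.imp fun k hk => FD.res n h k P.1 hk
  res_id _ := rfl
  res_res _ _ _ := rfl

/-- The Rees ring `R_X = R_F 𝒟_X = ⨁_k F_k 𝒟_X ħ^k`. -/
noncomputable def ReesPsh : RingPsh.{u, u} X where
  obj U := Rees (FD n U)
  res h := reesRes n h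
  res_id r := by
    induction r using Rees.induct with
    | h0 => exact map_zero _
    | h k P => exact reesRes_of n _ k P
    | hadd a b ha hb => rw [map_add, ha, hb]
  res_res h h' r := by
    induction r using Rees.induct with
    | h0 => simp only [map_zero]
    | h k P => rw [reesRes_of, reesRes_of, reesRes_of]; rfl
    | hadd a b ha hb => rw [map_add, map_add, map_add, ha, hb]

/-- The morphism `R_X → 𝒟_X`, `P ħ^k ↦ P`. -/
noncomputable def ReesPsh.toD : (ReesPsh n X).Hom (DPsh n X) where
  app U := (Rees.toAlg (F := FD n U)).codRestrict (diffOp n U) fun r => by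
    induction r using Rees.induct with
    | h0 => rw [map_zero]; exact zero_mem _
    | h k P => rw [Rees.toAlg_of]; exact ⟨k, P.2⟩
    | hadd a b ha hb => rw [map_add]; exact add_mem ha hb
  app_res {U V} h r := by
    refine Subtype.ext ?_
    change Rees.toAlg (reesRes n h r) = EndO.res n h (Rees.toAlg r)
    induction r using Rees.induct with
    | h0 => simp only [map_zero]
    | h k P => rw [reesRes_of, Rees.toAlg_of, Rees.toAlg_of]
    | hadd a b ha hb => rw [map_add, map_add, map_add, map_add, ha, hb]

variable {X} in
/-- Restriction in `^τR_X(*τ)`. -/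
noncomputable def tauRes {U V : Opens X} (h : V ≤ U) : TauLoc (Rees (FD n U)) →+*
    TauLoc (Rees (FD n V)) :=
  TauLoc.map (reesRes n h) (reesRes_hbar n h)

section

variable {X} {U V : Opens X} (h : V ≤ U)

lemma tauRes_coef (a : Rees (FD n U)) : tauRes n h (ofCoef a) = ofCoef (reesRes n h a) :=
  TauLoc.map_coef _ _ a

lemma tauRes_theta : tauRes n h theta = theta := TauLoc.map_theta _ _

lemma tauRes_tauPow (k : ℤ) : tauRes n h (tauPow k) = tauPow k := TauLoc.map_tauPow _ _ k

end

/-- The ring `^τR_X(*τ) = 𝒪_X[τ, τ⁻¹, ħ]⟨ð_x, τð_τ⟩ = R_X[τ, τ⁻¹]⟨τð_τ⟩`. -/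
noncomputable def TauLocPsh : RingPsh.{u, u} X where
  obj U := TauLoc (Rees (FD n U))
  res h := tauRes n h
  res_id r := by
    induction r using TauLoc.induct with
    | hC a => exact (tauRes_coef n _ a).trans (congrArg _ ((ReesPsh n X).res_id a))
    | hX => exact tauRes_theta n _
    | hT k => exact tauRes_tauPow n _ k
    | hadd a b ha hb => rw [map_add, ha, hb]
    | hmul a b ha hb => rw [map_mul, ha, hb]
  res_res h h' r := by
    induction r using TauLoc.induct with
    | hC a =>
      rw [tauRes_coef, tauRes_coef, tauRes_coef]
      exact congrArg _ ((ReesPsh n X).res_res h h' a)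
    | hX => rw [tauRes_theta, tauRes_theta, tauRes_theta]
    | hT k => rw [tauRes_tauPow, tauRes_tauPow, tauRes_tauPow]
    | hadd a b ha hb => rw [map_add, map_add, map_add, ha, hb]
    | hmul a b ha hb => rw [map_mul, map_mul, map_mul, ha, hb]

/-- The ring `V_0(^τR_X(*τ)) = 𝒪_X[τ, ħ]⟨ð_x, τð_τ⟩ = R_X[τ]⟨τð_τ⟩`. -/
noncomputable def TauZeroPsh : RingPsh.{u, u} X where
  obj U := tauZero (Rees (FD n U))
  res h := ((tauRes n h).comp (tauZero _).subtype).codRestrict (tauZero _)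
    fun r => TauLoc.map_mem _ (reesRes_hbar n h) r.1 r.2
  res_id r := Subtype.ext ((TauLocPsh n X).res_id r.1)
  res_res h h' r := Subtype.ext ((TauLocPsh n X).res_res h h' r.1)

/-- The ring `^τR'_X = 𝒪_X[τ, ħ]⟨ð_x⟩ = R_X[τ]`. -/
noncomputable def TauPrimePsh : RingPsh.{u, u} X where
  obj U := Polynomial (Rees (FD n U))
  res h := Polynomial.mapRingHom (reesRes n h)
  res_id r := by
    ext1 k
    rw [Polynomial.coe_mapRingHom, Polynomial.coeff_map]
    exact (ReesPsh n X).res_id _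
  res_res h h' r := by
    ext1 k
    simp only [Polynomial.coe_mapRingHom, Polynomial.coeff_map]
    exact (ReesPsh n X).res_res h h' _

/-- The inclusion of `V_0(^τR_X(*τ))` in `^τR_X(*τ)`. -/
noncomputable def zeroToLoc : (TauZeroPsh n X).Hom (TauLocPsh n X) where
  app U := (tauZero (Rees (FD n U))).subtype
  app_res _ _ := rfl

/-- The inclusion of `^τR'_X` in `V_0(^τR_X(*τ))`. -/
noncomputable def primeToZero : (TauPrimePsh n X).Hom (TauZeroPsh n X) where
  app U := polyToZero (S := Rees (FD n U))
  app_res {U V} h r := by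
    refine Subtype.ext ?_
    exact (TauLoc.map_polyToZero (reesRes n h) (reesRes_hbar n h) r).symm

end Operators



/-! ### Modules over `R̃_X` and their rescaling -/

section Rescaling

open HasHbar

variable {n : ℕ} {X : Type u} [TopologicalSpace X] [ChartedSpace (EuclideanSpace ℂ (Fin n)) X]

noncomputable instance (M : ModSheaf.{u, v, u} (ReesPsh n X)) (U : Opens X) :
    Module (Rees (FD n U)) (M.obj U) := M.mod U

lemma res_rees_smul (M : ModSheaf.{u, v, u} (ReesPsh n X)) {U V : Opens X} (h : V ≤ U)
    (r : Rees (FD n U)) (m : M.obj U) : M.res h (r • m) = reesRes n h r • M.res h m :=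
  M.res_smul h r m

lemma Rees.der_of' {U : Opens X} (k : ℕ) (P : FD n U k) :
    Rees.der (Rees.of (FD n U) k P) = (k : ℤ) • ((hbar : Rees (FD n U)) * Rees.of _ k P) := by
  rw [Rees.der_of, natCast_zsmul]
  change _ = k • (Rees.of (FD n U) 1 _ * _)
  rw [Rees.of_mul_of, ← map_nsmul]
  exact Rees.of_congr (add_comm _ _) _ _ (by simp)

/-- The endomorphism `∑ τ^i ⊗ m_i ↦ ∑ τ^{i+k} ⊗ (Pħ^k) m_i`. -/
noncomputable def grEnd (M : ModSheaf.{u, v, u} (ReesPsh n X)) (U : Opens X) (k : ℕ) :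
    FD n U k →+ AddMonoid.End (M.fam.obj U) where
  toFun P := famEnd M.toAbSheaf U k (fun _ => DistribSMul.toAddMonoidHom (M.obj U)
      (Rees.of (FD n U) k P)) fun _ V h m hm => by
    rw [DistribSMul.toAddMonoidHom_apply, res_rees_smul, hm, smul_zero]
  map_zero' := by
    ext s : 1
    refine Subtype.ext (funext fun i => ?_)
    exact (congrArg (· • s.1 (i - k)) (map_zero (Rees.of (FD n U) k))).trans
      (zero_smul (Rees (FD n U)) _)
  map_add' P Q := by
    ext s : 1
    refine Subtype.ext (funext fun i => ?_)
    exact (congrArg (· • s.1 (i - k)) (map_add (Rees.of (FD n U) k) P Q)).trans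
      (add_smul _ _ _)

lemma grEnd_apply (M : ModSheaf.{u, v, u} (ReesPsh n X)) (U : Opens X) (k : ℕ) (P : FD n U k)
    (s : M.fam.obj U) (i : ℤ) :
    (grEnd M U k P s).1 i = Rees.of (FD n U) k P • s.1 (i - k) := rfl

/-- The action of `R_F𝒟_X` on `⨁_k τ^k ⊗ M` where a homogeneous element `Pħ^j` acts by
`τ^k ⊗ m ↦ τ^{k+j} ⊗ (Pħ^j) m`. -/
noncomputable def grHom (M : ModSheaf.{u, v, u} (ReesPsh n X)) (U : Opens X) :
    Rees (FD n U) →+* AddMonoid.End (M.fam.obj U) :=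
  Rees.lift (grEnd M U) (by
    ext s : 1
    refine Subtype.ext (funext fun i => ?_)
    rw [grEnd_apply]
    refine (one_smul (Rees (FD n U)) _).trans ?_
    simp) (fun j k P Q => by
    ext s : 1
    refine Subtype.ext (funext fun i => ?_)
    rw [grEnd_apply, ← Rees.of_mul_of]
    refine (mul_smul _ _ _).trans ?_
    change _ = (grEnd M U j P (grEnd M U k Q s)).1 i
    rw [grEnd_apply, grEnd_apply]
    have e : i - ((j + k : ℕ) : ℤ) = i - (j : ℤ) - (k : ℤ) := by omega
    rw [e])

lemma grHom_of (M : ModSheaf.{u, v, u} (ReesPsh n X)) (U : Opens X) (k : ℕ) (P : FD n U k) :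
    grHom M U (Rees.of _ k P) = grEnd M U k P :=
  Rees.lift_of _ _ _ k P

lemma grHom_res (M : ModSheaf.{u, v, u} (ReesPsh n X)) {U V : Opens X} (h : V ≤ U)
    (r : Rees (FD n U)) (s : M.fam.obj U) :
    M.fam.res h (grHom M U r s) = grHom M V (reesRes n h r) (M.fam.res h s) := by
  induction r using Rees.induct with
  | h0 => rw [map_zero, map_zero, map_zero]; exact map_zero _
  | h k P =>
    rw [reesRes_of, grHom_of, grHom_of]
    refine Subtype.ext (funext fun i => ?_)
    rw [grEnd_apply]
    refine (res_rees_smul M h _ _).trans ?_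
    rw [reesRes_of]
    rfl
  | hadd a b ha hb =>
    rw [map_add, map_add, map_add]
    exact (map_add _ _ _).trans (congrArg₂ (· + ·) ha hb)

/-- The sheaf `ℂ[τ, τ⁻¹] ⊗ M = ⨁_k τ^k ⊗ M` with the action of `R_F𝒟_X` for which a homogeneous
element `Pħ^j` acts by `τ^k ⊗ m ↦ τ^{k+j} ⊗ (Pħ^j) m`. -/
noncomputable abbrev ModSheaf.laurent (M : ModSheaf.{u, v, u} (ReesPsh n X)) :
    ModSheaf.{u, v, u} (ReesPsh n X) where
  toAbSheaf := M.fam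
  mod U := Module.compHom (M.fam.obj U) (grHom M U)
  res_smul h r s := grHom_res M h r s

variable (n X) in
/-- A sheaf of left `R̃_X`-modules, where `R̃_X = R_X⟨ħ²∂_ħ⟩`: an `R_X`-module with an operator
`ħ²∂_ħ` satisfying the Leibniz rule with respect to the derivation `ħ²∂_ħ` of `R_X`. -/
structure TildeMod where
  toModSheaf : ModSheaf.{u, v, u} (ReesPsh n X)
  del : ∀ U, toModSheaf.obj U →+ toModSheaf.obj U
  del_res : ∀ {U V : Opens X} (h : V ≤ U) (m : toModSheaf.obj U),
    toModSheaf.res h (del U m) = del V (toModSheaf.res h m)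
  del_smul : ∀ {U : Opens X} (r : Rees (FD n U)) (m : toModSheaf.obj U),
    del U (r • m) = r • del U m + Rees.der r • m

/-- A morphism of `R̃_X`-modules. -/
structure TildeMod.Hom (M N : TildeMod.{u, v} n X) extends
    ModSheaf.Hom M.toModSheaf N.toModSheaf where
  app_del : ∀ {U : Opens X} (m : M.toModSheaf.obj U), app U (M.del U m) = N.del U (app U m)

/-- Multiplication by `τ^k` on `⨁_k τ^k ⊗ M`. -/
def shiftEnd (M : AbSheaf.{u, v} X) (U : Opens X) (k : ℤ) : AddMonoid.End (M.fam.obj U) :=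
  famEnd M U k (fun _ => AddMonoidHom.id _) fun _ _ _ _ hm => hm

/-- The operator `τð_τ`: `τ^k ⊗ m ↦ τ^{k+1} ⊗ (kħ - ħ²∂_ħ) m`. -/
noncomputable def thetaEnd (M : TildeMod.{u, v} n X) (U : Opens X) :
    AddMonoid.End (M.toModSheaf.fam.obj U) :=
  famEnd M.toModSheaf.toAbSheaf U 1 (fun k => k • DistribSMul.toAddMonoidHom (M.toModSheaf.obj U)
      (hbar : Rees (FD n U)) - M.del U) fun k V h m hm => by
    rw [AddMonoidHom.sub_apply, AddMonoidHom.smul_apply, DistribSMul.toAddMonoidHom_apply,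
      map_sub, map_zsmul, res_rees_smul, M.del_res, hm, smul_zero, smul_zero, map_zero, sub_zero]

lemma shiftEnd_apply (M : AbSheaf.{u, v} X) (U : Opens X) (k : ℤ) (s : M.fam.obj U) (i : ℤ) :
    (shiftEnd M U k s).1 i = s.1 (i - k) := rfl

lemma thetaEnd_apply (M : TildeMod.{u, v} n X) (U : Opens X) (s : M.toModSheaf.fam.obj U) (i : ℤ) :
    (thetaEnd M U s).1 i = (i - 1) • (hbar : Rees (FD n U)) •
      s.1 (i - 1) - M.del U (s.1 (i - 1)) := rfl

lemma grHom_hbar_apply (M : ModSheaf.{u, v, u} (ReesPsh n X)) (U : Opens X)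
    (s : M.fam.obj U) (i : ℤ) : (grHom M U hbar s).1 i =
      (hbar : Rees (FD n U)) • s.1 (i - 1) := by
  have : grHom M U hbar = grEnd M U 1 _ := grHom_of M U 1 _
  rw [this, grEnd_apply]
  rfl

/-- The action of `^τR_X(*τ)` on `^τM`. -/
noncomputable def tauHom (M : TildeMod.{u, v} n X) (U : Opens X) :
    TauLoc (Rees (FD n U)) →+* AddMonoid.End (M.toModSheaf.fam.obj U) :=
  TauLoc.lift (grHom M.toModSheaf U) (thetaEnd M U) (shiftEnd M.toModSheaf.toAbSheaf U)
    (fun a => by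
      induction a using Rees.induct with
      | h0 => rw [map_zero]; exact Commute.zero_left _
      | h k P =>
        rw [grHom_of, commute_iff_eq]
        ext s : 1
        refine Subtype.ext (funext fun i => ?_)
        change (grEnd M.toModSheaf U k P (thetaEnd M U s)).1 i =
          (thetaEnd M U (grEnd M.toModSheaf U k P s)).1 i
        rw [grEnd_apply, thetaEnd_apply, thetaEnd_apply, grEnd_apply, M.del_smul, Rees.der_of']
        rw [show i - k - 1 = i - 1 - k by ring]
        generalize s.1 (i - 1 - k) = m
        have e1 : ((k : ℤ) • ((hbar : Rees (FD n U)) * Rees.of _ k P)) • m =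
            (k : ℤ) • (hbar : Rees (FD n U)) • Rees.of (FD n U) k P • m :=
          (smul_assoc (M := ℤ) (N := Rees (FD n U)) _ _ m).trans
            (congrArg _ (mul_smul _ _ _))
        have e2 : Rees.of (FD n U) k P •
            (hbar : Rees (FD n U)) • m =
            (hbar : Rees (FD n U)) •
            Rees.of (FD n U) k P • m := by
          refine (mul_smul _ _ m).symm.trans ?_
          refine Eq.trans ?_ (mul_smul _ _ m)
          exact congrArg (fun r : Rees (FD n U) => r • m)
            (HasHbar.comm (Rees.of (FD n U) k P)).eq
        rw [e1, smul_sub, smul_comm _ (i - 1 - (k : ℤ)), e2, sub_smul]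
        abel
      | hadd a b ha hb => rw [map_add]; exact ha.add_left hb)
    (by
      ext s : 1
      refine Subtype.ext (funext fun i => ?_)
      rw [shiftEnd_apply, sub_zero]
      rfl)
    (fun j k => by
      ext s : 1
      refine Subtype.ext (funext fun i => ?_)
      change _ = (shiftEnd M.toModSheaf.toAbSheaf U j (shiftEnd M.toModSheaf.toAbSheaf U k s)).1 i
      rw [shiftEnd_apply, shiftEnd_apply, shiftEnd_apply, sub_sub])
    (fun a k => by
      induction a using Rees.induct with
      | h0 => rw [map_zero]; exact Commute.zero_left _
      | h j P =>
        rw [grHom_of, commute_iff_eq]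
        ext s : 1
        refine Subtype.ext (funext fun i => ?_)
        change (grEnd M.toModSheaf U j P (shiftEnd M.toModSheaf.toAbSheaf U k s)).1 i =
          (shiftEnd M.toModSheaf.toAbSheaf U k (grEnd M.toModSheaf U j P s)).1 i
        rw [grEnd_apply, shiftEnd_apply, shiftEnd_apply, grEnd_apply, sub_right_comm]
      | hadd a b ha hb => rw [map_add]; exact ha.add_left hb)
    (fun k => by
      ext s : 1
      refine Subtype.ext (funext fun i => ?_)
      change (thetaEnd M U (shiftEnd M.toModSheaf.toAbSheaf U k s)).1 i =
        (shiftEnd M.toModSheaf.toAbSheaf U k (thetaEnd M U s + k • grHom M.toModSheaf U hbar s)).1 i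
      rw [thetaEnd_apply, shiftEnd_apply, shiftEnd_apply]
      change _ = (thetaEnd M U s).1 (i - k) + k • (grHom M.toModSheaf U hbar s).1 (i - k)
      rw [thetaEnd_apply, grHom_hbar_apply, show i - 1 - k = i - k - 1 by ring,
        show (i - 1) = (i - k - 1) + k by ring, add_smul]
      abel)

/-- The rescaling `^τM = 𝒪_X[τ, τ⁻¹] ⊗ M = ⨁_k τ^k ⊗ M` of an `R̃_X`-module, as a module over
`^τR_X(*τ)`: `𝒪_X` acts in degree `0`, `ħ(τ^k ⊗ m) = τ^{k+1} ⊗ ħm`,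
`ð_x(τ^k ⊗ m) = τ^{k+1} ⊗ ð_x m`, `τð_τ(τ^k ⊗ m) = τ^{k+1} ⊗ (kħ - ħ²∂_ħ)m`. -/
noncomputable def TildeMod.tau (M : TildeMod.{u, v} n X) :
    ModSheaf.{u, v, u} (TauLocPsh n X) where
  toAbSheaf := M.toModSheaf.fam
  mod U := Module.compHom (M.toModSheaf.fam.obj U) (tauHom M U)
  res_smul {U V} h r s := by
    change M.toModSheaf.fam.res h (tauHom M U r s) = tauHom M V (tauRes n h r) (M.toModSheaf.fam.res h s)
    induction r using TauLoc.induct generalizing s with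
    | hC a =>
      rw [tauRes_coef, tauHom, tauHom, TauLoc.lift_coef, TauLoc.lift_coef]
      exact grHom_res M.toModSheaf h a s
    | hX =>
      rw [tauRes_theta, tauHom, tauHom, TauLoc.lift_theta, TauLoc.lift_theta]
      refine Subtype.ext (funext fun i => ?_)
      change M.toModSheaf.res h ((thetaEnd M U s).1 i) = _
      rw [thetaEnd_apply, thetaEnd_apply, map_sub, map_zsmul, res_rees_smul, M.del_res]
      congr 3
      exact reesRes_hbar n h
    | hT k =>
      rw [tauRes_tauPow, tauHom, tauHom, TauLoc.lift_tauPow, TauLoc.lift_tauPow]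
      rfl
    | hadd a b ha hb =>
      rw [map_add, map_add, map_add]
      exact (map_add _ _ _).trans (congrArg₂ (· + ·) (ha s) (hb s))
    | hmul a b ha hb =>
      rw [map_mul, map_mul, map_mul]
      change M.toModSheaf.fam.res h (tauHom M U a (tauHom M U b s)) = tauHom M V _ (tauHom M V _ _)
      rw [ha, hb]

end Rescaling

/-! ### Sub-objects, quotients and morphisms -/

section Images

variable {X : Type u} [TopologicalSpace X]

/-- The subsheaf of the sections which are locally in the subgroups `p W`. -/
def SubSheaf.gen (M : AbSheaf.{u, v} X) (p : ∀ U, AddSubgroup (M.obj U))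
    (hp : ∀ {U V : Opens X} (h : V ≤ U) s, s ∈ p U → M.res h s ∈ p V) : SubSheaf M where
  carrier U :=
    { carrier := {s | M.Loc (fun W t => t ∈ p W) s}
      zero_mem' := fun x hx => ⟨U, le_rfl, hx, by rw [map_zero]; exact zero_mem _⟩
      add_mem' := fun {s t} hs ht x hx => by
        obtain ⟨V, h, hV, e⟩ := hs x hx
        obtain ⟨V', h', hV', e'⟩ := ht x hx
        refine ⟨V ⊓ V', inf_le_left.trans h, ⟨hV, hV'⟩, ?_⟩
        have a := hp (inf_le_left : V ⊓ V' ≤ V) _ e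
        have b := hp (inf_le_right : V ⊓ V' ≤ V') _ e'
        rw [M.res_res] at a b
        rw [map_add]
        exact add_mem a b
      neg_mem' := fun {s} hs x hx => by
        obtain ⟨V, h, hV, e⟩ := hs x hx
        exact ⟨V, h, hV, by rw [map_neg]; exact neg_mem e⟩ }
  res_mem {U V} h {s} hs x hx := by
    obtain ⟨W, k, hW, e⟩ := hs x (h hx)
    refine ⟨W ⊓ V, inf_le_right, ⟨hW, hx⟩, ?_⟩
    have a := hp (inf_le_left : W ⊓ V ≤ W) _ e
    rw [M.res_res] at a ⊢
    exact a
  of_loc {U s} hs x hx := by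
    obtain ⟨V, h, hV, e⟩ := hs x hx
    obtain ⟨W, k, hW, e⟩ := e x hV
    rw [M.res_res] at e
    exact ⟨W, k.trans h, hW, e⟩

/-- The sheaf of submodules of the sections which are locally in the subgroups `p W`. -/
def SubMod.gen {R : RingPsh.{u, w} X} (M : ModSheaf.{u, v, w} R) (p : ∀ U, AddSubgroup (M.obj U))
    (hp : ∀ {U V : Opens X} (h : V ≤ U) s, s ∈ p U → M.res h s ∈ p V)
    (hr : ∀ {U : Opens X} (r : R.obj U) s, s ∈ p U → r • s ∈ p U) : SubMod M where
  toSubSheaf := SubSheaf.gen M.toAbSheaf p hp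
  smul_mem r s hs x hx := by
    obtain ⟨V, h, hV, e⟩ := hs x hx
    exact ⟨V, h, hV, by rw [M.res_smul]; exact hr _ _ e⟩

/-- The image of a morphism. -/
def ModSheaf.Hom.image {R : RingPsh.{u, w} X} {M N : ModSheaf.{u, v, w} R} (f : M.Hom N) :
    SubMod N :=
  SubMod.gen N (fun U => (f.app U).toAddMonoidHom.range)
    (fun h s => by
      rintro ⟨m, rfl⟩
      exact ⟨M.res h m, f.app_res h m⟩)
    (fun {U} r s => by
      rintro ⟨m, rfl⟩
      exact ⟨r • m, (f.app U).map_smul r m⟩)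

/-- The cokernel of a morphism. -/
def ModSheaf.Hom.coker {R : RingPsh.{u, w} X} {M N : ModSheaf.{u, v, w} R} (f : M.Hom N) :
    ModSheaf.{u, max u v, w} R :=
  N.quot f.image

/-- The morphism `M / N → M' / N'` induced by a morphism `f : M → M'` such that `f(N) ⊆ N'`. -/
def ModSheaf.Hom.quotMap {R : RingPsh.{u, w} X} {M M' : ModSheaf.{u, v, w} R} (f : M.Hom M')
    (N : SubMod M) (N' : SubMod M') (hf : ∀ U, ∀ m ∈ N.carrier U, f.app U m ∈ N'.carrier U) :
    (M.quot N).Hom (M'.quot N') where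
  app U :=
    { QuotientAddGroup.map (quotRel N.toSubSheaf U) (quotRel N'.toSubSheaf U)
        { toFun := fun g => ⟨fun V => f.app V.1 (g.1 V), fun x hx => by
            obtain ⟨V, h, hV, e⟩ := g.2 x hx
            refine ⟨V, h, hV, fun W k => ?_⟩
            have := hf W _ (e W k)
            rwa [map_sub, f.app_res] at this⟩
          map_zero' := Subtype.ext (funext fun V => map_zero _)
          map_add' := fun a b => Subtype.ext (funext fun V => map_add _ _ _) }
        (fun g hg x hx => by
          obtain ⟨V, h, hV, e⟩ := hg x hx
          exact ⟨V, h, hV, fun W k => hf W _ (e W k)⟩) with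
      map_smul' := fun r s => by
        induction s using QuotientAddGroup.induction_on with
        | _ g => exact congrArg QuotientAddGroup.mk (Subtype.ext (funext fun V =>
            (f.app V.1).map_smul _ _)) }
  app_res h s := by
    induction s using QuotientAddGroup.induction_on; rfl

lemma ModSheaf.Hom.quotMap_proj {R : RingPsh.{u, w} X} {M M' : ModSheaf.{u, v, w} R}
    (f : M.Hom M') (N : SubMod M) (N' : SubMod M')
    (hf : ∀ U, ∀ m ∈ N.carrier U, f.app U m ∈ N'.carrier U) (U : Opens X) (m : M.obj U) :
    (f.quotMap N N' hf).app U (M.proj N U m) = M'.proj N' U (f.app U m) :=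
  congrArg QuotientAddGroup.mk (Subtype.ext (funext fun V => f.app_res V.2 m))

end Images

/-! ### The fibre at `ħ = 1` -/

section Fibre

open HasHbar

variable {n : ℕ} {X : Type u} [TopologicalSpace X] [ChartedSpace (EuclideanSpace ℂ (Fin n)) X]

noncomputable instance (Q : ModSheaf.{u, v, u} (DPsh n X)) (U : Opens X) :
    Module (diffOp n U) (Q.obj U) := Q.mod U

/-- The operator `P` acts through any of the homogeneous elements `Pħ^k`. -/
noncomputable def homogSmul (Q : ModSheaf.{u, v, u} (ReesPsh n X)) {U : Opens X}
    (P : diffOp n U) (s : Q.obj U) : Q.obj U :=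
  Rees.of (FD n U) P.2.choose ⟨P.1, P.2.choose_spec⟩ • s

lemma Rees.hbar_mul_of {U : Opens X} (k : ℕ) (P : FD n U k) (h : P.1 ∈ FD n U (k + 1)) :
    (hbar : Rees (FD n U)) * Rees.of _ k P = Rees.of _ (k + 1) ⟨P.1, h⟩ := by
  change Rees.of (FD n U) 1 _ * _ = _
  rw [Rees.of_mul_of]
  exact Rees.of_congr (add_comm _ _) _ _ (by simp)

lemma smul_of_mono {Q : ModSheaf.{u, v, u} (ReesPsh n X)}
    (hQ : ∀ (U : Opens X) (s : Q.obj U), (hbar : Rees (FD n U)) • s = s) {U : Opens X} {j k : ℕ}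
    (hjk : j ≤ k) (P : EndO n U) (hj : P ∈ FD n U j) (hk : P ∈ FD n U k) (s : Q.obj U) :
    Rees.of (FD n U) j ⟨P, hj⟩ • s = Rees.of (FD n U) k ⟨P, hk⟩ • s := by
  induction hjk with
  | refl => rfl
  | @step m h ih =>
    have hm : P ∈ FD n U m := AlgFilt.mono h hj
    rw [ih hm, ← Rees.hbar_mul_of m ⟨P, hm⟩ hk]
    refine Eq.trans ?_ (mul_smul _ _ s).symm
    rw [hQ]

lemma homogSmul_eq {Q : ModSheaf.{u, v, u} (ReesPsh n X)}
    (hQ : ∀ (U : Opens X) (s : Q.obj U), (hbar : Rees (FD n U)) • s = s) {U : Opens X}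
    (P : diffOp n U) (k : ℕ) (hk : P.1 ∈ FD n U k) (s : Q.obj U) :
    homogSmul Q P s = Rees.of (FD n U) k ⟨P.1, hk⟩ • s := by
  rcases le_total P.2.choose k with h | h
  · exact smul_of_mono hQ h _ _ _ s
  · exact (smul_of_mono hQ h _ _ _ s).symm

/-- An `R_X`-module on which `ħ` acts by the identity is a `𝒟_X`-module, where `P ∈ F_k 𝒟_X` acts
as `Pħ^k`. -/
noncomputable def ModSheaf.hbarOne (Q : ModSheaf.{u, v, u} (ReesPsh n X))
    (hQ : ∀ (U : Opens X) (s : Q.obj U), (hbar : Rees (FD n U)) • s = s) :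
    ModSheaf.{u, v, u} (DPsh n X) where
  toAbSheaf := Q.toAbSheaf
  mod U :=
    { smul := homogSmul Q
      one_smul := fun s =>
        (homogSmul_eq hQ (1 : diffOp n U) 0 (OrdLE.one n) s).trans (one_smul (Rees (FD n U)) s)
      mul_smul := fun P P' s => by
        obtain ⟨j, hj⟩ := P.2
        obtain ⟨k, hk⟩ := P'.2
        change homogSmul Q (P * P') s = homogSmul Q P (homogSmul Q P' s)
        rw [homogSmul_eq hQ P j hj, homogSmul_eq hQ P' k hk,
          homogSmul_eq hQ (P * P') (j + k) (OrdLE.mul n hj hk)]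
        refine Eq.trans ?_ (mul_smul _ _ s)
        rw [Rees.of_mul_of]
        rfl
      smul_zero := fun P => smul_zero (A := Q.obj U) (Rees.of (FD n U) _ _)
      smul_add := fun P s t => smul_add (A := Q.obj U) (Rees.of (FD n U) _ _) s t
      add_smul := fun P P' s => by
        obtain ⟨j, hj⟩ := P.2
        obtain ⟨k, hk⟩ := P'.2
        have hj' := OrdLE.mono n (le_max_left j k) hj
        have hk' := OrdLE.mono n (le_max_right j k) hk
        change homogSmul Q (P + P') s = homogSmul Q P s + homogSmul Q P' s
        rw [homogSmul_eq hQ P _ hj', homogSmul_eq hQ P' _ hk',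
          homogSmul_eq hQ (P + P') _ (OrdLE.add n hj' hk')]
        refine Eq.trans ?_ (add_smul _ _ s)
        rw [← map_add]
        rfl
      zero_smul := fun s => by
        change homogSmul Q 0 s = 0
        rw [homogSmul_eq hQ 0 0 (zero_mem _)]
        refine Eq.trans ?_ (zero_smul (Rees (FD n U)) s)
        exact congrArg (· • s) (map_zero (Rees.of (FD n U) 0)) }
  res_smul {U V} h P s := by
    obtain ⟨j, hj⟩ := P.2
    change Q.res h (homogSmul Q P s) = homogSmul Q ((DPsh n X).res h P) (Q.res h s)
    rw [homogSmul_eq hQ P j hj, homogSmul_eq hQ ((DPsh n X).res h P) j (FD.res n h j _ hj),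
      res_rees_smul, reesRes_of]
    rfl

lemma ModSheaf.hbarOne_smul (Q : ModSheaf.{u, v, u} (ReesPsh n X))
    (hQ : ∀ (U : Opens X) (s : Q.obj U), (hbar : Rees (FD n U)) • s = s) {U : Opens X} (k : ℕ)
    (P : EndO n U) (hP : P ∈ FD n U k) (s : Q.obj U) :
    (show (Q.hbarOne hQ).obj U from Rees.of (FD n U) k ⟨P, hP⟩ • s) =
      (⟨P, ⟨k, hP⟩⟩ : diffOp n U) • (show (Q.hbarOne hQ).obj U from s) :=
  (homogSmul_eq hQ (⟨P, ⟨k, hP⟩⟩ : diffOp n U) k hP s).symm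

/-- The submodule `(ħ - 1)M`. -/
noncomputable def hbarSubOne (M : ModSheaf.{u, v, u} (ReesPsh n X)) : SubMod M :=
  SubMod.gen M (fun U => (DistribSMul.toAddMonoidHom (M.obj U) (hbar - 1 : Rees (FD n U))).range)
    (fun {U V} h s => by
      rintro ⟨m, rfl⟩
      refine ⟨M.res h m, ?_⟩
      rw [DistribSMul.toAddMonoidHom_apply, DistribSMul.toAddMonoidHom_apply, res_rees_smul,
        map_sub, reesRes_hbar, map_one])
    (fun {U} (r : Rees (FD n U)) s => by
      rintro ⟨m, rfl⟩
      refine ⟨r • m, ?_⟩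
      rw [DistribSMul.toAddMonoidHom_apply, DistribSMul.toAddMonoidHom_apply]
      refine (mul_smul _ _ m).symm.trans (Eq.trans ?_ (mul_smul _ _ m))
      exact congrArg (fun a : Rees (FD n U) => a • m)
        ((HasHbar.comm r).sub_right (Commute.one_right r)).eq.symm)

lemma hbar_smul_quot (M : ModSheaf.{u, v, u} (ReesPsh n X)) (U : Opens X)
    (s : (M.quot (hbarSubOne M)).obj U) : (hbar : Rees (FD n U)) • s = s := by
  refine sub_eq_zero.1 ((M.quot (hbarSubOne M)).sep _ fun x hx => ?_)
  obtain ⟨V, h, hV, m, e⟩ := quot_lift (hbarSubOne M).toSubSheaf s x hx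
  change (M.quot (hbarSubOne M)).res h s = M.proj (hbarSubOne M) V m at e
  refine ⟨V, h, hV, ?_⟩
  rw [map_sub, res_rees_smul, e, reesRes_hbar]
  have e1 : (hbar : Rees (FD n V)) • M.proj (hbarSubOne M) V m =
      M.proj (hbarSubOne M) V ((hbar : Rees (FD n V)) • m) := (M.proj_smul _ V _ m).symm
  rw [e1, ← map_sub]
  refine (quotMk_eq_zero _ _).2 fun y hy => ⟨V, le_rfl, hy, m, ?_⟩
  rw [DistribSMul.toAddMonoidHom_apply, sub_smul, M.res_id]
  exact congrArg _ (one_smul _ m)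

/-- The `𝒟_X`-module `𝓜 = M / (ħ - 1)M`. -/
noncomputable def TildeMod.fibre (M : TildeMod.{u, v} n X) :
    ModSheaf.{u, max u v, u} (DPsh n X) :=
  (M.toModSheaf.quot (hbarSubOne M.toModSheaf)).hbarOne (hbar_smul_quot M.toModSheaf)

/-- The class in `𝓜` of a section of `M`. -/
noncomputable def TildeMod.cls (M : TildeMod.{u, v} n X) (U : Opens X) :
    M.toModSheaf.obj U →+ M.fibre.obj U :=
  M.toModSheaf.proj (hbarSubOne M.toModSheaf) U

lemma TildeMod.cls_res (M : TildeMod.{u, v} n X) {U V : Opens X} (h : V ≤ U)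
    (m : M.toModSheaf.obj U) : M.fibre.res h (M.cls U m) = M.cls V (M.toModSheaf.res h m) :=
  quotMk_res _ h m

lemma TildeMod.Hom.app_hbarSubOne {M N : TildeMod.{u, v} n X} (f : M.Hom N) (U : Opens X)
    (m : M.toModSheaf.obj U) (hm : m ∈ (hbarSubOne M.toModSheaf).carrier U) :
    f.app U m ∈ (hbarSubOne N.toModSheaf).carrier U := by
  intro x hx
  obtain ⟨V, h, hV, t, e⟩ := hm x hx
  refine ⟨V, h, hV, f.app V t, ?_⟩
  rw [← f.app_res, ← e]
  exact ((f.app V).map_smul _ t).symm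

/-- The `𝒟_X`-linear morphism `λ|_{ħ=1} : 𝓜 → 𝓝` induced by `λ : M → N`. -/
noncomputable def TildeMod.Hom.fibre {M N : TildeMod.{u, v} n X} (f : M.Hom N) :
    M.fibre.Hom N.fibre :=
  let g := f.toHom.quotMap _ _ f.app_hbarSubOne
  { app := fun U =>
      { toFun := g.app U
        map_add' := map_add (g.app U)
        map_smul' := fun P s => (g.app U).map_smul (Rees.of (FD n U) P.2.choose _) s }
    app_res := g.app_res }

lemma TildeMod.Hom.fibre_cls {M N : TildeMod.{u, v} n X} (f : M.Hom N) (U : Opens X)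
    (m : M.toModSheaf.obj U) : f.fibre.app U (M.cls U m) = N.cls U (f.app U m) :=
  ModSheaf.Hom.quotMap_proj _ _ _ f.app_hbarSubOne U m

end Fibre
/-! ### Strict `ℝ`-specializability along `τ` -/

section Specializability

open HasHbar

/-- An increasing filtration, indexed by `ℝ`, of a sheaf of modules by sheaves of submodules. -/
structure IncFilt {X : Type u} [TopologicalSpace X] {R : RingPsh.{u, w} X}
    (T : ModSheaf.{u, v, w} R) where
  step : ℝ → SubMod T
  mono : ∀ {a b : ℝ}, a ≤ b → ∀ U, (step a).carrier U ≤ (step b).carrier U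

namespace IncFilt

variable {X : Type u} [TopologicalSpace X] {R : RingPsh.{u, w} X} {T : ModSheaf.{u, v, w} R}

/-- `V_{<a} = ⋃_{b < a} V_b`, as a submodule of `V_a`. -/
def lt (V : IncFilt T) (a : ℝ) : SubMod (V.step a).toMod :=
  SubMod.gen (V.step a).toMod
    (fun U =>
      { carrier := {s | ∃ b < a, s.1 ∈ (V.step b).carrier U}
        zero_mem' := ⟨a - 1, by linarith, zero_mem _⟩
        add_mem' := fun {s t} ⟨b, hb, hs⟩ ⟨c, hc, ht⟩ => ⟨max b c, max_lt hb hc,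
          add_mem (V.mono (le_max_left b c) U hs) (V.mono (le_max_right b c) U ht)⟩
        neg_mem' := fun ⟨b, hb, hs⟩ => ⟨b, hb, neg_mem hs⟩ })
    (fun h _ ⟨b, hb, hs⟩ => ⟨b, hb, (V.step b).res_mem h hs⟩)
    (fun r _ ⟨b, hb, hs⟩ => ⟨b, hb, (V.step b).smul_mem r hs⟩)

/-- `gr_a^V = V_a / V_{<a}`. -/
def gr (V : IncFilt T) (a : ℝ) : ModSheaf.{u, max u v, w} R :=
  (V.step a).toMod.quot (V.lt a)

/-- The class in `gr_a^V` of a section of `V_a`. -/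
def grMk (V : IncFilt T) (a : ℝ) (U : Opens X) : (V.step a).toMod.obj U →+ (V.gr a).obj U :=
  (V.step a).toMod.proj (V.lt a) U

end IncFilt

/-- The element `τð_τ` of `V_0`. -/
noncomputable def thetaZ {S : Type w} [Ring S] [HasHbar S] : tauZero S := ⟨theta, ofTheta_mem _⟩

/-- The inclusion of `S` in `V_0 = S[τ]⟨τð_τ⟩`. -/
noncomputable def coefZ {S : Type w} [Ring S] [HasHbar S] : S →+* tauZero S :=
  ofCoef.codRestrict (tauZero S) fun _ => ofTheta_mem _

variable (n : ℕ) (X : Type u) [TopologicalSpace X] [ChartedSpace (EuclideanSpace ℂ (Fin n)) X]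

/-- The inclusion of `R_X` in `V_0(^τR_X(*τ))`. -/
noncomputable def reesToZero : (ReesPsh n X).Hom (TauZeroPsh n X) where
  app U := coefZ (S := Rees (FD n U))
  app_res h r := Subtype.ext (tauRes_coef n h r).symm

variable {n X}

noncomputable instance (T : ModSheaf.{u, v, u} (TauLocPsh n X)) (U : Opens X) :
    Module (TauLoc (Rees (FD n U))) (T.obj U) := T.mod U

noncomputable instance (T : ModSheaf.{u, v, u} (TauZeroPsh n X)) (U : Opens X) :
    Module (tauZero (Rees (FD n U))) (T.obj U) := T.mod U

/-- The `R_X`-module `Q` has no `ℂ[ħ]`-torsion. -/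
def HbarTorsionFree (Q : ModSheaf.{u, v, u} (ReesPsh n X)) : Prop :=
  ∀ p : Polynomial ℂ, p ≠ 0 → ∀ (U : Opens X) (s : Q.obj U),
    Polynomial.aeval (hbar : Rees (FD n U)) p • s = 0 → s = 0

/-- The set `A + ℤ`. -/
def addInt (A : Set ℝ) : Set ℝ := {a | ∃ α ∈ A, ∃ k : ℤ, a = α + k}

/-- An increasing filtration of the `^τR_X(*τ)`-module `T` by sheaves of
`V_0(^τR_X(*τ))`-submodules. -/
abbrev TauFilt (T : ModSheaf.{u, v, u} (TauLocPsh n X)) : Type _ :=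
  IncFilt (T.restrict (zeroToLoc n X))

/-- `V` is a `V`-filtration along `τ` of the `^τR_X(*τ)`-module `T`, indexed by `A + ℤ`. For
`a ∈ ℝ`, the term `V_a` is the union of the terms `V_b` with `b ∈ A + ℤ` and `b ≤ a`. The module `T`
is strictly `ℝ`-specializable along `τ` if there exist such `A` and `V`. -/
structure IsVFiltration (T : ModSheaf.{u, v, u} (TauLocPsh n X)) (A : Set ℝ) (V : TauFilt T) :
    Prop where
  subset : A ⊆ Ico 0 1
  discrete : ∀ r ∈ Ico (0 : ℝ) 1, ¬ AccPt r (Filter.principal A)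
  step_eq : ∀ (a : ℝ) (U : Opens X) (s : T.obj U), s ∈ (V.step a).carrier U →
    T.Loc (fun W t => ∃ b ∈ addInt A, b ≤ a ∧ t ∈ (V.step b).carrier W) s
  coherent : ∀ a ∈ addInt A, (V.step a).toMod.Coherent
  exhaustive : ∀ (U : Opens X) (s : T.obj U),
    T.Loc (fun W t => ∃ a ∈ addInt A, t ∈ (V.step a).carrier W) s
  step_add : ∀ a ∈ addInt A, ∀ (k : ℤ) (U : Opens X) (s : T.obj U),
    s ∈ (V.step (a + k)).carrier U ↔
      ∃ t ∈ (V.step a).carrier U, s = (tauPow (-k) : TauLoc (Rees (FD n U))) • (t : T.obj U)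
  nilpotent : ∀ a ∈ addInt A, ∀ x : X, ∃ W : Opens X, x ∈ W ∧ ∃ N : ℕ, ∀ Z ≤ W,
    ∀ s : (V.gr a).obj Z,
      (thetaZ + coefZ (algebraMap ℂ (Rees (FD n Z)) (a : ℂ) * hbar)) ^ N • s = 0
  locFinite : ∀ K : Set X, IsCompact K → ∃ B ⊆ A, B.Finite ∧ ∀ a ∈ addInt A, a ∉ addInt B →
    ∀ x ∈ K, ∀ (W : Opens X) (_ : x ∈ W) (s : (V.gr a).obj W),
      ∃ (Z : Opens X) (h : Z ≤ W), x ∈ Z ∧ (V.gr a).res h s = 0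
  hbar_injective : ∀ a ∈ addInt A, ∀ (U : Opens X) (s : (V.gr a).obj U),
    coefZ (hbar : Rees (FD n U)) • s = 0 → s = 0

/-- The image in `gr_a^V T'` of `V_a T` by a morphism `φ : T → T'`. -/
noncomputable def grImage {T T' : ModSheaf.{u, v, u} (TauLocPsh n X)} (φ : T.Hom T') (V : TauFilt T)
    (V' : TauFilt T') (a : ℝ) : SubMod (V'.gr a) :=
  SubMod.gen (V'.gr a)
    (fun U =>
      { carrier := {s | ∃ m ∈ (V.step a).carrier U,
          ∃ h : φ.app U m ∈ (V'.step a).carrier U, s = V'.grMk a U ⟨φ.app U m, h⟩}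
        zero_mem' := ⟨0, zero_mem _, by rw [map_zero]; exact zero_mem _, by
          refine (map_zero (V'.grMk a U)).symm.trans (congrArg _ (Subtype.ext ?_))
          exact (map_zero (φ.app U)).symm⟩
        add_mem' := by
          rintro _ _ ⟨m, hm, h, rfl⟩ ⟨m', hm', h', rfl⟩
          refine ⟨m + m', add_mem hm hm', ?_, ?_⟩
          · exact (map_add (φ.app U) m m').symm ▸ add_mem h h'
          · refine (map_add (V'.grMk a U) _ _).symm.trans (congrArg _ (Subtype.ext ?_))
            exact (map_add (φ.app U) m m').symm
        neg_mem' := by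
          rintro _ ⟨m, hm, h, rfl⟩
          refine ⟨-m, neg_mem hm, ?_, ?_⟩
          · exact (map_neg (φ.app U) m).symm ▸ neg_mem h
          · refine (map_neg (V'.grMk a U) _).symm.trans (congrArg _ (Subtype.ext ?_))
            exact (map_neg (φ.app U) m).symm })
    (fun {U W} k s => by
      rintro ⟨m, hm, h, rfl⟩
      refine ⟨T.res k m, (V.step a).res_mem k hm, ?_, ?_⟩
      · rw [φ.app_res]; exact (V'.step a).res_mem k h
      · refine (quotMk_res _ k _).trans (congrArg _ (Subtype.ext ?_))
        exact (φ.app_res k m).symm)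
    (fun {U} r s => by
      rintro ⟨m, hm, h, rfl⟩
      have e := (φ.app U).map_smul ((zeroToLoc n X).app U r) m
      refine ⟨(zeroToLoc n X).app U r • m, (V.step a).smul_mem r hm, ?_, ?_⟩
      · exact e.symm ▸ (V'.step a).smul_mem r h
      · exact ((V'.step a).toMod.proj_smul (V'.lt a) U r _).symm.trans
          (congrArg _ (Subtype.ext e.symm)))

/-- The morphism `φ : T → T'` is strictly `ℝ`-specializable along `τ`, with respect to the
`V`-filtrations `V` and `V'`: the cokernel of `gr_a^V φ` has no `ℂ[ħ]`-torsion for every `a`. -/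
def IsSpecializableHom {T T' : ModSheaf.{u, v, u} (TauLocPsh n X)} (φ : T.Hom T') (V : TauFilt T)
    (V' : TauFilt T') : Prop :=
  ∀ a : ℝ, HbarTorsionFree (((V'.gr a).quot (grImage φ V V' a)).restrict (reesToZero n X))

end Specializability

/-! ### Rescaling of morphisms, coherent filtrations -/

section Filtrations

open HasHbar

variable {n : ℕ} {X : Type u} [TopologicalSpace X] [ChartedSpace (EuclideanSpace ℂ (Fin n)) X]

/-- The morphism `∑ τ^k ⊗ m_k ↦ ∑ τ^k ⊗ f(m_k)`. -/
def famMap {M : AbSheaf.{u, v} X} {N : AbSheaf.{u, w} X} (f : ∀ U, M.obj U →+ N.obj U)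
    (hf : ∀ {U V : Opens X} (h : V ≤ U) (m : M.obj U), f V (M.res h m) = N.res h (f U m))
    (U : Opens X) : M.fam.obj U →+ N.fam.obj U where
  toFun s := ⟨fun k => f U (s.1 k), fun x hx => by
    obtain ⟨V, h, hV, e⟩ := s.2 x hx
    refine ⟨V, h, hV, e.subset fun k hk H => hk ?_⟩
    rw [← hf, H, map_zero]⟩
  map_zero' := Subtype.ext (funext fun k => map_zero _)
  map_add' _ _ := Subtype.ext (funext fun k => map_add _ _ _)

/-- The morphism `τ^k ⊗ m ↦ τ^k ⊗ λ(m)`. -/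
noncomputable def TildeMod.Hom.fam {M N : TildeMod.{u, v} n X} (f : M.Hom N) (U : Opens X) :
    M.toModSheaf.fam.obj U →+ N.toModSheaf.fam.obj U :=
  famMap (N := N.toModSheaf.toAbSheaf) (fun U => (f.app U).toAddMonoidHom) f.app_res U

lemma TildeMod.Hom.fam_apply {M N : TildeMod.{u, v} n X} (f : M.Hom N) (U : Opens X)
    (s : M.toModSheaf.fam.obj U) (k : ℤ) : (f.fam U s).1 k = f.app U (s.1 k) := rfl

lemma TildeMod.Hom.fam_tauHom {M N : TildeMod.{u, v} n X} (f : M.Hom N) (U : Opens X)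
    (r : TauLoc (Rees (FD n U))) (s : M.toModSheaf.fam.obj U) :
    f.fam U (tauHom M U r s) = tauHom N U r (f.fam U s) := by
  have hs : ∀ (r : Rees (FD n U)) (m : M.toModSheaf.obj U),
    f.app U (r • m) = r • f.app U m := fun r m => (f.app U).map_smul r m
  induction r using TauLoc.induct generalizing s with
  | hC a =>
    rw [tauHom, tauHom, TauLoc.lift_coef, TauLoc.lift_coef]
    induction a using Rees.induct with
    | h0 => rw [map_zero, map_zero]; exact map_zero (f.fam U)
    | h k P =>
      rw [grHom_of, grHom_of]
      exact Subtype.ext (funext fun i => hs _ _)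
    | hadd a b ha hb =>
      rw [map_add, map_add]
      exact (map_add (f.fam U) _ _).trans (congrArg₂ (· + ·) ha hb)
  | hX =>
    rw [tauHom, tauHom, TauLoc.lift_theta, TauLoc.lift_theta]
    refine Subtype.ext (funext fun i => ?_)
    rw [f.fam_apply, thetaEnd_apply, thetaEnd_apply, f.fam_apply, map_sub, map_zsmul, hs,
      f.app_del]
  | hT k =>
    rw [tauHom, tauHom, TauLoc.lift_tauPow, TauLoc.lift_tauPow]
    rfl
  | hadd a b ha hb =>
    rw [map_add, map_add]
    exact (map_add (f.fam U) _ _).trans (congrArg₂ (· + ·) (ha s) (hb s))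
  | hmul a b ha hb =>
    rw [map_mul, map_mul]
    change f.fam U (tauHom M U a (tauHom M U b s)) = tauHom N U a (tauHom N U b (f.fam U s))
    rw [ha, hb]

/-- The rescaling `^τλ` of a morphism `λ` of `R̃_X`-modules. -/
noncomputable def TildeMod.Hom.tau {M N : TildeMod.{u, v} n X} (f : M.Hom N) :
    M.tau.Hom N.tau where
  app U := { f.fam U with map_smul' := fun r s => f.fam_tauHom U r s }
  app_res h s := Subtype.ext (funext fun k => f.app_res h (s.1 k))

/-- The natural morphism `^τM → ℂ[τ, τ⁻¹] ⊗ 𝓜`. -/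
noncomputable def TildeMod.clsTau (M : TildeMod.{u, v} n X) (U : Opens X) :
    M.tau.obj U →+ M.fibre.fam.obj U :=
  famMap M.cls (fun h m => (M.cls_res h m).symm) U

/-- An increasing exhaustive filtration, indexed by `ℤ`, of a `𝒟_X`-module `Q` by subsheaves
`F_k Q` such that `F_j 𝒟_X · F_k Q ⊆ F_{k+j} Q`. -/
structure DFiltration (Q : ModSheaf.{u, v, u} (DPsh n X)) where
  step : ℤ → SubSheaf Q.toAbSheaf
  mono : ∀ {j k : ℤ}, j ≤ k → ∀ U, (step j).carrier U ≤ (step k).carrier U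
  smul_mem : ∀ {U : Opens X} (j : ℕ) (P : EndO n U) (hP : P ∈ FD n U j) (k : ℤ) (s : Q.obj U),
    s ∈ (step k).carrier U →
      (⟨P, ⟨j, hP⟩⟩ : diffOp n U) • s ∈ (step (k + j)).carrier U
  exhaustive : ∀ (U : Opens X) (s : Q.obj U), Q.Loc (fun W t => ∃ k, t ∈ (step k).carrier W) s

/-- The Rees module `R_F Q = ⨁_k τ^k ⊗ F_k Q ⊆ ℂ[τ, τ⁻¹] ⊗ Q` over `R_F 𝒟_X`. -/
noncomputable def DFiltration.rees {Q : ModSheaf.{u, v, u} (DPsh n X)} (F : DFiltration Q) :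
    SubMod (Q.restrict (ReesPsh.toD n X)).laurent where
  carrier U :=
    { carrier := {s | ∀ k, s.1 k ∈ (F.step k).carrier U}
      zero_mem' := fun k => zero_mem _
      add_mem' := fun hs ht k => add_mem (hs k) (ht k)
      neg_mem' := fun hs k => neg_mem (hs k) }
  res_mem h _ hs k := (F.step k).res_mem h (hs k)
  of_loc {U s} hs k := (F.step k).of_loc fun x hx => by
    obtain ⟨V, h, hV, e⟩ := hs x hx
    exact ⟨V, h, hV, e k⟩
  smul_mem {U} r s hs := by
    change Rees (FD n U) at r
    change ∀ k, (grHom (Q.restrict (ReesPsh.toD n X)) U r s).1 k ∈ (F.step k).carrier U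
    induction r using Rees.induct with
    | h0 => intro k; rw [map_zero]; exact zero_mem _
    | h j P =>
      intro k
      rw [grHom_of, grEnd_apply]
      have h1 := F.smul_mem j P.1 P.2 (k - j) (s.1 (k - j)) (hs (k - j))
      rw [sub_add_cancel] at h1
      have e : (ReesPsh.toD n X).app U (Rees.of (FD n U) j P) = ⟨P.1, ⟨j, P.2⟩⟩ :=
        Subtype.ext (Rees.toAlg_of j P)
      change (ReesPsh.toD n X).app U (Rees.of (FD n U) j P) • s.1 (k - j) ∈ _
      rw [e]
      exact h1
    | hadd a b ha hb =>
      intro k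
      rw [map_add]
      exact add_mem (ha k) (hb k)

/-- The filtration `F` is coherent: the Rees module `R_F Q` is a coherent `R_F 𝒟_X`-module. -/
def DFiltration.IsCoherent {Q : ModSheaf.{u, v, u} (DPsh n X)} (F : DFiltration Q) : Prop :=
  F.rees.toMod.Coherent

/-- `R_F 𝓜 = i^*_{τ=ħ} N`, as a submodule of `ℂ[τ, τ⁻¹] ⊗ 𝓜`, where `N ⊆ ^τM` and
`i^*_{τ=ħ} N = N / (τ - ħ)N`: the natural morphism `N → ℂ[τ, τ⁻¹] ⊗ 𝓜` has kernel `(τ - ħ)N` and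
image `R_F 𝓜`. -/
def IsReesOf (M : TildeMod.{u, v} n X) (N : SubMod (M.tau.restrict (zeroToLoc n X)))
    (F : DFiltration M.fibre) : Prop :=
  (∀ (U : Opens X) (m : M.tau.obj U), m ∈ N.carrier U → (M.clsTau U m = 0 ↔
    M.tau.Loc (fun W t => ∃ m' : M.tau.obj W, m' ∈ N.carrier W ∧
      t = (tauPow 1 - ofCoef hbar : TauLoc (Rees (FD n W))) • m') m)) ∧
  ∀ (U : Opens X) (s : M.fibre.fam.obj U), s ∈ F.rees.carrier U ↔
    M.fibre.fam.Loc (fun W t => ∃ m ∈ N.carrier W, M.clsTau W m = t) s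

/-- `N ⊆ ^τM` is coherent over `^τR'_X`. -/
def PrimeCoherent {T : ModSheaf.{u, v, u} (TauLocPsh n X)}
    (N : SubMod (T.restrict (zeroToLoc n X))) : Prop :=
  (N.restrict (primeToZero n X)).toMod.Coherent

/-- `N ⊆ ^τM` is `τ`-graded. -/
def IsTauGraded (M : TildeMod.{u, v} n X) (N : SubMod (M.tau.restrict (zeroToLoc n X))) : Prop :=
  ∀ (U : Opens X) (s : M.tau.obj U), s ∈ N.carrier U →
    ∀ k : ℤ, famSingle M.toModSheaf.toAbSheaf U k (s.1 k) ∈ N.carrier U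

/-- `(τ - ħ)N = N ∩ (τ - ħ)T`. -/
def IsTauHbarSaturated {T : ModSheaf.{u, v, u} (TauLocPsh n X)}
    (N : SubMod (T.restrict (zeroToLoc n X))) : Prop :=
  ∀ (U : Opens X) (s : T.obj U),
    T.Loc (fun W t => ∃ m : T.obj W, m ∈ N.carrier W ∧
      t = (tauPow 1 - ofCoef hbar : TauLoc (Rees (FD n W))) • m) s ↔
    s ∈ N.carrier U ∧ T.Loc (fun W t => ∃ m : T.obj W,
      t = (tauPow 1 - ofCoef hbar : TauLoc (Rees (FD n W))) • m) s

end Filtrations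
/-! ### The localization `𝒪_X[τ, τ⁻¹, ħ] ⊗ N` -/

section Localization

open HasHbar

/-- The morphism `A[τ, τ⁻¹] → S[τ, τ⁻¹]⟨τð_τ⟩` induced by a morphism `A → S`. -/
noncomputable def laurentToLoc {A : Type v} {S : Type w} [CommRing A] [Ring S] [HasHbar S]
    (f : A →+* S) : LaurentPolynomial A →+* TauLoc S :=
  AddMonoidAlgebra.liftNCRingHom (ofCoef.comp f)
    { toFun := fun k : Multiplicative ℤ => tauPow k.toAdd
      map_one' := rfl
      map_mul' := fun _ _ => tauPow_add _ _ }
    fun _ _ => ofCoef_comm_tauPow _ _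

lemma laurentToLoc_toLaurent {A : Type v} {S : Type w} [CommRing A] [Ring S] [HasHbar S]
    (f : A →+* S) (p : Polynomial A) :
    laurentToLoc f (Polynomial.toLaurent p) = (polyToZero (p.map f)).1 := by
  induction p using Polynomial.induction_on' with
  | add p q hp hq => rw [map_add, map_add, hp, hq, Polynomial.map_add, map_add, Subring.coe_add]
  | monomial k a =>
    have e : ∀ k : ℕ, tauPow (S := S) (k : ℤ) = tauPow 1 ^ k := by
      intro k
      induction k with
      | zero => rfl
      | succ k ih => rw [pow_succ, ← ih, ← tauPow_add]; rfl
    rw [Polynomial.map_monomial, polyToZero_monomial, Subring.coe_mul, Subring.coe_pow, ← e,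
      ← Polynomial.C_mul_X_pow_eq_monomial, Polynomial.toLaurent_C_mul_X_pow, map_mul]
    congr 1
    · change AddMonoidAlgebra.liftNC _ _ (AddMonoidAlgebra.single _ _) = _
      rw [AddMonoidAlgebra.liftNC_single]
      exact mul_one _
    · change AddMonoidAlgebra.liftNC _ _ (AddMonoidAlgebra.single _ _) = _
      rw [AddMonoidAlgebra.liftNC_single]
      change ofCoef (f 1) * tauPow (k : ℤ) = _
      rw [map_one, map_one, one_mul]

variable {n : ℕ} {X : Type u} [TopologicalSpace X] [ChartedSpace (EuclideanSpace ℂ (Fin n)) X]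

lemma mulHol_mem {U : Opens X} (f : Hol n U) : mulHol n f ∈ FD n U 0 := by
  intro V h g
  refine Subtype.ext (funext fun W => LinearMap.ext fun t => ?_)
  change Hol.res n (W.2.trans h) f * (Hol.res n W.2 g * t) -
    Hol.res n W.2 g * (Hol.res n (W.2.trans h) f * t) = 0
  ring

/-- The morphism `𝒪_X → R_X`. -/
noncomputable def holToRees (U : Opens X) : Hol n U →+* Rees (FD n U) where
  toFun f := Rees.of (FD n U) 0 ⟨mulHol n f, mulHol_mem f⟩
  map_one' := Rees.of_congr rfl _ _ (Subtype.ext (funext fun W => LinearMap.ext fun t => by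
    change Hol.res n W.2 1 * t = t
    rw [map_one, one_mul]))
  map_mul' f g := by
    rw [Rees.of_mul_of]
    refine Rees.of_congr rfl _ _ (Subtype.ext (funext fun W => LinearMap.ext fun t => ?_))
    change Hol.res n W.2 (f * g) * t = Hol.res n W.2 f * (Hol.res n W.2 g * t)
    rw [map_mul, mul_assoc]
  map_zero' := by
    refine (congrArg _ (Subtype.ext (Subtype.ext (funext fun W => LinearMap.ext fun t => ?_)))).trans
      (map_zero (Rees.of (FD n U) 0))
    change Hol.res n W.2 0 * t = 0
    rw [map_zero, zero_mul]
  map_add' f g := by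
    rw [← map_add]
    refine Rees.of_congr rfl _ _ (Subtype.ext (funext fun W => LinearMap.ext fun t => ?_))
    change Hol.res n W.2 (f + g) * t = Hol.res n W.2 f * t + Hol.res n W.2 g * t
    rw [map_add, add_mul]

variable (n) in
/-- The ring `𝒪_X[ħ]`. -/
abbrev HolHbar (U : Opens X) : Type u := Polynomial (Hol n U)

/-- The morphism `𝒪_X[ħ] → R_X`. -/
noncomputable def holHbarToRees (U : Opens X) : HolHbar n U →+* Rees (FD n U) :=
  Polynomial.eval₂RingHom' (holToRees U) hbar fun _ => HasHbar.comm _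

/-- The morphism `𝒪_X[τ, ħ] → V_0(^τR_X(*τ))`. -/
noncomputable def holTauToZero (U : Opens X) :
    Polynomial (HolHbar n U) →+* tauZero (Rees (FD n U)) :=
  polyToZero.comp (Polynomial.mapRingHom (holHbarToRees U))

/-- The morphism `𝒪_X[τ, τ⁻¹, ħ] → ^τR_X(*τ)`. -/
noncomputable def holTauToLoc (U : Opens X) :
    LaurentPolynomial (HolHbar n U) →+* TauLoc (Rees (FD n U)) :=
  laurentToLoc (holHbarToRees U)

lemma holTauToLoc_toLaurent (U : Opens X) (p : Polynomial (HolHbar n U)) :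
    holTauToLoc U (Polynomial.toLaurent p) = (holTauToZero U p).1 :=
  laurentToLoc_toLaurent (holHbarToRees U) p

variable {T : ModSheaf.{u, v, u} (TauLocPsh n X)}

noncomputable instance (N : SubMod (T.restrict (zeroToLoc n X))) (U : Opens X) :
    Module (Polynomial (HolHbar n U)) (N.toMod.obj U) :=
  Module.compHom (N.toMod.obj U) (holTauToZero U : _ →+* tauZero (Rees (FD n U)))

/-- The natural map `𝒪_X[τ, τ⁻¹, ħ] ⊗_{𝒪_X[τ, ħ]} N → T` on the sections over `U`, for a submodule
`N` of `T`. -/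
noncomputable def localizeMap (N : SubMod (T.restrict (zeroToLoc n X))) (U : Opens X) :
    TensorProduct (Polynomial (HolHbar n U)) (LaurentPolynomial (HolHbar n U)) (N.toMod.obj U) →+
      T.obj U :=
  TensorProduct.liftAddHom
    { toFun := fun r => (DistribSMul.toAddMonoidHom (T.obj U) (holTauToLoc U r)).comp
        (N.carrier U).subtype
      map_zero' := by
        refine AddMonoidHom.ext fun s : N.carrier U => ?_
        change holTauToLoc (n := n) U 0 • (s.1 : T.obj U) = 0
        rw [map_zero]
        exact zero_smul (TauLoc (Rees (FD n U))) (s.1 : T.obj U)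
      map_add' := fun r r' => by
        refine AddMonoidHom.ext fun s : N.carrier U => ?_
        change holTauToLoc U (r + r') • (s.1 : T.obj U) = holTauToLoc U r • s.1 + holTauToLoc U r' • s.1
        rw [map_add, add_smul] }
    fun p r s => by
      change holTauToLoc U (Polynomial.toLaurent p * r) • s.1 =
        holTauToLoc U r • (holTauToZero U p).1 • s.1
      rw [mul_comm, map_mul, mul_smul, holTauToLoc_toLaurent]

/-- `𝒪_X[τ, τ⁻¹, ħ] ⊗_{𝒪_X[τ, ħ]} N = T`: the natural morphism (from the presheaf tensor product) is
injective and locally surjective, so that it induces an isomorphism on the associated sheaves. -/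
def IsTauLattice (N : SubMod (T.restrict (zeroToLoc n X))) : Prop :=
  (∀ U : Opens X, Function.Injective (localizeMap N U)) ∧
    ∀ (U : Opens X) (s : T.obj U), T.Loc (fun W t => ∃ z, localizeMap N W z = t) s

end Localization

end IrrHodge

open IrrHodge

/-!
Write `T = ^τM` and `eul a = τð_τ + aħ`. Everything is deduced from two mechanisms, and neither the
strictness of `M` or of `coker λ` nor the coherence of `M` over `R_X` enters.

*Descent.* The index set `A + ℤ` is well-ordered above each real number
(`wellBounded_addInt`), so a section belongs to `V_a` as soon as, for every `b > a`, being in `V_b`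
forces it to be in `V_{<b}` (`IsVFiltration.mem_step_of_descent`).

*Coprimality.* Near a point, some product of operators `eul c`, `d < c ≤ a`, maps `V_a` into `V_d`
(`IsVFiltration.exists_eul_prod_mem`). If a class on which `ħ` is injective is killed by a power of
`eul b` and by such a product with all `c ≠ b`, it is zero, because `eul b - eul c = (b - c)ħ`
(`mem_of_eul_pow_of_prod`).

Together they show that a map `T → T'` which is linear up to an automorphism scaling `τð_τ` and `ħ`
by the same constant preserves the `V`-filtrations (`SemilinHom.app_mem_step`). This is applied to
`^τλ`, and to the automorphism `τ^k ⊗ m ↦ c^k τ^k ⊗ m`: a submodule stable by it for `c = 2` is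
graded, so `V_a` is `τ`-graded (`IsVFiltration.isTauGraded`). Saturation with respect to `τ - ħ` is
a descent: if `(τ - ħ)s ∈ V_a` and `s ∈ V_b` with `b > a`, then `ħs ∈ V_{<b}`, since
`τs ∈ V_{b-1}`.

If some `V_a` is coherent over `^τR'_X`, all are: `V_{a+k} = τ^{-k}V_a`, and `V_a` is generated over
`^τR'_X` by a smaller `V_c` and by the images of generators over `V_0` by partial products of
operators `eul c` (`IsVFiltration.primeCoherent`). As `V_a` is graded, the image of `V_a` in
`ℂ[τ, τ⁻¹] ⊗ 𝓜` is determined by its components, the classes of the `m` such that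
`τ^k ⊗ m ∈ V_a` (`TildeMod.irrStep`). This gives the filtration and its uniqueness
(`IsReesOf.step_eq`), and it is coherent because its Rees module is the quotient of `V_a` by
`(τ - ħ)V_a` (`IsReesOf.isCoherent`).

For a strictly specializable `φ = ^τλ`, a simultaneous induction on the index shows that `ħ` is
injective on `V'_b / (φ(V_b) + V'_c)` and that `V'_a ∩ φ(T) ⊆ φ(V_a) + V'_c` for all `c ≤ a`
(`IsSpecializableHom.mem_mapAdd_of_hbar`, `IsSpecializableHom.app_mem_mapAdd`). A descent then shows
that `τ - ħ` is injective on `T' / (φ(T) + V'_a)` (`IsSpecializableHom.mem_of_tau_sub_hbar`). Since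
`V'_a` is of finite type over `^τR'_X`, on which no operator lowers the degree, the terms `V'_c` have
no component of a given degree if `c` is small (`SubMod.FG.exists_apply_eq_zero`). Taking the
component of degree `k` modulo `τ - ħ`, one gets that `λ|_{ħ=1}` is strictly filtered
(`IsSpecializableHom.loc_inImage_iff`).
-/

namespace IrrHodge

/-! ### Local membership -/

section Loc

universe v'

variable {X : Type u} [TopologicalSpace X]

lemma AbSheaf.Loc.mono {M : AbSheaf.{u, v} X} {p q : ∀ W : Opens X, M.obj W → Prop}
    {U : Opens X} {s : M.obj U} (hs : M.Loc p s) (h : ∀ W t, p W t → q W t) : M.Loc q s := by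
  intro x hx
  obtain ⟨W, k, hW, e⟩ := hs x hx
  exact ⟨W, k, hW, h _ _ e⟩

lemma AbSheaf.Loc.of_self {M : AbSheaf.{u, v} X} {p : ∀ W : Opens X, M.obj W → Prop}
    {U : Opens X} {s : M.obj U} (hs : p U s) : M.Loc p s :=
  fun x hx => ⟨U, le_rfl, hx, by rwa [M.res_id]⟩

lemma AbSheaf.Loc.bind {M : AbSheaf.{u, v} X} {p q : ∀ W : Opens X, M.obj W → Prop}
    {U : Opens X} {s : M.obj U} (hs : M.Loc p s) (h : ∀ W t, p W t → M.Loc q t) : M.Loc q s := by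
  intro x hx
  obtain ⟨W, k, hW, e⟩ := hs x hx
  obtain ⟨Z, l, hZ, e⟩ := h _ _ e x hW
  exact ⟨Z, l.trans k, hZ, by rwa [M.res_res] at e⟩

/-- A property of sections is stable if it is inherited by restrictions. -/
def AbSheaf.Stable (M : AbSheaf.{u, v} X) (p : ∀ W : Opens X, M.obj W → Prop) : Prop :=
  ∀ {U V : Opens X} (h : V ≤ U) (s : M.obj U), p U s → p V (M.res h s)

/-- A stable property of a section may be added to a local one. -/
lemma AbSheaf.Loc.and_stable {M : AbSheaf.{u, v} X} {p q : ∀ W : Opens X, M.obj W → Prop}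
    {U : Opens X} {s : M.obj U} (hs : M.Loc p s) (hq : M.Stable q) (h : q U s) :
    M.Loc (fun W t => p W t ∧ q W t) s := by
  intro x hx
  obtain ⟨W, k, hW, e⟩ := hs x hx
  exact ⟨W, k, hW, e, hq k _ h⟩

lemma SubSheaf.stable {M : AbSheaf.{u, v} X} (N : SubSheaf M) :
    M.Stable fun W s => s ∈ N.carrier W := fun h _ hs => N.res_mem h hs

/-- To show that a section belongs to a subsheaf, one may replace it with its restrictions to small
open sets. -/
lemma SubSheaf.mem_of_loc {M : AbSheaf.{u, v} X} (N : SubSheaf M)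
    {p : ∀ W : Opens X, M.obj W → Prop} {U : Opens X} {s : M.obj U} (hs : M.Loc p s)
    (h : ∀ W t, p W t → t ∈ N.carrier W) : s ∈ N.carrier U :=
  N.of_loc (hs.mono h)

/-- A variant of `SubSheaf.mem_of_loc` where the local property holds on a neighbourhood of each
point, whatever the section. -/
lemma SubSheaf.mem_of_nhds {M : AbSheaf.{u, v} X} (N : SubSheaf M) {U : Opens X} {s : M.obj U}
    (h : ∀ x ∈ U, ∃ W : Opens X, x ∈ W ∧ ∀ (Z : Opens X) (_ : Z ≤ W) (l : Z ≤ U),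
      M.res l s ∈ N.carrier Z) : s ∈ N.carrier U := by
  refine N.of_loc fun x hx => ?_
  obtain ⟨W, hW, e⟩ := h x hx
  exact ⟨W ⊓ U, inf_le_right, ⟨hW, hx⟩, e _ inf_le_left _⟩

lemma SubSheaf.ext {M : AbSheaf.{u, v} X} {N N' : SubSheaf M}
    (h : ∀ U s, s ∈ N.carrier U ↔ s ∈ N'.carrier U) : N = N' := by
  obtain ⟨c, _, _⟩ := N
  obtain ⟨c', _, _⟩ := N'
  obtain rfl : c = c' := funext fun U => AddSubgroup.ext (h U)
  rfl

end Loc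

/-! ### Finite type and coherence of submodules -/

section Coherence

universe v'

variable {X : Type u} [TopologicalSpace X] {R : RingPsh.{u, w} X}

/-- The relations between the sections `m i` over `U` are of finite type over `R`. -/
def ModSheaf.FiniteRel (M : ModSheaf.{u, v, w} R) (U : Opens X) {q : ℕ} (m : Fin q → M.obj U) :
    Prop :=
  ∀ x ∈ U, ∃ (V : Opens X) (h : V ≤ U), x ∈ V ∧ ∃ (p : ℕ) (g : Fin p → Fin q → R.obj V),
      (∀ j, ∑ i, g j i • M.res h (m i) = 0) ∧
      ∀ (W : Opens X) (k : W ≤ V) (r : Fin q → R.obj W),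
        ∑ i, r i • M.res (k.trans h) (m i) = 0 →
        ∀ y ∈ W, ∃ (Z : Opens X) (l : Z ≤ W), y ∈ Z ∧ ∃ c : Fin p → R.obj Z,
          ∀ i, R.res l (r i) = ∑ j, c j * R.res (l.trans k) (g j i)

/-- The sheaf of submodules `N` is of finite type: the condition `N.toMod.FiniteType` in terms of
the sections of the ambient sheaf, with generators indexed by a finite type. -/
def SubMod.FG {M : ModSheaf.{u, v, w} R} (N : SubMod M) : Prop :=
  ∀ x : X, ∃ V : Opens X, x ∈ V ∧ ∃ (p : ℕ) (g : Fin p → M.obj V),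
    (∀ i, g i ∈ N.carrier V) ∧ ∀ W ≤ V, ∀ s ∈ N.carrier W,
      M.Loc (fun Z t => ∃ (k : Z ≤ V) (r : Fin p → R.obj Z), t = ∑ i, r i • M.res k (g i)) s

lemma SubMod.coe_sum_smul {M : ModSheaf.{u, v, w} R} (N : SubMod M) {U : Opens X} {ι : Type*}
    (I : Finset ι) (r : ι → R.obj U) (s : ι → N.toMod.obj U) :
    ((∑ i ∈ I, r i • s i : N.toMod.obj U) : N.carrier U).1 =
      ∑ i ∈ I, r i • ((s i : N.carrier U).1 : M.obj U) :=
  map_sum (N.carrier U).subtype _ _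

lemma SubMod.toMod_finiteType_iff {M : ModSheaf.{u, v, w} R} (N : SubMod M) :
    N.toMod.FiniteType ↔ N.FG := by
  constructor
  · intro H x
    obtain ⟨V, hV, p, g, e⟩ := H x
    refine ⟨V, hV, p, fun i => (g i : N.carrier V).1, fun i => (g i : N.carrier V).2,
      fun W hW s hs y hy => ?_⟩
    obtain ⟨Z, k, hZ, l, r, er⟩ := e W hW (⟨s, hs⟩ : N.carrier W) y hy
    refine ⟨Z, k, hZ, l, r, ?_⟩
    exact (congrArg Subtype.val er).trans (N.coe_sum_smul _ _ _)
  · intro H x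
    obtain ⟨V, hV, p, g, hg, e⟩ := H x
    refine ⟨V, hV, p, fun i => (⟨g i, hg i⟩ : N.carrier V), fun W hW s y hy => ?_⟩
    obtain ⟨Z, k, hZ, l, r, er⟩ := e W hW (s : N.carrier W).1 (s : N.carrier W).2 y hy
    refine ⟨Z, k, hZ, l, r, Subtype.ext ?_⟩
    exact er.trans (N.coe_sum_smul Finset.univ r
      (fun i => N.toMod.res l (⟨g i, hg i⟩ : N.carrier V))).symm

lemma SubMod.toMod_finiteRel_iff {M : ModSheaf.{u, v, w} R} (N : SubMod M) {U : Opens X} {q : ℕ}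
    (m : Fin q → N.toMod.obj U) :
    N.toMod.FiniteRel U m ↔ M.FiniteRel U fun i => (m i : N.carrier U).1 := by
  have key : ∀ {V W : Opens X} (h : V ≤ U) (r : Fin q → R.obj V),
      ∑ i, r i • N.toMod.res h (m i) = 0 ↔ ∑ i, r i • M.res h (m i : N.carrier U).1 = 0 := by
    intro V W h r
    have e := N.coe_sum_smul Finset.univ r (fun i => N.toMod.res h (m i))
    constructor
    · intro H
      exact e.symm.trans (congrArg Subtype.val H)
    · intro H
      exact Subtype.ext (e.trans H)
  constructor
  · intro H x hx
    obtain ⟨V, h, hV, p, g, e, e'⟩ := H x hx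
    exact ⟨V, h, hV, p, g, fun j => (key (W := V) h _).1 (e j),
      fun W k r hr => e' W k r ((key (W := V) _ _).2 hr)⟩
  · intro H x hx
    obtain ⟨V, h, hV, p, g, e, e'⟩ := H x hx
    exact ⟨V, h, hV, p, g, fun j => (key (W := V) h _).2 (e j),
      fun W k r hr => e' W k r ((key (W := V) _ _).1 hr)⟩

lemma SubMod.toMod_coherent_iff {M : ModSheaf.{u, v, w} R} (N : SubMod M) :
    N.toMod.Coherent ↔ N.FG ∧ ∀ (U : Opens X) (q : ℕ) (m : Fin q → M.obj U),
      (∀ i, m i ∈ N.carrier U) → M.FiniteRel U m := by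
  refine and_congr N.toMod_finiteType_iff ⟨fun H U q m hm => ?_, fun H U q m => ?_⟩
  · exact (N.toMod_finiteRel_iff fun i => (⟨m i, hm i⟩ : N.carrier U)).1
      (H U q fun i => (⟨m i, hm i⟩ : N.carrier U))
  · exact (N.toMod_finiteRel_iff m).2 (H U q _ fun i => (m i : N.carrier U).2)

/-- A submodule of finite type of a coherent module is coherent. -/
lemma SubMod.coherent_of_le {M : ModSheaf.{u, v, w} R} {N N' : SubMod M}
    (h : ∀ U, N.carrier U ≤ N'.carrier U) (hN : N.FG) (hN' : N'.toMod.Coherent) :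
    N.toMod.Coherent :=
  N.toMod_coherent_iff.2 ⟨hN, fun U q m hm => (N'.toMod_coherent_iff.1 hN').2 U q m
    fun i => h U (hm i)⟩

lemma ModSheaf.finiteRel_of_res {M : ModSheaf.{u, v, w} R} {U : Opens X} {q : ℕ}
    {m : Fin q → M.obj U} (H : ∀ x ∈ U, ∃ (W : Opens X) (k : W ≤ U), x ∈ W ∧
      M.FiniteRel W fun i => M.res k (m i)) : M.FiniteRel U m := by
  intro x hx
  obtain ⟨W, k, hW, e⟩ := H x hx
  obtain ⟨V, h, hV, p, g, e1, e2⟩ := e x hW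
  simp only [M.res_res] at e1 e2
  exact ⟨V, h.trans k, hV, p, g, e1, e2⟩

/-- Coherence is a local property. -/
lemma SubMod.coherent_of_locally_eq {M : ModSheaf.{u, v, w} R} {N : SubMod M}
    (H : ∀ x : X, ∃ W : Opens X, x ∈ W ∧ ∃ N' : SubMod M, N'.toMod.Coherent ∧
      ∀ Z ≤ W, N.carrier Z = N'.carrier Z) : N.toMod.Coherent := by
  refine N.toMod_coherent_iff.2 ⟨fun x => ?_, fun U q m hm => ?_⟩
  · obtain ⟨W, hW, N', hN', e⟩ := H x
    obtain ⟨V, hV, p, g, hg, e'⟩ := (N'.toMod_coherent_iff.1 hN').1 x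
    refine ⟨V ⊓ W, ⟨hV, hW⟩, p, fun i => M.res inf_le_left (g i), fun i => ?_, ?_⟩
    · rw [e _ inf_le_right]
      exact N'.res_mem _ (hg i)
    · intro Y hY s hs
      rw [e _ (hY.trans inf_le_right)] at hs
      intro y hy
      obtain ⟨Z, k, hZ, l, r, er⟩ := e' Y (hY.trans inf_le_left) s hs y hy
      refine ⟨Z, k, hZ, k.trans hY, r, ?_⟩
      simp only [M.res_res]
      exact er
  · refine ModSheaf.finiteRel_of_res fun x hx => ?_
    obtain ⟨W, hW, N', hN', e⟩ := H x
    refine ⟨W ⊓ U, inf_le_right, ⟨hW, hx⟩, (N'.toMod_coherent_iff.1 hN').2 _ _ _ fun i => ?_⟩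
    rw [← e _ inf_le_left]
    exact N.res_mem _ (hm i)

/-- Coherence of submodules is preserved by the automorphisms of the ambient module. -/
lemma SubMod.coherent_of_equiv {M : ModSheaf.{u, v, w} R} {N N' : SubMod M}
    (e e' : M.Hom M) (h : ∀ U s, e.app U (e'.app U s) = s) (h' : ∀ U s, e'.app U (e.app U s) = s)
    (hN' : ∀ U s, s ∈ N'.carrier U ↔ e.app U s ∈ N.carrier U) (hN : N.toMod.Coherent) :
    N'.toMod.Coherent := by
  obtain ⟨hN1, hN2⟩ := N.toMod_coherent_iff.1 hN
  have key : ∀ (U : Opens X) (q : ℕ) (r : Fin q → R.obj U) (m : Fin q → M.obj U),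
      e.app U (∑ i, r i • m i) = ∑ i, r i • e.app U (m i) := fun U q r m => by
    rw [map_sum]; exact Finset.sum_congr rfl fun i _ => (e.app U).map_smul _ _
  have key' : ∀ (U : Opens X) (q : ℕ) (r : Fin q → R.obj U) (m : Fin q → M.obj U),
      e'.app U (∑ i, r i • m i) = ∑ i, r i • e'.app U (m i) := fun U q r m => by
    rw [map_sum]; exact Finset.sum_congr rfl fun i _ => (e'.app U).map_smul _ _
  refine N'.toMod_coherent_iff.2 ⟨fun x => ?_, fun U q m hm x hx => ?_⟩
  · obtain ⟨V, hV, p, g, hg, H⟩ := hN1 x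
    refine ⟨V, hV, p, fun i => e'.app V (g i), fun i => ?_, fun W hW s hs y hy => ?_⟩
    · rw [hN', h]; exact hg i
    · obtain ⟨Z, k, hZ, l, r, er⟩ := H W hW _ ((hN' W s).1 hs) y hy
      refine ⟨Z, k, hZ, l, r, ?_⟩
      have := congrArg (e'.app Z) er
      rw [← e.app_res, h', key'] at this
      simpa only [e'.app_res] using this
  · obtain ⟨V, k, hV, p, g, e1, e2⟩ := hN2 U q (fun i => e.app U (m i))
      (fun i => (hN' U _).1 (hm i)) x hx
    simp only [← e.app_res, ← key] at e1 e2
    refine ⟨V, k, hV, p, g, fun j => ?_, fun W l r hr => e2 W l r ?_⟩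
    · have := congrArg (e'.app V) (e1 j)
      rwa [h', map_zero] at this
    · rw [hr, map_zero]

end Coherence

/-! ### The term `V_{<a}` of a filtration -/

section LtSub

variable {X : Type u} [TopologicalSpace X] {R : RingPsh.{u, w} X} {T : ModSheaf.{u, v, w} R}

/-- `V_{<a}`, as a sheaf of submodules of the ambient module. -/
def IncFilt.ltSub (V : IncFilt T) (a : ℝ) : SubMod T :=
  SubMod.gen T
    (fun U =>
      { carrier := {s | ∃ b < a, s ∈ (V.step b).carrier U}
        zero_mem' := ⟨a - 1, by linarith, zero_mem _⟩
        add_mem' := fun {s t} ⟨b, hb, hs⟩ ⟨c, hc, ht⟩ => ⟨max b c, max_lt hb hc,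
          add_mem (V.mono (le_max_left b c) U hs) (V.mono (le_max_right b c) U ht)⟩
        neg_mem' := fun ⟨b, hb, hs⟩ => ⟨b, hb, neg_mem hs⟩ })
    (fun h _ ⟨b, hb, hs⟩ => ⟨b, hb, (V.step b).res_mem h hs⟩)
    (fun r _ ⟨b, hb, hs⟩ => ⟨b, hb, (V.step b).smul_mem r hs⟩)

lemma IncFilt.mem_ltSub_of_lt {V : IncFilt T} {a b : ℝ} (h : b < a) {U : Opens X} {s : T.obj U}
    (hs : s ∈ (V.step b).carrier U) : s ∈ (V.ltSub a).carrier U :=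
  AbSheaf.Loc.of_self (M := T.toAbSheaf) ⟨b, h, hs⟩

lemma IncFilt.grMk_eq_zero {V : IncFilt T} {a : ℝ} {U : Opens X} (s : (V.step a).carrier U) :
    V.grMk a U s = 0 ↔ s.1 ∈ (V.ltSub a).carrier U :=
  quotMk_eq_zero _ _

end LtSub

/-! ### The operators `τð_τ + aħ` -/

section Euler

open HasHbar

variable {S : Type w} [Ring S] [HasHbar S]

lemma coefZ_hbar_comm_theta : Commute (coefZ (hbar : S)) (thetaZ : tauZero S) :=
  Subtype.ext (ofCoef_comm_theta _).eq

/-- `ħ`, as an element of `V_0`. -/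
noncomputable def hbarZ : tauZero S := coefZ hbar

/-- An induction principle for `V_0 = S[τ]⟨τð_τ⟩`. -/
lemma tauZero_induct {P : TauLoc S → Prop} {r : TauLoc S} (hr : r ∈ tauZero S)
    (hC : ∀ a, P (ofCoef a)) (hX : P theta) (hT : P (tauPow 1))
    (hadd : ∀ a b, P a → P b → P (a + b)) (hmul : ∀ a b, P a → P b → P (a * b)) : P r := by
  have hpoly : ∀ p : Polynomial S, P (ofTheta p) := by
    intro p
    induction p using Polynomial.induction_on with
    | C a => exact hC a
    | add p q hp hq => rw [map_add]; exact hadd _ _ hp hq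
    | monomial k a h =>
      rw [pow_succ, ← mul_assoc, map_mul]
      exact hmul _ _ h hX
  have hpow : ∀ k : ℕ, P (tauPow k) := by
    intro k
    induction k with
    | zero => exact hC 1
    | succ k ih => rw [Nat.cast_succ, tauPow_add]; exact hmul _ _ ih hT
  rw [← SkewMonoidAlgebra.sum_single r, SkewMonoidAlgebra.sum_def']
  refine Finset.sum_induction _ P hadd (by simpa using hC 0) fun k hk => ?_
  rw [single_eq, ← Int.toNat_of_nonneg (hr k hk)]
  exact hmul _ _ (hpoly _) (hpow _)

variable [Algebra ℂ S]

/-- A complex number, as an element of `V_0`. -/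
noncomputable def scalZ (c : ℂ) : tauZero S := coefZ (algebraMap ℂ S c)

variable (S) in
/-- The operator `τð_τ + aħ`. -/
noncomputable def eul (a : ℝ) : tauZero S := thetaZ + scalZ (a : ℂ) * hbarZ

lemma scalZ_comm_hbarZ (c : ℂ) : Commute (scalZ c : tauZero S) hbarZ :=
  (HasHbar.comm (algebraMap ℂ S c)).map coefZ

lemma scalZ_comm_thetaZ (c : ℂ) : Commute (scalZ c : tauZero S) thetaZ :=
  Subtype.ext (ofCoef_comm_theta _).eq

lemma scalZ_comm_eul (c : ℂ) (a : ℝ) : Commute (scalZ c) (eul S a) := by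
  refine (scalZ_comm_thetaZ c).add_right (Commute.mul_right ?_ (scalZ_comm_hbarZ c))
  exact (Commute.all c (a : ℂ)).map ((coefZ (S := S)).comp (algebraMap ℂ S))

lemma hbarZ_comm_eul (a : ℝ) : Commute hbarZ (eul S a) :=
  coefZ_hbar_comm_theta.add_right ((scalZ_comm_hbarZ _).symm.mul_right (Commute.refl _))

lemma eul_comm_eul (a b : ℝ) : Commute (eul S a) (eul S b) := by
  refine Commute.add_left (a := (thetaZ : tauZero S)) ?_
    (Commute.mul_left (scalZ_comm_eul _ _) (hbarZ_comm_eul _))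
  exact (Commute.refl _).add_right ((scalZ_comm_thetaZ _).symm.mul_right coefZ_hbar_comm_theta.symm)

lemma scalZ_mul (c d : ℂ) : (scalZ c * scalZ d : tauZero S) = scalZ (c * d) := by
  rw [scalZ, scalZ, scalZ, ← map_mul, ← map_mul]

lemma scalZ_one : (scalZ 1 : tauZero S) = 1 := by rw [scalZ, map_one, map_one]

lemma eul_eq (a c : ℝ) : eul S a = eul S c + scalZ ((a - c : ℝ) : ℂ) * hbarZ := by
  rw [eul, eul, add_assoc, ← add_mul, scalZ, scalZ, scalZ, ← map_add, ← map_add]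
  congr 5
  push_cast
  ring

/-- If `ħ` is injective on `D / I`, and the class of `s ∈ D` is killed by a power of `τð_τ + bħ` and
by a product of operators `τð_τ + cħ` with `c ≠ b`, then `s ∈ I`: modulo the ideal generated by two
coprime such products a power of `ħ` vanishes. -/
lemma mem_of_eul_pow_of_prod {E : Type*} [AddCommGroup E] [Module (tauZero S) E]
    (D I : Submodule (tauZero S) E)
    (hI : ∀ y ∈ D, (hbarZ : tauZero S) • y ∈ I → y ∈ I) {b : ℝ} {N : ℕ} {L : List ℝ}
    (hL : ∀ c ∈ L, c ≠ b) {s : E} (hs : s ∈ D) (h1 : eul S b ^ N • s ∈ I)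
    (h2 : (L.map (eul S)).prod • s ∈ I) : s ∈ I := by
  have step : ∀ (c : ℝ), c ≠ b → ∀ (N : ℕ) (y : E), y ∈ D → eul S b ^ N • y ∈ I →
      eul S c • y ∈ I → y ∈ I := by
    intro c hc N
    induction N with
    | zero => intro y _ h _; simpa using h
    | succ N ih =>
      intro y hy h h'
      refine ih y hy (hI _ (D.smul_mem _ hy) ?_) h'
      have e : eul S b ^ (N + 1) • y = eul S b ^ N • eul S c • y +
          (scalZ ((b - c : ℝ) : ℂ) : tauZero S) • (hbarZ : tauZero S) • eul S b ^ N • y := by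
        have e1 : eul S b • y = eul S c • y +
            (scalZ ((b - c : ℝ) : ℂ) * hbarZ : tauZero S) • y := by rw [eul_eq b c, add_smul]
        rw [pow_succ, mul_smul, e1, smul_add]
        congr 1
        rw [← mul_smul, ← mul_smul, ← mul_smul, ← mul_assoc,
          ← ((scalZ_comm_eul _ b).pow_right N).eq, mul_assoc, mul_assoc,
          ((hbarZ_comm_eul b).pow_right N).eq]
      have h3 : (scalZ ((b - c : ℝ) : ℂ) : tauZero S) • (hbarZ : tauZero S) • eul S b ^ N • y ∈ I := by
        rw [e] at h
        exact (I.add_mem_iff_right (I.smul_mem _ h')).1 h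
      have h4 := I.smul_mem (scalZ (((b - c : ℝ) : ℂ)⁻¹)) h3
      rwa [← mul_smul, scalZ_mul, inv_mul_cancel₀, scalZ_one, one_smul] at h4
      exact_mod_cast sub_ne_zero.2 hc.symm
  induction L with
  | nil => simpa using h2
  | cons c L ih =>
    refine ih (fun c hc => hL c (List.mem_cons_of_mem _ hc)) ?_
    refine step c (hL c List.mem_cons_self) N _ (D.smul_mem _ hs) ?_ ?_
    · have : Commute (eul S b ^ N) (L.map (eul S)).prod :=
        (Commute.list_prod_right _ _ fun x hx => by
          obtain ⟨c, _, rfl⟩ := List.mem_map.1 hx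
          exact eul_comm_eul _ _).pow_left N
      rw [← mul_smul, this.eq, mul_smul]
      exact I.smul_mem _ h1
    · rwa [← mul_smul, ← List.prod_cons, ← List.map_cons]

end Euler

/-! ### The set of indices -/

section Indices

lemma addInt_add {A : Set ℝ} {a : ℝ} (ha : a ∈ addInt A) (k : ℤ) : a + k ∈ addInt A := by
  obtain ⟨α, hα, j, rfl⟩ := ha
  exact ⟨α, hα, j + k, by push_cast; ring⟩

lemma addInt_sub {A : Set ℝ} {a : ℝ} (ha : a ∈ addInt A) (k : ℤ) : a - k ∈ addInt A := by
  simpa [sub_eq_add_neg] using addInt_add ha (-k)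

lemma addInt_mono {A B : Set ℝ} (h : A ⊆ B) : addInt A ⊆ addInt B :=
  fun _ ⟨α, hα, k, e⟩ => ⟨α, h hα, k, e⟩

/-- A set of indices is well-ordered above each real number: every accumulation point is a limit of
smaller indices, since `A` accumulates at most at `1`. -/
def WellBounded (J : Set ℝ) : Prop := ∀ c : ℝ, (J ∩ Ioi c).IsWF

lemma WellBounded.union {J J' : Set ℝ} (h : WellBounded J) (h' : WellBounded J') :
    WellBounded (J ∪ J') := fun c => by
  rw [union_inter_distrib_right]
  exact (h c).union (h' c)

lemma wellBounded_addInt {A : Set ℝ} (hA : A ⊆ Ico 0 1)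
    (hd : ∀ r ∈ Ico (0 : ℝ) 1, ¬ AccPt r (Filter.principal A)) : WellBounded (addInt A) := by
  intro c
  rw [Set.IsWF, Set.wellFoundedOn_iff_no_descending_seq]
  rintro f hf
  -- a decreasing bounded sequence of indices converges from above
  have hanti : StrictAnti f := fun i j h => f.map_rel_iff.2 h
  have hbdd : BddBelow (range f) := ⟨c, by rintro _ ⟨i, rfl⟩; exact (hf i).2.le⟩
  have hlim := tendsto_atTop_ciInf hanti.antitone hbdd
  set r := ⨅ i, f i with hr
  have hgt : ∀ i, r < f i := fun i => (ciInf_le hbdd (i + 1)).trans_lt (hanti (Nat.lt_succ_self i))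
  refine hd (Int.fract r) ⟨Int.fract_nonneg r, Int.fract_lt_one r⟩ ?_
  rw [accPt_iff_frequently]
  have h1 : Filter.Tendsto (fun i => f i - ⌊r⌋) Filter.atTop (nhds (Int.fract r)) :=
    hlim.sub_const _
  have h2 : ∀ᶠ i in Filter.atTop, f i - ⌊r⌋ ≠ Int.fract r ∧ f i - ⌊r⌋ ∈ A := by
    have : ∀ᶠ i in Filter.atTop, f i < ⌊r⌋ + 1 := hlim.eventually_lt_const (Int.lt_floor_add_one r)
    filter_upwards [this] with i hi
    refine ⟨fun e => (hgt i).ne' (by rw [Int.fract] at e; linarith), ?_⟩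
    obtain ⟨α, hα, k, e⟩ := (hf i).1
    have hk : k = ⌊r⌋ := by
      have h0 := hA hα
      have h3 : (k : ℝ) < ⌊r⌋ + 1 := by have := h0.1; linarith
      have h4 : (⌊r⌋ : ℝ) < k + 1 := by
        have := h0.2; have := hgt i; have := Int.floor_le r; linarith
      have h5 : k < ⌊r⌋ + 1 := by exact_mod_cast h3
      have h6 : ⌊r⌋ < k + 1 := by exact_mod_cast h4
      omega
    rw [e, hk, add_sub_cancel_right]
    exact hα
  exact h1.frequently h2.frequently

/-- Well-founded induction over the indices. -/
lemma WellBounded.induction {J : Set ℝ} (hJ : WellBounded J) (c : ℝ) {P : ℝ → Prop}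
    (base : ∀ b ∈ J, b ≤ c → P b) (step : ∀ b ∈ J, c < b → (∀ b' ∈ J, b' < b → P b') → P b) :
    ∀ b ∈ J, P b := by
  intro b hb
  rcases le_or_gt b c with h | h
  · exact base b hb h
  · refine Set.WellFoundedOn.induction (hJ c) (P := P) ⟨hb, h⟩ fun y hy ih => step y hy.1 hy.2 ?_
    intro b' hb' hlt
    rcases le_or_gt b' c with h | h
    · exact base b' hb' h
    · exact ih b' ⟨hb', h⟩ hlt

/-- Only finitely many elements of `B + ℤ` lie in a bounded interval, if `B` is finite. -/
lemma finite_addInt_inter {B : Set ℝ} (hB : B.Finite) (c d : ℝ) : (addInt B ∩ Ioc c d).Finite := by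
  have : addInt B ∩ Ioc c d ⊆ ⋃ α ∈ B, (fun k : ℤ => α + (k : ℝ)) '' Icc ⌊c - α⌋ ⌈d - α⌉ := by
    rintro _ ⟨⟨α, hα, k, rfl⟩, h⟩
    refine mem_biUnion hα ⟨k, ⟨?_, ?_⟩, rfl⟩
    · have h1 := h.1
      have : (⌊c - α⌋ : ℝ) ≤ k := (Int.floor_le _).trans (by linarith)
      exact_mod_cast this
    · have h1 := h.2
      have : (k : ℝ) ≤ ⌈d - α⌉ := le_trans (by linarith) (Int.le_ceil _)
      exact_mod_cast this
  exact (hB.biUnion fun α _ => (finite_Icc _ _).image _).subset this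

end Indices

/-! ### `V`-filtrations with real indices -/

section VFiltration

open HasHbar

variable {n : ℕ} {X : Type u} [TopologicalSpace X] [ChartedSpace (EuclideanSpace ℂ (Fin n)) X]
  {T : ModSheaf.{u, v, u} (TauLocPsh n X)}

/-- The sections over `U` of a sheaf of `V_0`-submodules of `T`. -/
def SubMod.sec (N : SubMod (T.restrict (zeroToLoc n X))) (U : Opens X) :
    Submodule (tauZero (Rees (FD n U))) (T.obj U) where
  carrier := N.carrier U
  add_mem' := add_mem
  zero_mem' := zero_mem _
  smul_mem' r _ hs := N.smul_mem r hs

lemma SubMod.mem_sec {N : SubMod (T.restrict (zeroToLoc n X))} {U : Opens X} {s : T.obj U} :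
    s ∈ N.sec U ↔ s ∈ N.carrier U := Iff.rfl

lemma res_tau_smul {U V : Opens X} (h : V ≤ U) (r : TauLoc (Rees (FD n U))) (s : T.obj U) :
    T.res h (r • s) = tauRes n h r • T.res h s := T.res_smul h r s

lemma tauRes_hbar {U V : Opens X} (h : V ≤ U) :
    tauRes n h (hbarZ : tauZero (Rees (FD n U))).1 = (hbarZ : tauZero (Rees (FD n V))).1 :=
  (tauRes_coef n h _).trans (congrArg _ (reesRes_hbar n h))

lemma reesRes_algebraMap {U V : Opens X} (h : V ≤ U) (c : ℂ) :
    reesRes n h (algebraMap ℂ (Rees (FD n U)) c) = algebraMap ℂ (Rees (FD n V)) c := by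
  refine (reesRes_of n h 0 _).trans ?_
  exact Rees.of_congr rfl _ _ ((EndO.res n h).commutes c)

lemma tauRes_scal {U V : Opens X} (h : V ≤ U) (c : ℂ) :
    tauRes n h (scalZ c : tauZero (Rees (FD n U))).1 = (scalZ c : tauZero (Rees (FD n V))).1 :=
  (tauRes_coef n h _).trans (congrArg _ (reesRes_algebraMap h c))

lemma tauRes_eul {U V : Opens X} (h : V ≤ U) (a : ℝ) :
    tauRes n h (eul (Rees (FD n U)) a).1 = (eul (Rees (FD n V)) a).1 := by
  refine (map_add _ _ _).trans (congrArg₂ _ (tauRes_theta n h) ?_)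
  exact (map_mul _ _ _).trans (congrArg₂ _ (tauRes_scal h _) (tauRes_hbar h))

lemma tauRes_eul_prod {U V : Opens X} (h : V ≤ U) (L : List ℝ) :
    tauRes n h (L.map (eul (Rees (FD n U)))).prod.1 = (L.map (eul (Rees (FD n V)))).prod.1 := by
  induction L with
  | nil => exact map_one _
  | cons c L ih =>
    rw [List.map_cons, List.map_cons, List.prod_cons, List.prod_cons, Subring.coe_mul,
      Subring.coe_mul, map_mul, ih, tauRes_eul]

lemma res_eul_prod_smul {U V : Opens X} (h : V ≤ U) (L : List ℝ) (s : T.obj U) :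
    T.res h ((L.map (eul (Rees (FD n U)))).prod • s) =
      (L.map (eul (Rees (FD n V)))).prod • T.res h s :=
  (res_tau_smul h _ s).trans (congrArg (fun r : TauLoc (Rees (FD n V)) => r • T.res h s)
    (tauRes_eul_prod h L))

lemma res_tauPow_smul {U V : Opens X} (h : V ≤ U) (k : ℤ) (s : T.obj U) :
    T.res h ((tauPow k : TauLoc (Rees (FD n U))) • s) =
      (tauPow k : TauLoc (Rees (FD n V))) • T.res h s := by
  rw [res_tau_smul, tauRes_tauPow]

lemma tauPow_neg_smul {U : Opens X} (k : ℤ) (s : T.obj U) :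
    (tauPow (-k) : TauLoc (Rees (FD n U))) • (tauPow k : TauLoc (Rees (FD n U))) • s = s := by
  rw [← mul_smul, ← tauPow_add, neg_add_cancel]
  exact one_smul _ s

lemma tauPow_smul_neg {U : Opens X} (k : ℤ) (s : T.obj U) :
    (tauPow k : TauLoc (Rees (FD n U))) • (tauPow (-k) : TauLoc (Rees (FD n U))) • s = s := by
  rw [← mul_smul, ← tauPow_add, add_neg_cancel]
  exact one_smul _ s

variable {A : Set ℝ} {V : TauFilt T}

lemma grMk_smul (V : TauFilt T) {a : ℝ} {U : Opens X} (r : tauZero (Rees (FD n U))) {s : T.obj U}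
    (hs : s ∈ (V.step a).carrier U) :
    V.grMk a U ⟨r • s, (V.step a).smul_mem r hs⟩ = r • V.grMk a U ⟨s, hs⟩ :=
  (V.step a).toMod.proj_smul (V.lt a) U r ⟨s, hs⟩

namespace IsVFiltration

variable (hV : IsVFiltration T A V)
include hV

lemma wellBounded : WellBounded (addInt A) := wellBounded_addInt hV.subset hV.discrete

/-- The indices in the definition of `V_{<a}` may be taken in `A + ℤ`. -/
lemma loc_of_mem_ltSub {a : ℝ} {U : Opens X} {s : T.obj U} (hs : s ∈ (V.ltSub a).carrier U) :
    T.Loc (fun W t => ∃ b ∈ addInt A, b < a ∧ t ∈ (V.step b).carrier W) s :=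
  AbSheaf.Loc.bind hs fun W t ⟨b, hb, ht⟩ =>
    AbSheaf.Loc.mono (hV.step_eq b W t ht) fun _ _ ⟨c, hc, hcb, h⟩ => ⟨c, hc, hcb.trans_lt hb, h⟩

/-- `V_a = V_{<a}` if `a` is not in `A + ℤ`. -/
lemma mem_ltSub_of_notMem {a : ℝ} (ha : a ∉ addInt A) {U : Opens X} {s : T.obj U}
    (hs : s ∈ (V.step a).carrier U) : s ∈ (V.ltSub a).carrier U :=
  AbSheaf.Loc.mono (hV.step_eq a U s hs) fun _ _ ⟨c, hc, hca, h⟩ =>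
    ⟨c, lt_of_le_of_ne hca fun e => ha (e ▸ hc), h⟩

/-- `V_{a+k} = τ^{-k} V_a` for every real number `a`. -/
lemma mem_step_add_iff (a : ℝ) (k : ℤ) {U : Opens X} {s : T.obj U} :
    s ∈ (V.step (a + k)).carrier U ↔
      (tauPow k : TauLoc (Rees (FD n U))) • s ∈ (V.step a).carrier U := by
  have key : ∀ (a : ℝ) (k : ℤ) (U : Opens X) (s : T.obj U), s ∈ (V.step (a + k)).carrier U →
      (tauPow k : TauLoc (Rees (FD n U))) • s ∈ (V.step a).carrier U := by
    intro a k U s hs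
    refine (V.step a).of_loc fun x hx => ?_
    obtain ⟨W, h, hW, b, hb, hba, e⟩ := hV.step_eq _ U s hs x hx
    refine ⟨W, h, hW, ?_⟩
    obtain ⟨t, ht, e⟩ := (hV.step_add (b - k) (addInt_sub hb k) k W _).1 (by rwa [sub_add_cancel])
    have e' : T.res h ((tauPow k : TauLoc (Rees (FD n U))) • s) = t := by
      rw [res_tauPow_smul]
      refine (congrArg _ e).trans ?_
      exact tauPow_smul_neg k t
    refine (congrArg (· ∈ (V.step a).carrier W) e').mpr ?_
    exact V.mono (by linarith) W ht
  refine ⟨key a k U s, fun h => ?_⟩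
  have := key (a + k) (-k) U ((tauPow k : TauLoc (Rees (FD n U))) • s) (by
    push_cast; rwa [add_neg_cancel_right])
  rwa [tauPow_neg_smul] at this

lemma tauPow_smul_mem_iff (a : ℝ) (k : ℤ) {U : Opens X} {s : T.obj U} :
    (tauPow k : TauLoc (Rees (FD n U))) • s ∈ (V.step (a - k)).carrier U ↔
      s ∈ (V.step a).carrier U := by
  rw [← hV.mem_step_add_iff, sub_add_cancel]

/-- `τ^k V_a ⊆ V_b` if `a - k ≤ b`. -/
lemma tauPow_smul_mem {a b : ℝ} {k : ℤ} (h : a - k ≤ b) {U : Opens X} {s : T.obj U}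
    (hs : s ∈ (V.step a).carrier U) :
    (tauPow k : TauLoc (Rees (FD n U))) • s ∈ (V.step b).carrier U :=
  V.mono h U ((hV.tauPow_smul_mem_iff a k).2 hs)

lemma exists_eul_pow_mem (a : ℝ) (x : X) : ∃ W : Opens X, x ∈ W ∧ ∃ N : ℕ, ∀ Z ≤ W,
    ∀ s ∈ (V.step a).carrier Z,
      eul (Rees (FD n Z)) a ^ N • (s : T.obj Z) ∈ (V.ltSub a).carrier Z := by
  by_cases ha : a ∈ addInt A
  · obtain ⟨W, hW, N, e⟩ := hV.nilpotent a ha x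
    refine ⟨W, hW, N, fun Z hZ s hs => ?_⟩
    have h1 := e Z hZ (V.grMk a Z ⟨s, hs⟩)
    have e0 : thetaZ + coefZ (algebraMap ℂ (Rees (FD n Z)) (a : ℂ) * hbar) = eul (Rees (FD n Z)) a := by
      rw [eul, scalZ, hbarZ, map_mul]
    rw [e0] at h1
    exact (V.grMk_eq_zero _).1 ((grMk_smul V _ hs).trans h1)
  · refine ⟨⊤, trivial, 0, fun Z _ s hs => ?_⟩
    rw [pow_zero, one_smul]
    exact hV.mem_ltSub_of_notMem ha hs

lemma mem_ltSub_of_hbar {a : ℝ} {U : Opens X} {s : T.obj U} (hs : s ∈ (V.step a).carrier U)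
    (h : (hbarZ : tauZero (Rees (FD n U))) • s ∈ (V.ltSub a).carrier U) :
    s ∈ (V.ltSub a).carrier U := by
  by_cases ha : a ∈ addInt A
  · refine (V.grMk_eq_zero ⟨s, hs⟩).1 (hV.hbar_injective a ha U _ ?_)
    exact (grMk_smul V _ hs).symm.trans ((V.grMk_eq_zero _).2 h)
  · exact hV.mem_ltSub_of_notMem ha hs

/-- If a stable property forces the local sections of `V_b` into `V_{<b}` for each `b > a`, then the
sections which have it are in `V_a`: the indices above `a` are well-ordered. -/
lemma mem_step_of_descent {a : ℝ} {p : ∀ W : Opens X, T.obj W → Prop} (hp : T.Stable p)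
    (h : ∀ b ∈ addInt A, a < b → ∀ (W : Opens X) (t : T.obj W), p W t →
      t ∈ (V.step b).carrier W → t ∈ (V.ltSub b).carrier W)
    {U : Opens X} {s : T.obj U} (hs : p U s) : s ∈ (V.step a).carrier U := by
  have key : ∀ b ∈ addInt A, ∀ (W : Opens X) (t : T.obj W), p W t →
      t ∈ (V.step b).carrier W → t ∈ (V.step a).carrier W := by
    refine hV.wellBounded.induction a (fun b _ hba W t _ ht => V.mono hba W ht) ?_
    intro b hb hab ih W t hpt ht
    refine (V.step a).mem_of_loc
      (AbSheaf.Loc.and_stable (hV.loc_of_mem_ltSub (h b hb hab W t hpt ht)) hp hpt) ?_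
    rintro Z t ⟨⟨c, hc, hcb, hz⟩, hpz⟩
    exact ih c hc hcb Z t hpz hz
  refine (V.step a).mem_of_loc (AbSheaf.Loc.and_stable (hV.exhaustive U s) hp hs) ?_
  rintro Z t ⟨⟨c, hc, hz⟩, hpz⟩
  exact key c hc Z t hpz hz

/-- Near each point the jumps of the filtration are in `B + ℤ` for some finite set `B`. -/
lemma exists_finite_jumps [LocallyCompactSpace X] (x : X) : ∃ W : Opens X, x ∈ W ∧
    ∃ B ⊆ A, B.Finite ∧ ∀ a ∉ addInt B, ∀ Z ≤ W, ∀ s ∈ (V.step a).carrier Z,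
      s ∈ (V.ltSub a).carrier Z := by
  obtain ⟨K, hK, hxK⟩ := exists_compact_mem_nhds x
  obtain ⟨W, hWK, hWo, hxW⟩ := mem_nhds_iff.1 hxK
  obtain ⟨B, hBA, hB, e⟩ := hV.locFinite K hK
  refine ⟨⟨W, hWo⟩, hxW, B, hBA, hB, fun a ha Z hZ s hs => ?_⟩
  by_cases haA : a ∈ addInt A
  · refine (V.grMk_eq_zero ⟨s, hs⟩).1 ((V.gr a).sep _ fun y hy => ?_)
    obtain ⟨Y, h, hY, e⟩ := e a haA ha y (hWK (hZ hy)) Z hy (V.grMk a Z ⟨s, hs⟩)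
    exact ⟨Y, h, hY, e⟩
  · exact hV.mem_ltSub_of_notMem haA hs

/-- The filtration is constant between two consecutive jumps. -/
lemma step_le_of_no_jump {B : Set ℝ} {W : Opens X}
    (hB : ∀ a ∉ addInt B, ∀ Z ≤ W, ∀ s ∈ (V.step a).carrier Z, s ∈ (V.ltSub a).carrier Z)
    {a b : ℝ} (h : ∀ c ∈ addInt B, c ≤ a → c ≤ b) {Z : Opens X} (hZ : Z ≤ W) {s : T.obj Z}
    (hs : s ∈ (V.step a).carrier Z) : s ∈ (V.step b).carrier Z := by
  refine hV.mem_step_of_descent (p := fun Y t => Y ≤ W ∧ t ∈ (V.step a).carrier Y)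
    (fun k _ h => ⟨k.trans h.1, (V.step a).res_mem k h.2⟩) ?_ ⟨hZ, hs⟩
  rintro c _ hbc Y t ⟨hY, ht⟩ htc
  by_cases hcB : c ∈ addInt B
  · refine V.mem_ltSub_of_lt ?_ ht
    by_contra hca
    exact absurd (h c hcB (not_lt.1 hca)) (not_le.2 hbc)
  · exact hB c hcB Y hY t htc

/-- Every term of the filtration is locally equal to a term with index in `A + ℤ`. -/
lemma exists_addInt_step_eq [LocallyCompactSpace X] (a : ℝ) (x : X) : ∃ W : Opens X, x ∈ W ∧
    ∃ b ∈ addInt A, ∀ Z ≤ W, (V.step a).carrier Z = (V.step b).carrier Z := by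
  obtain ⟨W, hW, B, hBA, hB, e⟩ := hV.exists_finite_jumps x
  have hA : A.Nonempty := by
    obtain ⟨Z, _, _, _, ⟨α, hα, _⟩, _⟩ := hV.exhaustive W 0 x hW
    exact ⟨α, hα⟩
  obtain ⟨α, hα⟩ := hA
  -- `b` is the largest index below `a` in `B' + ℤ`
  set B' := insert α B with hB'
  have hfin : (addInt B' ∩ Ioc (a - 2) a).Finite := finite_addInt_inter (hB.insert α) _ _
  have hne : (addInt B' ∩ Ioc (a - 2) a).Nonempty := by
    refine ⟨α + ⌊a - α⌋, ⟨α, mem_insert _ _, _, rfl⟩, ?_, ?_⟩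
    · have := Int.lt_floor_add_one (a - α); linarith
    · have := Int.floor_le (a - α); linarith
  obtain ⟨b, ⟨hb, hb1⟩, hmax⟩ := hfin.exists_maximal hne
  refine ⟨W, hW, b, addInt_mono (insert_subset hα hBA) hb, fun Z hZ => le_antisymm ?_
    (V.mono hb1.2 Z)⟩
  intro s hs
  refine hV.step_le_of_no_jump e (fun c hc hca => ?_) hZ hs
  by_contra hcb
  have hcb := not_le.1 hcb
  exact absurd (hmax ⟨addInt_mono (subset_insert _ _) hc, hb1.1.trans hcb, hca⟩ hcb.le)
    (not_le.2 hcb)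

lemma coherent_step [LocallyCompactSpace X] (a : ℝ) : (V.step a).toMod.Coherent :=
  SubMod.coherent_of_locally_eq fun x => by
    obtain ⟨W, hW, b, hb, e⟩ := hV.exists_addInt_step_eq a x
    exact ⟨W, hW, V.step b, hV.coherent b hb, e⟩

/-- Locally, a product of operators `τð_τ + cħ` with `d < c ≤ a` maps `V_a` to `V_d`. -/
lemma exists_eul_prod_mem [LocallyCompactSpace X] (a d : ℝ) (x : X) : ∃ W : Opens X, x ∈ W ∧
    ∃ L : List ℝ, (∀ c ∈ L, d < c ∧ c ≤ a) ∧ ∀ Z ≤ W, ∀ s ∈ (V.step a).carrier Z,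
      (L.map (eul (Rees (FD n Z)))).prod • (s : T.obj Z) ∈ (V.step d).carrier Z := by
  obtain ⟨W₀, hW₀, B, -, hB, e⟩ := hV.exists_finite_jumps x
  have hfin := finite_addInt_inter hB d a
  have key : ∀ S : Finset ℝ, (∀ c ∈ S, d < c) → ∃ W ≤ W₀, x ∈ W ∧ ∃ L : List ℝ,
      (∀ c ∈ L, c ∈ S) ∧ ∀ b : ℝ, addInt B ∩ Ioc d b ⊆ S → ∀ Z ≤ W, ∀ s ∈ (V.step b).carrier Z,
        (L.map (eul (Rees (FD n Z)))).prod • (s : T.obj Z) ∈ (V.step d).carrier Z := by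
    intro S
    induction S using Finset.induction_on_max with
    | empty =>
      refine fun _ => ⟨W₀, le_rfl, hW₀, [], by simp, fun b hb Z hZ s hs => ?_⟩
      rw [List.map_nil, List.prod_nil, one_smul]
      refine hV.step_le_of_no_jump e (fun c hc hcb => ?_) hZ hs
      by_contra hcd
      exact absurd (hb ⟨hc, not_le.1 hcd, hcb⟩) (by simp)
    | insert c S hmax ih =>
      intro hS
      obtain ⟨W, hWW₀, hW, L, hL, H⟩ := ih fun y hy => hS y (Finset.mem_insert_of_mem hy)
      obtain ⟨W', hW', N, H'⟩ := hV.exists_eul_pow_mem c x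
      refine ⟨W ⊓ W', inf_le_left.trans hWW₀, ⟨hW, hW'⟩, L ++ List.replicate N c, ?_, ?_⟩
      · intro c' hc'
        rcases List.mem_append.1 hc' with h | h
        · exact Finset.mem_insert_of_mem (hL _ h)
        · exact (List.eq_of_mem_replicate h) ▸ Finset.mem_insert_self _ _
      · intro b hb Z hZ s hs
        rw [List.map_append, List.prod_append, mul_smul, List.map_replicate, List.prod_replicate]
        rcases lt_or_ge b c with hbc | hbc
        · refine H b (fun y hy => ?_) Z (hZ.trans inf_le_left) _ ((V.step b).smul_mem _ hs)
          rcases Finset.mem_insert.1 (hb hy) with rfl | h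
          · exact absurd hy.2.2 (not_le.2 hbc)
          · exact h
        · have hs' : s ∈ (V.step c).carrier Z := by
            refine hV.step_le_of_no_jump e (fun y hy hyb => ?_)
              ((hZ.trans inf_le_left).trans hWW₀) hs
            rcases le_or_gt y d with hyd | hyd
            · exact hyd.trans (hS c (Finset.mem_insert_self _ _)).le
            · rcases Finset.mem_insert.1 (hb ⟨hy, hyd, hyb⟩) with rfl | h
              · exact le_rfl
              · exact (hmax y h).le
          refine (V.step d).of_loc fun y hy => ?_
          obtain ⟨Y, h, hY, r, hr, e'⟩ := H' Z (hZ.trans inf_le_right) s hs' y hy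
          refine ⟨Y, h, hY, ?_⟩
          refine (congrArg (· ∈ (V.step d).carrier Y) (res_eul_prod_smul h L _)).mpr ?_
          refine H r (fun z hz => ?_) Y ((h.trans hZ).trans inf_le_left) _ e'
          rcases Finset.mem_insert.1 (hb ⟨hz.1, hz.2.1, hz.2.2.trans (hr.le.trans hbc)⟩) with
            rfl | h
          · exact absurd hr (not_lt.2 hz.2.2)
          · exact h
  obtain ⟨W, -, hW, L, hL, H⟩ := key hfin.toFinset fun c hc => (hfin.mem_toFinset.1 hc).2.1
  exact ⟨W, hW, L, fun c hc => (hfin.mem_toFinset.1 (hL c hc)).2,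
    H a fun c hc => hfin.mem_toFinset.2 hc⟩

end IsVFiltration

end VFiltration

/-! ### Semilinear maps are compatible with the `V`-filtrations -/

section Comparison

open HasHbar

variable {n : ℕ} {X : Type u} [TopologicalSpace X] [ChartedSpace (EuclideanSpace ℂ (Fin n)) X]
  {T T' : ModSheaf.{u, v, u} (TauLocPsh n X)}

/-- An additive morphism `φ : T → T'` which is linear up to an automorphism of the ring
`^τR_X(*τ)` which preserves `V_0` and multiplies `τð_τ` and `ħ` with the same constant. Only the
consequences of the existence of such an automorphism are recorded. -/
structure SemilinHom (T T' : ModSheaf.{u, v, u} (TauLocPsh n X)) where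
  app : ∀ U, T.obj U →+ T'.obj U
  app_res : ∀ {U V : Opens X} (h : V ≤ U) (s : T.obj U), app V (T.res h s) = T'.res h (app U s)
  scal : ℂ
  app_smul : ∀ (U : Opens X) (r : tauZero (Rees (FD n U))), ∃ r' : tauZero (Rees (FD n U)),
    ∀ s : T.obj U, app U (r • s) = r' • app U s
  app_tauPow : ∀ (U : Opens X) (k : ℕ), ∃ r' : tauZero (Rees (FD n U)), ∀ s : T.obj U,
    app U ((tauPow (k : ℤ) : TauLoc (Rees (FD n U))) • s) =
      r' • (tauPow (k : ℤ) : TauLoc (Rees (FD n U))) • app U s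
  eul_app : ∀ (U : Opens X) (c : ℝ) (s : T.obj U), eul (Rees (FD n U)) c • app U s =
    app U ((scalZ scal : tauZero (Rees (FD n U))) • eul (Rees (FD n U)) c • s)

/-- A linear morphism is semilinear. -/
noncomputable def ModSheaf.Hom.toSemilin (f : T.Hom T') : SemilinHom T T' where
  app U := (f.app U).toAddMonoidHom
  app_res h s := f.app_res h s
  scal := 1
  app_smul U r := ⟨r, fun s => (f.app U).map_smul (r.1 : TauLoc (Rees (FD n U))) s⟩
  app_tauPow U k := ⟨1, fun s => by
    rw [one_smul]
    exact (f.app U).map_smul (tauPow (k : ℤ) : TauLoc (Rees (FD n U))) s⟩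
  eul_app U c s := by
    rw [scalZ_one, one_smul]
    exact ((f.app U).map_smul ((eul (Rees (FD n U)) c).1 : TauLoc (Rees (FD n U))) s).symm

lemma SemilinHom.eul_prod_app (φ : SemilinHom T T') (U : Opens X) (L : List ℝ) (s : T.obj U) :
    ∃ c : ℂ, (L.map (eul (Rees (FD n U)))).prod • φ.app U s =
      φ.app U ((scalZ c : tauZero (Rees (FD n U))) • (L.map (eul (Rees (FD n U)))).prod • s) := by
  induction L with
  | nil => exact ⟨1, by rw [List.map_nil, List.prod_nil, scalZ_one, one_smul, one_smul, one_smul]⟩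
  | cons a L ih =>
    obtain ⟨c, hc⟩ := ih
    refine ⟨φ.scal * c, ?_⟩
    rw [List.map_cons, List.prod_cons, mul_smul, hc, φ.eul_app, ← scalZ_mul]
    congr 1
    rw [← mul_smul, ← mul_smul, ← mul_smul, ← mul_smul, mul_assoc (scalZ φ.scal),
      ← (scalZ_comm_eul c a).eq]
    simp only [mul_assoc]

variable {A A' : Set ℝ} {V : TauFilt T} {V' : TauFilt T'}

/-- A semilinear morphism maps `V_a` to some `V'_b` near each point, since `V_a` is of finite
type. -/
lemma SemilinHom.exists_app_mem (φ : SemilinHom T T') {N : SubMod (T.restrict (zeroToLoc n X))}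
    (hN : N.FG) (hV' : IsVFiltration T' A' V') (x : X) :
    ∃ W : Opens X, x ∈ W ∧ ∃ b : ℝ, ∀ Z ≤ W, ∀ s ∈ N.carrier Z,
      φ.app Z s ∈ (V'.step b).carrier Z := by
  obtain ⟨W, hW, p, g, hg, H⟩ := hN x
  have key : ∀ I : Finset (Fin p), ∃ (Y : Opens X) (h : Y ≤ W), x ∈ Y ∧ ∃ b : ℝ, ∀ i ∈ I,
      T'.res h (φ.app W (g i)) ∈ (V'.step b).carrier Y := by
    intro I
    induction I using Finset.induction_on with
    | empty => exact ⟨W, le_rfl, hW, 0, by simp⟩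
    | insert i I _ ih =>
      obtain ⟨Y, h, hY, b, e⟩ := ih
      obtain ⟨Y', h', hY', b', -, e'⟩ := hV'.exhaustive W (φ.app W (g i)) x hW
      refine ⟨Y ⊓ Y', inf_le_left.trans h, ⟨hY, hY'⟩, max b b', fun j hj => ?_⟩
      rcases Finset.mem_insert.1 hj with rfl | hj
      · have := (V'.step b').res_mem (inf_le_right : Y ⊓ Y' ≤ Y') e'
        rw [AbSheaf.res_res] at this
        exact V'.mono (le_max_right _ _) _ this
      · have := (V'.step b).res_mem (inf_le_left : Y ⊓ Y' ≤ Y) (e j hj)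
        rw [AbSheaf.res_res] at this
        exact V'.mono (le_max_left _ _) _ this
  obtain ⟨Y, h, hY, b, e⟩ := key Finset.univ
  refine ⟨Y, hY, b, fun Z hZ s hs => (V'.step b).of_loc fun y hy => ?_⟩
  obtain ⟨Z', k, hZ', l, r, er⟩ := H Z (hZ.trans h) s hs y hy
  refine ⟨Z', k, hZ', ?_⟩
  change T'.res k (φ.app Z s) ∈ _
  rw [← φ.app_res, show T.res k s = _ from er, map_sum]
  refine sum_mem fun i _ => ?_
  obtain ⟨r', hr'⟩ := φ.app_smul Z' (r i)
  refine (congrArg (· ∈ (V'.step b).carrier Z') (hr' _)).mpr ?_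
  refine (V'.step b).smul_mem r' ?_
  have := (V'.step b).res_mem (k.trans hZ) (e i (Finset.mem_univ i))
  rw [AbSheaf.res_res] at this
  rw [show φ.app Z' ((T.restrict (zeroToLoc n X)).res l (g i)) = _ from φ.app_res l (g i)]
  exact this

/-- Semilinear morphisms preserve the `V`-filtrations. For `s ∈ V_a`, a product of operators
`τð_τ + cħ`, `c ≤ a`, maps `s` to `V_{a-ℓ} = τ^ℓ V_a`, hence maps `φ(s)` to `V'_a` if `ℓ` is large;
this is incompatible with a nonzero class of `φ(s)` in `gr_b^{V'}` for `b > a`. -/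
theorem SemilinHom.app_mem_step [LocallyCompactSpace X] (φ : SemilinHom T T')
    (hV : IsVFiltration T A V) (hV' : IsVFiltration T' A' V') (a : ℝ) {U : Opens X} {s : T.obj U}
    (hs : s ∈ (V.step a).carrier U) : φ.app U s ∈ (V'.step a).carrier U := by
  refine (V'.step a).mem_of_nhds fun x hx => ?_
  obtain ⟨W₁, hW₁, b₀, H₁⟩ := φ.exists_app_mem
    ((V.step a).toMod_coherent_iff.1 (hV.coherent_step a)).1 hV' x
  obtain ⟨l, hl⟩ := exists_nat_ge (b₀ - a)
  obtain ⟨W₂, hW₂, L, hL, H₂⟩ := hV.exists_eul_prod_mem a (a - l) x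
  refine ⟨W₁ ⊓ W₂, ⟨hW₁, hW₂⟩, fun Z₀ hZ₀ l₀ => ?_⟩
  refine hV'.mem_step_of_descent
    (p := fun Z t => Z ≤ W₁ ⊓ W₂ ∧ ∃ s ∈ (V.step a).carrier Z, φ.app Z s = t) ?_ ?_
    ⟨hZ₀, T.res l₀ s, (V.step a).res_mem l₀ hs, φ.app_res l₀ s⟩
  · rintro Y Y' k _ ⟨hY, s, hs, rfl⟩
    exact ⟨k.trans hY, T.res k s, (V.step a).res_mem k hs, φ.app_res k s⟩
  rintro b - hab Z _ ⟨hZ, s, hs, rfl⟩ ht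
  refine (V'.ltSub b).mem_of_nhds fun y hy => ?_
  obtain ⟨W₃, hW₃, N, H₃⟩ := hV'.exists_eul_pow_mem b y
  refine ⟨W₃, hW₃, fun Y hY k => ?_⟩
  have hs' := (V.step a).res_mem k hs
  have ht' := (V'.step b).res_mem k ht
  change T'.res k (φ.app Z s) ∈ _
  change T'.res k (φ.app Z s) ∈ _ at ht'
  rw [← φ.app_res] at ht' ⊢
  refine mem_of_eul_pow_of_prod ((V'.step b).sec Y) ((V'.ltSub b).sec Y)
    (fun y hy h => hV'.mem_ltSub_of_hbar hy h) (L := L)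
    (fun c hc => ((hL c hc).2.trans_lt hab).ne) ht' (H₃ Y hY _ ht') ?_
  obtain ⟨c, hc⟩ := φ.eul_prod_app Y L (T.res k s)
  rw [hc]
  have h1 := H₂ Y (k.trans (hZ.trans inf_le_right)) _ hs'
  have h2 := (V.step (a - l)).smul_mem (scalZ c : tauZero (Rees (FD n Y))) h1
  -- `V_{a-l} = τ^l V_a` is mapped to `τ^l V'_{b₀}`
  obtain ⟨t, ht, e⟩ : ∃ t ∈ (V.step a).carrier Y,
      (scalZ c : tauZero (Rees (FD n Y))) • (L.map (eul (Rees (FD n Y)))).prod • T.res k s =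
        (tauPow (l : ℤ) : TauLoc (Rees (FD n Y))) • (t : T.obj Y) := by
    refine ⟨(tauPow (-(l : ℤ)) : TauLoc (Rees (FD n Y))) • ((scalZ c : tauZero (Rees (FD n Y))) •
      (L.map (eul (Rees (FD n Y)))).prod • T.res k s), ?_, (tauPow_smul_neg _ _).symm⟩
    exact hV.tauPow_smul_mem (by push_cast; linarith) h2
  obtain ⟨r', hr'⟩ := φ.app_tauPow Y l
  rw [e, hr']
  refine SubMod.mem_sec.2 (V'.mem_ltSub_of_lt (b := a) hab ((V'.step a).smul_mem r' ?_))
  refine hV'.tauPow_smul_mem ?_ (H₁ Y (k.trans (hZ.trans inf_le_left)) t ht)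
  push_cast
  linarith

end Comparison

/-! ### The grading of the rescaled module -/

section Components

open HasHbar

variable {n : ℕ} {X : Type u} [TopologicalSpace X] [ChartedSpace (EuclideanSpace ℂ (Fin n)) X]
  (M : TildeMod.{u, v} n X)

lemma tau_smul_def {U : Opens X} (r : TauLoc (Rees (FD n U))) (s : M.tau.obj U) :
    r • s = tauHom M U r s := rfl

lemma tau_ext {U : Opens X} {s t : M.tau.obj U} (h : ∀ k, s.1 k = t.1 k) : s = t :=
  Subtype.ext (funext h)

lemma tau_add_apply {U : Opens X} (s t : M.tau.obj U) (i : ℤ) : (s + t).1 i = s.1 i + t.1 i := rfl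

lemma tau_res_apply {U V : Opens X} (h : V ≤ U) (s : M.tau.obj U) (i : ℤ) :
    (M.tau.res h s).1 i = M.toModSheaf.res h (s.1 i) := rfl

lemma tau_coef_smul {U : Opens X} (r : Rees (FD n U)) (s : M.tau.obj U) :
    (ofCoef r : TauLoc (Rees (FD n U))) • s = grHom M.toModSheaf U r s := by
  rw [tau_smul_def, tauHom, TauLoc.lift_coef]

lemma tau_of_apply {U : Opens X} (k : ℕ) (P : FD n U k) (s : M.tau.obj U) (i : ℤ) :
    ((ofCoef (Rees.of (FD n U) k P) : TauLoc (Rees (FD n U))) • s).1 i =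
      Rees.of (FD n U) k P • s.1 (i - k) := by
  rw [tau_coef_smul, grHom_of]
  exact grEnd_apply M.toModSheaf U k P s i

lemma tau_theta_apply {U : Opens X} (s : M.tau.obj U) (i : ℤ) :
    ((theta : TauLoc (Rees (FD n U))) • s).1 i =
      (i - 1) • (hbar : Rees (FD n U)) • s.1 (i - 1) - M.del U (s.1 (i - 1)) := by
  rw [tau_smul_def, tauHom, TauLoc.lift_theta]
  exact thetaEnd_apply M U s i

lemma tau_tauPow_apply {U : Opens X} (k : ℤ) (s : M.tau.obj U) (i : ℤ) :
    ((tauPow k : TauLoc (Rees (FD n U))) • s).1 i = s.1 (i - k) := by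
  rw [tau_smul_def, tauHom, TauLoc.lift_tauPow]
  exact shiftEnd_apply M.toModSheaf.toAbSheaf U k s i

lemma tau_hbar_apply {U : Opens X} (s : M.tau.obj U) (i : ℤ) :
    ((ofCoef hbar : TauLoc (Rees (FD n U))) • s).1 i = (hbar : Rees (FD n U)) • s.1 (i - 1) := by
  rw [tau_coef_smul]
  exact grHom_hbar_apply M.toModSheaf U s i

lemma algebraMap_eq_of {U : Opens X} (c : ℂ) : algebraMap ℂ (Rees (FD n U)) c =
    Rees.of (FD n U) 0 ⟨algebraMap ℂ (EndO n U) c, SetLike.algebraMap_mem_graded (FD n U) c⟩ := rfl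

lemma tau_scal_apply {U : Opens X} (c : ℂ) (s : M.tau.obj U) (i : ℤ) :
    ((scalZ c : tauZero (Rees (FD n U))) • s).1 i = algebraMap ℂ (Rees (FD n U)) c • s.1 i := by
  refine (tau_of_apply M 0 _ s i).trans ?_
  rw [Nat.cast_zero, sub_zero]
  rfl

lemma tau_tau_sub_hbar_apply {U : Opens X} (s : M.tau.obj U) (i : ℤ) :
    ((tauPow 1 - ofCoef hbar : TauLoc (Rees (FD n U))) • s).1 i =
      s.1 (i - 1) - (hbar : Rees (FD n U)) • s.1 (i - 1) := by
  rw [sub_smul]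
  change ((tauPow 1 : TauLoc (Rees (FD n U))) • s).1 i -
    ((ofCoef hbar : TauLoc (Rees (FD n U))) • s).1 i = _
  rw [tau_tauPow_apply, tau_hbar_apply]

/-- The section `τ^k ⊗ m` of `^τM`. -/
noncomputable def TildeMod.single {U : Opens X} (k : ℤ) (m : M.toModSheaf.obj U) : M.tau.obj U :=
  famSingle M.toModSheaf.toAbSheaf U k m

lemma TildeMod.single_apply {U : Opens X} (k i : ℤ) (m : M.toModSheaf.obj U) :
    (M.single k m).1 i = if i = k then m else 0 := by
  change (Pi.single k m : ℤ → M.toModSheaf.obj U) i = _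
  rw [Pi.single_apply]

lemma TildeMod.single_apply_self {U : Opens X} (k : ℤ) (m : M.toModSheaf.obj U) :
    (M.single k m).1 k = m := by
  rw [M.single_apply, if_pos rfl]

lemma TildeMod.single_zero {U : Opens X} (k : ℤ) : M.single k (0 : M.toModSheaf.obj U) = 0 :=
  tau_ext M fun i => by rw [M.single_apply, ite_self]; rfl

lemma TildeMod.single_add {U : Opens X} (k : ℤ) (m m' : M.toModSheaf.obj U) :
    M.single k (m + m') = M.single k m + M.single k m' :=
  tau_ext M fun i => by
    rw [tau_add_apply, M.single_apply, M.single_apply, M.single_apply]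
    split_ifs
    · rfl
    · rw [add_zero]

lemma TildeMod.res_single {U V : Opens X} (h : V ≤ U) (k : ℤ) (m : M.toModSheaf.obj U) :
    M.tau.res h (M.single k m) = M.single k (M.toModSheaf.res h m) :=
  tau_ext M fun i => by
    rw [tau_res_apply, M.single_apply, M.single_apply]
    split_ifs
    · rfl
    · rw [map_zero]

lemma TildeMod.tauPow_smul_single {U : Opens X} (j k : ℤ) (m : M.toModSheaf.obj U) :
    (tauPow j : TauLoc (Rees (FD n U))) • M.single k m = M.single (k + j) m :=
  tau_ext M fun i => by
    rw [tau_tauPow_apply, M.single_apply, M.single_apply]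
    simp only [sub_eq_iff_eq_add]

lemma TildeMod.of_smul_single {U : Opens X} (j : ℕ) (P : FD n U j) (k : ℤ)
    (m : M.toModSheaf.obj U) :
    (ofCoef (Rees.of (FD n U) j P) : TauLoc (Rees (FD n U))) • M.single k m =
      M.single (k + j) (Rees.of (FD n U) j P • m) :=
  tau_ext M fun i => by
    rw [tau_of_apply, M.single_apply, M.single_apply]
    simp only [sub_eq_iff_eq_add]
    split_ifs
    · rfl
    · exact smul_zero _

lemma TildeMod.tau_sub_hbar_smul_single {U : Opens X} (k : ℤ) (m : M.toModSheaf.obj U) :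
    (tauPow 1 - ofCoef hbar : TauLoc (Rees (FD n U))) • M.single k m =
      M.single (k + 1) (m - (hbar : Rees (FD n U)) • m) :=
  tau_ext M fun i => by
    rw [tau_tau_sub_hbar_apply, M.single_apply, M.single_apply]
    simp only [sub_eq_iff_eq_add (G := ℤ)]
    split_ifs
    · rfl
    · rw [smul_zero, sub_zero]

lemma tau_sum_apply {U : Opens X} {ι : Type*} (I : Finset ι) (s : ι → M.tau.obj U) (k : ℤ) :
    (∑ i ∈ I, s i).1 k = ∑ i ∈ I, (s i).1 k := by
  classical
  induction I using Finset.induction_on with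
  | empty => rfl
  | insert i I hi ih => rw [Finset.sum_insert hi, Finset.sum_insert hi, tau_add_apply, ih]

lemma TildeMod.sum_single_apply {U : Opens X} (I : Finset ℤ) (s : ℤ → M.toModSheaf.obj U) (i : ℤ) :
    (∑ k ∈ I, M.single k (s k)).1 i = if i ∈ I then s i else 0 := by
  rw [tau_sum_apply]
  simp only [M.single_apply]
  rw [Finset.sum_ite_eq]

/-- Locally, a section of `^τM` is a finite sum `∑ τ^k ⊗ m_k`. -/
lemma TildeMod.exists_finset {U : Opens X} (s : M.tau.obj U) :
    M.tau.Loc (fun _ t => ∃ I : Finset ℤ, ∀ k ∉ I, t.1 k = 0) s := by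
  intro x hx
  obtain ⟨V, h, hV, e⟩ := s.2 x hx
  refine ⟨V, h, hV, e.toFinset, fun k hk => ?_⟩
  by_contra H
  exact hk (e.mem_toFinset.2 H)

lemma TildeMod.eq_sum_single {U : Opens X} {s : M.tau.obj U} {I : Finset ℤ}
    (hI : ∀ k ∉ I, s.1 k = 0) : s = ∑ k ∈ I, M.single k (s.1 k) :=
  tau_ext M fun i => by
    rw [M.sum_single_apply]
    split_ifs with h
    · rfl
    · exact hI i h

/-- The automorphism `τ^k ⊗ m ↦ c^k τ^k ⊗ m` of `^τM`. -/
noncomputable def TildeMod.twistApp (c : ℂ) (U : Opens X) : M.tau.obj U →+ M.tau.obj U where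
  toFun s := ⟨fun k => algebraMap ℂ (Rees (FD n U)) (c ^ k) • s.1 k, fun x hx => by
    obtain ⟨V, h, hV, e⟩ := s.2 x hx
    refine ⟨V, h, hV, e.subset fun k hk H => hk ?_⟩
    rw [res_rees_smul, H, smul_zero]⟩
  map_zero' := tau_ext M fun k => smul_zero _
  map_add' s t := tau_ext M fun k => smul_add _ _ _

lemma TildeMod.twistApp_apply (c : ℂ) {U : Opens X} (s : M.tau.obj U) (k : ℤ) :
    (M.twistApp c U s).1 k = algebraMap ℂ (Rees (FD n U)) (c ^ k) • s.1 k := rfl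

lemma Rees.der_algebraMap {U : Opens X} (c : ℂ) :
    Rees.der (algebraMap ℂ (Rees (FD n U)) c) = 0 := by
  rw [algebraMap_eq_of, Rees.der_of', Nat.cast_zero, zero_smul]

lemma TildeMod.del_algebraMap_smul {U : Opens X} (c : ℂ) (m : M.toModSheaf.obj U) :
    M.del U (algebraMap ℂ (Rees (FD n U)) c • m) = algebraMap ℂ (Rees (FD n U)) c • M.del U m := by
  rw [M.del_smul, Rees.der_algebraMap, zero_smul, add_zero]

variable {c : ℂ} (hc : c ≠ 0)
include hc

lemma TildeMod.twistApp_of_smul {U : Opens X} (j : ℕ) (P : FD n U j) (s : M.tau.obj U) :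
    M.twistApp c U ((ofCoef (Rees.of (FD n U) j P) : TauLoc (Rees (FD n U))) • s) =
      (scalZ (c ^ j) : tauZero (Rees (FD n U))) •
        (ofCoef (Rees.of (FD n U) j P) : TauLoc (Rees (FD n U))) • M.twistApp c U s :=
  tau_ext M fun i => by
    rw [M.twistApp_apply, tau_scal_apply, tau_of_apply, tau_of_apply, M.twistApp_apply,
      ← mul_smul, ← mul_smul, ← mul_smul, mul_assoc,
      ← (Algebra.commutes (c ^ (i - (j : ℤ))) (Rees.of (FD n U) j P)), ← mul_assoc, ← map_mul,
      ← zpow_natCast c j, ← zpow_add₀ hc, add_sub_cancel]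

lemma TildeMod.twistApp_theta_smul {U : Opens X} (s : M.tau.obj U) :
    M.twistApp c U ((theta : TauLoc (Rees (FD n U))) • s) =
      (scalZ c : tauZero (Rees (FD n U))) •
        (theta : TauLoc (Rees (FD n U))) • M.twistApp c U s :=
  tau_ext M fun i => by
    rw [M.twistApp_apply, tau_scal_apply, tau_theta_apply, tau_theta_apply, M.twistApp_apply,
      M.del_algebraMap_smul]
    have e : c ^ i = c * c ^ (i - 1) := by rw [← zpow_one_add₀ hc, add_sub_cancel]
    rw [e, map_mul, mul_smul]
    congr 1
    rw [smul_sub, smul_comm _ (i - 1), ← mul_smul, ← mul_smul, Algebra.commutes]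

lemma TildeMod.twistApp_tauPow_smul {U : Opens X} (k : ℤ) (s : M.tau.obj U) :
    M.twistApp c U ((tauPow k : TauLoc (Rees (FD n U))) • s) =
      (scalZ (c ^ k) : tauZero (Rees (FD n U))) •
        (tauPow k : TauLoc (Rees (FD n U))) • M.twistApp c U s :=
  tau_ext M fun i => by
    rw [M.twistApp_apply, tau_scal_apply, tau_tauPow_apply, tau_tauPow_apply, M.twistApp_apply,
      ← mul_smul, ← map_mul, ← zpow_add₀ hc, add_sub_cancel]

end Components

/-! ### The `V`-filtration is graded, saturated, and a lattice -/

section Lattice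

open HasHbar

variable {n : ℕ} {X : Type u} [TopologicalSpace X] [ChartedSpace (EuclideanSpace ℂ (Fin n)) X]
  (M : TildeMod.{u, v} n X)

lemma TildeMod.exists_twistApp_smul {c : ℂ} (hc : c ≠ 0) {U : Opens X}
    (r : tauZero (Rees (FD n U))) : ∃ r' : tauZero (Rees (FD n U)),
      ∀ s : M.tau.obj U, M.twistApp c U (r • s) = r' • M.twistApp c U s := by
  -- the property, for elements of the larger ring
  let P : TauLoc (Rees (FD n U)) → Prop := fun r => ∃ r' ∈ tauZero (Rees (FD n U)),
    ∀ s : M.tau.obj U, M.twistApp c U (r • s) = r' • M.twistApp c U s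
  have hadd : ∀ a b, P a → P b → P (a + b) := by
    rintro a b ⟨a', ha', ha⟩ ⟨b', hb', hb⟩
    exact ⟨a' + b', add_mem ha' hb', fun s => by rw [add_smul, map_add, ha, hb, add_smul]⟩
  have hmul : ∀ a b, P a → P b → P (a * b) := by
    rintro a b ⟨a', ha', ha⟩ ⟨b', hb', hb⟩
    exact ⟨a' * b', mul_mem ha' hb', fun s => by rw [mul_smul, ha, hb, mul_smul]⟩
  have hcoef : ∀ a : Rees (FD n U), P (ofCoef a) := by
    intro a
    induction a using Rees.induct with
    | h0 =>
      refine ⟨0, zero_mem _, fun s => ?_⟩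
      rw [map_zero]
      exact ((congrArg (M.twistApp c U) (zero_smul (TauLoc (Rees (FD n U))) s)).trans
        (map_zero _)).trans (zero_smul (TauLoc (Rees (FD n U))) (M.twistApp c U s)).symm
    | h k Q =>
      refine ⟨(scalZ (c ^ k) : tauZero (Rees (FD n U))).1 * ofCoef (Rees.of (FD n U) k Q),
        mul_mem (Subtype.prop _) (ofTheta_mem _), fun s => ?_⟩
      rw [M.twistApp_of_smul hc, mul_smul]
      rfl
    | hadd a b ha hb => rw [map_add]; exact hadd _ _ ha hb
  have htheta : P theta := ⟨(scalZ c : tauZero (Rees (FD n U))).1 * theta,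
    mul_mem (Subtype.prop _) (ofTheta_mem _), fun s => by
      rw [M.twistApp_theta_smul hc, mul_smul]
      rfl⟩
  have hpow : P (tauPow 1) := ⟨(scalZ (c ^ (1 : ℤ)) : tauZero (Rees (FD n U))).1 * tauPow 1,
    mul_mem (Subtype.prop _) (tauPow_mem zero_le_one), fun s => by
      rw [M.twistApp_tauPow_smul hc, mul_smul]
      rfl⟩
  have key : P r.1 := tauZero_induct r.2 hcoef htheta hpow hadd hmul
  obtain ⟨r', hr', e⟩ := key
  exact ⟨⟨r', hr'⟩, e⟩

/-- The automorphism `τ^k ⊗ m ↦ c^k τ^k ⊗ m` of `^τM`, as a semilinear morphism. -/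
noncomputable def TildeMod.twist {c : ℂ} (hc : c ≠ 0) : SemilinHom M.tau M.tau where
  app := M.twistApp c
  app_res h s := tau_ext M fun k => by
    rw [M.twistApp_apply, tau_res_apply, tau_res_apply, M.twistApp_apply, res_rees_smul,
      reesRes_algebraMap]
  scal := c⁻¹
  app_smul U r := M.exists_twistApp_smul hc r
  app_tauPow U k := ⟨scalZ (c ^ (k : ℤ)), fun s => M.twistApp_tauPow_smul hc _ s⟩
  eul_app U a s := by
    have e1 : ∀ (d : ℂ) (s : M.tau.obj U), M.twistApp c U ((scalZ d : tauZero (Rees (FD n U))) • s)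
        = (scalZ d : tauZero (Rees (FD n U))) • M.twistApp c U s := fun d s => by
      refine tau_ext M fun k => ?_
      rw [M.twistApp_apply, tau_scal_apply, tau_scal_apply, M.twistApp_apply, ← mul_smul,
        ← mul_smul, Algebra.commutes]
    have e2 : M.twistApp c U ((hbarZ : tauZero (Rees (FD n U))) • s) =
        (scalZ c : tauZero (Rees (FD n U))) • (hbarZ : tauZero (Rees (FD n U))) •
          M.twistApp c U s := by
      refine (M.twistApp_of_smul hc 1 _ s).trans ?_
      rw [pow_one]
      rfl
    have e3 : M.twistApp c U ((thetaZ : tauZero (Rees (FD n U))) • s) =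
        (scalZ c : tauZero (Rees (FD n U))) • (thetaZ : tauZero (Rees (FD n U))) •
          M.twistApp c U s := M.twistApp_theta_smul hc s
    rw [e1, eul, add_smul, add_smul, map_add, mul_smul, mul_smul, e1, e2, e3, smul_add]
    simp only [← mul_smul, ← mul_assoc, scalZ_mul]
    rw [inv_mul_cancel₀ hc, scalZ_one, one_mul, mul_right_comm, inv_mul_cancel₀ hc, one_mul]

variable {M} {A : Set ℝ} {V : TauFilt M.tau}

/-- Since `V_a` is stable by the automorphism `τ^k ⊗ m ↦ 2^k τ^k ⊗ m`, whose eigenvalues are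
distinct, it contains the homogeneous components of its sections. -/
theorem IsVFiltration.isTauGraded [LocallyCompactSpace X] (hV : IsVFiltration M.tau A V) (a : ℝ) :
    IsTauGraded M (V.step a) := by
  have h2 : (2 : ℂ) ≠ 0 := two_ne_zero
  have key : ∀ (I : Finset ℤ) (U : Opens X) (s : M.tau.obj U), s ∈ (V.step a).carrier U →
      (∀ k ∉ I, s.1 k = 0) → ∀ k, M.single k (s.1 k) ∈ (V.step a).carrier U := by
    intro I U
    induction I using Finset.induction_on with
    | empty =>
      intro s _ h k
      rw [h k (by simp), M.single_zero]
      exact zero_mem _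
    | insert j I hj ih =>
      intro s hs h
      -- `(φ - 2^j) s` has no component of degree `j`
      have h1 : (M.twist h2).app U s - (scalZ (2 ^ j) : tauZero (Rees (FD n U))) • s ∈
          (V.step a).carrier U :=
        sub_mem ((M.twist h2).app_mem_step hV hV a hs) ((V.step a).smul_mem (scalZ (2 ^ j)) hs)
      have h3 : ∀ k, ((M.twist h2).app U s - (scalZ (2 ^ j) : tauZero (Rees (FD n U))) • s).1 k =
          algebraMap ℂ (Rees (FD n U)) (2 ^ k - 2 ^ j) • s.1 k := fun k => by
        change (M.twistApp 2 U s).1 k - ((scalZ (2 ^ j) : tauZero (Rees (FD n U))) • s).1 k = _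
        rw [M.twistApp_apply, tau_scal_apply, map_sub, sub_smul]
      have h4 := ih _ h1 fun k hk => by
        rw [h3]
        by_cases hkj : k = j
        · rw [hkj, sub_self, map_zero, zero_smul]
        · rw [h k (by simp [hk, hkj]), smul_zero]
      have h5 : ∀ k, k ≠ j → M.single k (s.1 k) ∈ (V.step a).carrier U := by
        intro k hkj
        have h6 := (V.step a).smul_mem (scalZ ((2 ^ k - 2 ^ j : ℂ)⁻¹) : tauZero (Rees (FD n U)))
          (h4 k)
        refine (congrArg (· ∈ (V.step a).carrier U) ?_).mpr h6
        change M.single k (s.1 k) = (scalZ ((2 ^ k - 2 ^ j : ℂ)⁻¹) : tauZero (Rees (FD n U))) •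
          (M.single k (((M.twist h2).app U s -
            (scalZ (2 ^ j) : tauZero (Rees (FD n U))) • s).1 k) : M.tau.obj U)
        refine tau_ext M fun i => ?_
        rw [tau_scal_apply, M.single_apply, M.single_apply, h3]
        split_ifs
        · rw [← mul_smul, ← map_mul, inv_mul_cancel₀, map_one, one_smul]
          intro e
          have e' : ((2 ^ k : ℝ) : ℂ) = ((2 ^ j : ℝ) : ℂ) := by
            push_cast; exact sub_eq_zero.1 e
          exact hkj (zpow_right_injective₀ two_pos (by norm_num) (Complex.ofReal_injective e'))
        · rw [smul_zero]
      intro k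
      by_cases hkj : k = j
      · have e : M.single k (s.1 k) = s - ∑ i ∈ I, M.single i (s.1 i) := by
          rw [eq_sub_iff_add_eq, hkj, ← Finset.sum_insert (f := fun i => M.single i (s.1 i)) hj]
          exact (M.eq_sum_single h).symm
        rw [e]
        exact sub_mem hs (sum_mem fun i hi => h5 i fun e => hj (e ▸ hi))
      · exact h5 k hkj
  intro U s hs k
  refine (V.step a).of_loc fun x hx => ?_
  obtain ⟨W, h, hW, I, hI⟩ := M.exists_finset s x hx
  refine ⟨W, h, hW, ?_⟩
  have := key I W _ ((V.step a).res_mem h hs) hI k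
  exact (congrArg (· ∈ (V.step a).carrier W) (M.res_single h k (s.1 k))).mpr this

/-- `τ - ħ`, as an element of `V_0`. -/
noncomputable def tauSubHbarZ {S : Type w} [Ring S] [HasHbar S] : tauZero S :=
  ⟨tauPow 1 - ofCoef hbar, sub_mem (tauPow_mem zero_le_one) (ofTheta_mem _)⟩

lemma tauRes_tau_sub_hbar {U V : Opens X} (h : V ≤ U) :
    tauRes n h (tauPow 1 - ofCoef hbar : TauLoc (Rees (FD n U))) =
      (tauPow 1 - ofCoef hbar : TauLoc (Rees (FD n V))) := by
  rw [map_sub, tauRes_tauPow]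
  exact congrArg _ (tauRes_hbar h)

variable {T : ModSheaf.{u, v, u} (TauLocPsh n X)} {W : TauFilt T}

/-- If `(τ - ħ)m ∈ V_a` and `m ∈ V_b`, `b > a`, then `ħm = τm - (τ - ħ)m ∈ V_{<b}`, hence
`m ∈ V_{<b}` since `ħ` is injective on `gr_b^V`. -/
lemma IsVFiltration.mem_of_tau_sub_hbar_smul_mem (hW : IsVFiltration T A W) {a : ℝ} {U : Opens X}
    {s : T.obj U}
    (hs : (tauPow 1 - ofCoef hbar : TauLoc (Rees (FD n U))) • s ∈ (W.step a).carrier U) :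
    s ∈ (W.step a).carrier U := by
  refine hW.mem_step_of_descent (p := fun Z t =>
    (tauPow 1 - ofCoef hbar : TauLoc (Rees (FD n Z))) • t ∈ (W.step a).carrier Z) ?_ ?_ hs
  · intro Z Z' h t ht
    have := (W.step a).res_mem h ht
    rwa [show (T.restrict (zeroToLoc n X)).res h _ = _ from res_tau_smul h _ t,
      tauRes_tau_sub_hbar] at this
  · intro b _ hab Z t ht htb
    refine hW.mem_ltSub_of_hbar htb ?_
    have e : (hbarZ : tauZero (Rees (FD n Z))) • t = (tauPow 1 : TauLoc (Rees (FD n Z))) • t -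
        (tauPow 1 - ofCoef hbar : TauLoc (Rees (FD n Z))) • t := by
      rw [sub_smul, sub_sub_cancel]
      rfl
    rw [e]
    refine sub_mem (W.mem_ltSub_of_lt (b := b - 1) (by linarith) ?_) (W.mem_ltSub_of_lt hab ht)
    exact hW.tauPow_smul_mem (by push_cast; rfl) htb

lemma IsVFiltration.isTauHbarSaturated (hW : IsVFiltration T A W) (a : ℝ) :
    IsTauHbarSaturated (W.step a) := by
  refine fun U s => ⟨fun H => ⟨(W.step a).mem_of_loc H ?_, H.mono fun Z t ⟨m, _, e⟩ => ⟨m, e⟩⟩, ?_⟩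
  · rintro Z _ ⟨m, hm, rfl⟩
    exact (W.step a).smul_mem tauSubHbarZ hm
  · rintro ⟨hs, H⟩
    refine (AbSheaf.Loc.and_stable H (W.step a).toSubSheaf.stable hs).mono ?_
    rintro Z _ ⟨⟨m, rfl⟩, h⟩
    exact ⟨m, hW.mem_of_tau_sub_hbar_smul_mem h, rfl⟩

lemma laurentToLoc_T {R : Type v} {S : Type w} [CommRing R] [Ring S] [HasHbar S] (f : R →+* S)
    (k : ℤ) : laurentToLoc f (LaurentPolynomial.T k) = tauPow k := by
  change AddMonoidAlgebra.liftNC _ _ (AddMonoidAlgebra.single _ _) = _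
  rw [AddMonoidAlgebra.liftNC_single]
  change ofCoef (f 1) * tauPow k = _
  rw [map_one, map_one, one_mul]

lemma localizeMap_tmul (N : SubMod (T.restrict (zeroToLoc n X))) (U : Opens X)
    (r : LaurentPolynomial (HolHbar n U)) (s : N.carrier U) :
    localizeMap N U (r ⊗ₜ (s : N.toMod.obj U)) = holTauToLoc U r • (s.1 : T.obj U) := rfl

/-- Every element of `𝒪_X[τ, τ⁻¹, ħ] ⊗ N` is of the form `τ^{-k} ⊗ s`. -/
lemma exists_eq_T_tmul (N : SubMod (T.restrict (zeroToLoc n X))) (U : Opens X)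
    (z : TensorProduct (Polynomial (HolHbar n U)) (LaurentPolynomial (HolHbar n U))
      (N.toMod.obj U)) :
    ∃ (k : ℕ) (s : N.toMod.obj U), z = LaurentPolynomial.T (-(k : ℤ)) ⊗ₜ s := by
  have hT : ∀ (k j : ℕ) (s : N.toMod.obj U),
      (LaurentPolynomial.T (-(k : ℤ)) : LaurentPolynomial (HolHbar n U)) ⊗ₜ[Polynomial (HolHbar n U)] s =
        LaurentPolynomial.T (-((k + j : ℕ) : ℤ)) ⊗ₜ ((Polynomial.X ^ j : Polynomial (HolHbar n U)) • s) := by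
    intro k j s
    rw [← TensorProduct.smul_tmul]
    congr 1
    change _ = Polynomial.toLaurent _ * _
    rw [Polynomial.toLaurent_X_pow, ← LaurentPolynomial.T_add]
    congr 1
    push_cast
    ring
  induction z using TensorProduct.induction_on with
  | zero => exact ⟨0, 0, (TensorProduct.tmul_zero _ _).symm⟩
  | tmul r s =>
    obtain ⟨k, p, hp⟩ := LaurentPolynomial.exists_T_pow r
    refine ⟨k, p • s, ?_⟩
    rw [← TensorProduct.smul_tmul]
    congr 1
    change _ = Polynomial.toLaurent _ * _
    rw [hp, mul_assoc, ← LaurentPolynomial.T_add, add_neg_cancel, LaurentPolynomial.T_zero, mul_one]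
  | add z z' hz hz' =>
    obtain ⟨k, s, rfl⟩ := hz
    obtain ⟨k', s', rfl⟩ := hz'
    refine ⟨k + k', (Polynomial.X ^ k' : Polynomial (HolHbar n U)) • s +
      (Polynomial.X ^ k : Polynomial (HolHbar n U)) • s', ?_⟩
    rw [TensorProduct.tmul_add, ← hT, add_comm k k', ← hT]

lemma IsVFiltration.isTauLattice (hW : IsVFiltration T A W) (a : ℝ) :
    IsTauLattice (W.step a) := by
  refine ⟨fun U => (injective_iff_map_eq_zero _).2 fun z hz => ?_, fun U s => ?_⟩
  · obtain ⟨k, s, rfl⟩ := exists_eq_T_tmul _ _ z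
    rw [show localizeMap (W.step a) U _ = _ from localizeMap_tmul _ _ _ s, holTauToLoc,
      laurentToLoc_T] at hz
    have h1 := congrArg (fun t : T.obj U => (tauPow (k : ℤ) : TauLoc (Rees (FD n U))) • t) hz
    simp only [tauPow_smul_neg, smul_zero] at h1
    have h2 : s = 0 := Subtype.ext h1
    rw [h2, TensorProduct.tmul_zero]
  · refine (hW.exhaustive U s).mono ?_
    rintro Z t ⟨b, -, ht⟩
    obtain ⟨k, hk⟩ := exists_nat_ge (b - a)
    have h1 : (tauPow (k : ℤ) : TauLoc (Rees (FD n Z))) • t ∈ (W.step a).carrier Z :=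
      hW.tauPow_smul_mem (by push_cast; linarith) ht
    refine ⟨LaurentPolynomial.T (-(k : ℤ)) ⊗ₜ (⟨_, h1⟩ : (W.step a).carrier Z), ?_⟩
    rw [show localizeMap (W.step a) Z _ = _ from localizeMap_tmul _ _ _ _, holTauToLoc,
      laurentToLoc_T]
    exact tauPow_neg_smul _ _

end Lattice

/-! ### Locally generated submodules and quotients of coherent modules -/

section Span

universe v'

variable {X : Type u} [TopologicalSpace X] {R : RingPsh.{u, w} X}

/-- Finitely many local properties at `x` hold on a common neighbourhood. -/
lemma exists_nhds_forall {ι : Type*} [Finite ι] {U : Opens X} {x : X} (hx : x ∈ U)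
    {P : ι → ∀ W : Opens X, W ≤ U → Prop}
    (hP : ∀ i (W W' : Opens X) (h : W ≤ U) (h' : W' ≤ W), P i W h → P i W' (h'.trans h))
    (H : ∀ i, ∃ (W : Opens X) (h : W ≤ U), x ∈ W ∧ P i W h) :
    ∃ (W : Opens X) (h : W ≤ U), x ∈ W ∧ ∀ i, P i W h := by
  classical
  have := Fintype.ofFinite ι
  suffices h : ∀ I : Finset ι, ∃ (W : Opens X) (h : W ≤ U), x ∈ W ∧ ∀ i ∈ I, P i W h by
    obtain ⟨W, k, hW, e⟩ := h Finset.univ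
    exact ⟨W, k, hW, fun i => e i (Finset.mem_univ i)⟩
  intro I
  induction I using Finset.induction_on with
  | empty => exact ⟨U, le_rfl, hx, by simp⟩
  | insert i I _ ih =>
    obtain ⟨W, h, hW, e⟩ := ih
    obtain ⟨W', h', hW', e'⟩ := H i
    refine ⟨W ⊓ W', inf_le_left.trans h, ⟨hW, hW'⟩, fun j hj => ?_⟩
    rcases Finset.mem_insert.1 hj with rfl | hj
    · exact hP _ _ _ h' inf_le_right e'
    · exact hP _ _ _ h inf_le_left (e j hj)

/-- The sheaf of submodules generated by sections over `Y`, extended by zero outside of `Y`. -/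
def SubMod.spanOn (M : ModSheaf.{u, v, w} R) (Y : Opens X) {ι : Type*} [Fintype ι]
    (g : ι → M.obj Y) : SubMod M :=
  SubMod.gen M
    (fun W =>
      { carrier := {t | t = 0 ∨ ∃ (k : W ≤ Y) (r : ι → R.obj W), t = ∑ i, r i • M.res k (g i)}
        zero_mem' := Or.inl rfl
        add_mem' := by
          rintro s t (rfl | ⟨k, r, rfl⟩) (rfl | ⟨k', r', rfl⟩)
          · exact Or.inl (add_zero 0)
          · exact Or.inr ⟨k', r', zero_add _⟩
          · exact Or.inr ⟨k, r, add_zero _⟩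
          · refine Or.inr ⟨k, fun i => r i + r' i, ?_⟩
            simp only [add_smul, Finset.sum_add_distrib]
        neg_mem' := by
          rintro s (rfl | ⟨k, r, rfl⟩)
          · exact Or.inl neg_zero
          · refine Or.inr ⟨k, fun i => -r i, ?_⟩
            simp only [neg_smul, Finset.sum_neg_distrib] })
    (fun {U V} h s => by
      rintro (rfl | ⟨k, r, rfl⟩)
      · exact Or.inl (map_zero _)
      · refine Or.inr ⟨h.trans k, fun i => R.res h (r i), ?_⟩
        rw [map_sum]
        simp only [M.res_smul, M.res_res])
    (fun {U} a s => by
      rintro (rfl | ⟨k, r, rfl⟩)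
      · exact Or.inl (smul_zero _)
      · refine Or.inr ⟨k, fun i => a * r i, ?_⟩
        simp only [Finset.smul_sum, mul_smul])

lemma SubMod.mem_spanOn {M : ModSheaf.{u, v, w} R} {Y : Opens X} {ι : Type*} [Fintype ι]
    {g : ι → M.obj Y} {Z : Opens X} (hZ : Z ≤ Y) {s : M.obj Z} :
    s ∈ (SubMod.spanOn M Y g).carrier Z ↔
      M.Loc (fun W t => ∃ (k : W ≤ Y) (r : ι → R.obj W), t = ∑ i, r i • M.res k (g i)) s := by
  constructor
  · intro H x hx
    obtain ⟨W, h, hW, e | e⟩ := H x hx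
    · exact ⟨W, h, hW, h.trans hZ, 0, by simp [e]⟩
    · exact ⟨W, h, hW, e⟩
  · exact fun H => H.mono fun _ _ => Or.inr

lemma SubMod.gen_mem_spanOn {M : ModSheaf.{u, v, w} R} {Y : Opens X} {ι : Type*} [Fintype ι]
    (g : ι → M.obj Y) {Z : Opens X} (k : Z ≤ Y) (i : ι) :
    M.res k (g i) ∈ (SubMod.spanOn M Y g).carrier Z := by
  classical
  refine (SubMod.mem_spanOn k).2 (AbSheaf.Loc.of_self ⟨k, Pi.single i 1, ?_⟩)
  rw [Finset.sum_eq_single i (fun j _ hj => by rw [Pi.single_eq_of_ne hj, zero_smul])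
    (fun h => absurd (Finset.mem_univ i) h), Pi.single_eq_same, one_smul]

lemma SubMod.fg_of_le_spanOn {M : ModSheaf.{u, v, w} R} {N : SubMod M}
    (H : ∀ x : X, ∃ Y : Opens X, x ∈ Y ∧ ∃ (ι : Type) (_ : Fintype ι) (g : ι → M.obj Y),
      (∀ i, g i ∈ N.carrier Y) ∧ ∀ Z ≤ Y, N.carrier Z ≤ (SubMod.spanOn M Y g).carrier Z) :
    N.FG := by
  intro x
  obtain ⟨Y, hY, ι, _, g, hg, e⟩ := H x
  let σ := Fintype.equivFin ι
  refine ⟨Y, hY, Fintype.card ι, fun j => g (σ.symm j), fun j => hg _, fun W hW s hs => ?_⟩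
  refine ((SubMod.mem_spanOn hW).1 (e W hW hs)).mono ?_
  rintro Z _ ⟨k, r, rfl⟩
  exact ⟨k, fun j => r (σ.symm j), (Equiv.sum_comp σ.symm fun i => r i • M.res k (g i)).symm⟩

/-- The quotient of a coherent module by a submodule of finite type is coherent. Here the quotient
`Q` is given with a locally surjective morphism `π : N → Q`, linear over a surjective morphism
`ev` of rings. -/
lemma SubMod.coherent_of_quotient {S : RingPsh.{u, w} X} {A : ModSheaf.{u, v, w} R}
    {B : ModSheaf.{u, v', w} S} {N : SubMod A} {Q : SubMod B} (ev : R.Hom S)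
    (ev_surj : ∀ U, Function.Surjective (ev.app U)) (π : ∀ U, A.obj U →+ B.obj U)
    (π_res : ∀ {U V : Opens X} (h : V ≤ U) (s : A.obj U), π V (A.res h s) = B.res h (π U s))
    (π_smul : ∀ (U : Opens X) (r : R.obj U) (s : A.obj U), π U (r • s) = ev.app U r • π U s)
    (hπ : ∀ (U : Opens X) (s : B.obj U), s ∈ Q.carrier U ↔
      B.Loc (fun W t => ∃ m ∈ N.carrier W, π W m = t) s)
    (hker : ∀ x : X, ∃ V : Opens X, x ∈ V ∧ ∃ (p : ℕ) (κ : Fin p → A.obj V),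
      (∀ j, κ j ∈ N.carrier V ∧ π V (κ j) = 0) ∧ ∀ Z ≤ V, ∀ s ∈ N.carrier Z, π Z s = 0 →
        A.Loc (fun W t => ∃ (k : W ≤ V) (c : Fin p → R.obj W), t = ∑ j, c j • A.res k (κ j)) s)
    (hN : N.toMod.Coherent) : Q.toMod.Coherent := by
  obtain ⟨hN1, hN2⟩ := N.toMod_coherent_iff.1 hN
  have π_sum : ∀ {U : Opens X} {q : ℕ} (r : Fin q → R.obj U) (s : Fin q → A.obj U),
      π U (∑ i, r i • s i) = ∑ i, ev.app U (r i) • π U (s i) := fun r s => by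
    rw [map_sum]; exact Finset.sum_congr rfl fun i _ => π_smul _ _ _
  refine Q.toMod_coherent_iff.2 ⟨fun x => ?_, fun U q m hm x hx => ?_⟩
  · obtain ⟨V, hV, p, g, hg, H⟩ := hN1 x
    refine ⟨V, hV, p, fun i => π V (g i),
      fun i => (hπ V _).2 (AbSheaf.Loc.of_self ⟨g i, hg i, rfl⟩), fun W hW s hs y hy => ?_⟩
    obtain ⟨Y, h, hY, m, hm, e⟩ := (hπ W s).1 hs y hy
    obtain ⟨Z, k, hZ, l, r, er⟩ := H Y (h.trans hW) m hm y hY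
    refine ⟨Z, k.trans h, hZ, l, fun i => ev.app Z (r i), ?_⟩
    rw [← B.res_res h k, ← e, ← π_res, er, π_sum]
    simp only [π_res]
  · -- local lifts of the `m i`
    obtain ⟨V₀, h₀, hV₀, e₀⟩ := exists_nhds_forall hx
      (P := fun i W h => ∃ s ∈ N.carrier W, π W s = B.res h (m i))
      (fun i W W' h h' ⟨s, hs, e⟩ => ⟨A.res h' s, N.res_mem h' hs, by rw [π_res, e, B.res_res]⟩)
      (fun i => by
        obtain ⟨W, h, hW, e⟩ := (hπ U _).1 (hm i) x hx
        exact ⟨W, h, hW, e⟩)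
    choose s hs es using e₀
    obtain ⟨V₁, hV₁, p, κ, hκ, Hκ⟩ := hker x
    set Y := V₀ ⊓ V₁ with hY
    have hY0 : Y ≤ V₀ := inf_le_left
    have hY1 : Y ≤ V₁ := inf_le_right
    obtain ⟨V, h, hV, p', g, e1, e2⟩ := hN2 Y (q + p)
      (Fin.append (fun i => A.res hY0 (s i)) fun j => A.res hY1 (κ j)) (fun i => by
        induction i using Fin.addCases with
        | left i => rw [Fin.append_left]; exact N.res_mem _ (hs i)
        | right j => rw [Fin.append_right]; exact N.res_mem _ (hκ j).1) x ⟨hV₀, hV₁⟩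
    simp only [Fin.sum_univ_add, Fin.append_left, Fin.append_right, A.res_res] at e1 e2
    have hπκ : ∀ {Z : Opens X} (k : Z ≤ V₁) (c : Fin p → R.obj Z),
        π Z (∑ j, c j • A.res k (κ j)) = 0 := fun k c => by
      rw [π_sum]
      exact Finset.sum_eq_zero fun j _ => by rw [π_res, (hκ j).2, map_zero, smul_zero]
    have hπs : ∀ {Z : Opens X} (k : Z ≤ V₀) (r : Fin q → R.obj Z),
        π Z (∑ i, r i • A.res k (s i)) = ∑ i, ev.app Z (r i) • B.res (k.trans h₀) (m i) :=
      fun k r => by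
        rw [π_sum]
        exact Finset.sum_congr rfl fun i _ => by rw [π_res, es, B.res_res]
    refine ⟨V, (h.trans hY0).trans h₀, hV, p', fun j i => ev.app V (g j (Fin.castAdd p i)),
      fun j => ?_, fun W k r hr y hy => ?_⟩
    · have := congrArg (π V) (e1 j)
      rwa [map_add, hπκ, add_zero, hπs, map_zero] at this
    · choose r' hr' using fun i => ev_surj W (r i)
      have h3 : π W (∑ i, r' i • A.res (k.trans (h.trans hY0)) (s i)) = 0 := by
        rw [hπs]
        simp only [hr']
        exact hr
      obtain ⟨Z, l, hZ, l', c, ec⟩ := Hκ W (k.trans (h.trans hY1)) _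
        (sum_mem fun i _ => N.smul_mem _ (N.res_mem _ (hs i))) h3 y hy
      rw [map_sum] at ec
      simp only [A.res_smul, A.res_res] at ec
      obtain ⟨Z', l₂, hZ', d, ed⟩ := e2 Z (l.trans k)
        (Fin.append (fun i => R.res l (r' i)) fun j => -c j) (by
          simp only [Fin.append_left, Fin.append_right, neg_smul, Finset.sum_neg_distrib]
          rw [ec, add_neg_cancel]) y hZ
      refine ⟨Z', l₂.trans l, hZ', fun j => ev.app Z' (d j), fun i => ?_⟩
      have := congrArg (ev.app Z') (ed (Fin.castAdd p i))
      rw [Fin.append_left, map_sum, R.res_res, ev.app_res, hr'] at this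
      simpa only [map_mul, ev.app_res] using this

end Span

/-! ### Coherence over `^τR'_X` -/

section Prime

open HasHbar

variable {n : ℕ} {X : Type u} [TopologicalSpace X] [ChartedSpace (EuclideanSpace ℂ (Fin n)) X]
  {T : ModSheaf.{u, v, u} (TauLocPsh n X)}

lemma polyToZero_C {S : Type w} [Ring S] [HasHbar S] (a : S) :
    polyToZero (Polynomial.C a) = coefZ a := Polynomial.eval₂_C _ _

lemma polyToZero_X {S : Type w} [Ring S] [HasHbar S] :
    polyToZero (Polynomial.X : Polynomial S) = ⟨tauPow 1, tauPow_mem zero_le_one⟩ :=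
  Polynomial.eval₂_X _ _

/-- `S[τ]` is normalized by `τð_τ`. -/
lemma exists_theta_mul_polyToZero {S : Type w} [Ring S] [HasHbar S] (p : Polynomial S) :
    ∃ p' : Polynomial S, thetaZ * polyToZero p = polyToZero p * thetaZ + polyToZero p' := by
  induction p using Polynomial.induction_on with
  | C a =>
    refine ⟨0, ?_⟩
    rw [map_zero, add_zero, polyToZero_C]
    exact Subtype.ext (ofCoef_comm_theta a).eq.symm
  | add p q hp hq =>
    obtain ⟨p', hp⟩ := hp
    obtain ⟨q', hq⟩ := hq
    refine ⟨p' + q', ?_⟩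
    rw [map_add, map_add, mul_add, add_mul, hp, hq]
    abel
  | monomial k a h =>
    obtain ⟨p', h⟩ := h
    refine ⟨Polynomial.C a * Polynomial.X ^ k * (Polynomial.X * Polynomial.C hbar) +
      p' * Polynomial.X, ?_⟩
    have e : thetaZ * polyToZero (Polynomial.X : Polynomial S) =
        polyToZero Polynomial.X * thetaZ +
          polyToZero (Polynomial.X * Polynomial.C hbar) := by
      rw [map_mul, polyToZero_C, polyToZero_X]
      refine Subtype.ext ((theta_mul_tauPow 1).trans ?_)
      rw [one_smul, mul_add]
      rfl
    rw [pow_succ, ← mul_assoc]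
    generalize Polynomial.C a * Polynomial.X ^ k = q at h ⊢
    rw [map_mul, ← mul_assoc, h, add_mul, mul_assoc, e]
    simp only [map_mul, map_add, mul_add, mul_assoc, add_assoc]

lemma res_theta_smul {U V : Opens X} (h : V ≤ U) (s : T.obj U) :
    T.res h ((thetaZ : tauZero (Rees (FD n U))) • s) =
      (thetaZ : tauZero (Rees (FD n V))) • T.res h s :=
  (res_tau_smul h _ s).trans (congrArg (fun r : TauLoc (Rees (FD n V)) => r • T.res h s)
    (tauRes_theta n h))

/-- `V_a` is of finite type over `^τR'_X` if it contains some `V_c` which is: locally a product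
`(τð_τ + c_1ħ)⋯(τð_τ + c_mħ)` maps `V_a` to `V_c`, so `V_a` is generated by the images of its
generators over `V_0` by the partial products, together with the generators of `V_c`. -/
lemma IsVFiltration.fg_prime_of_le [LocallyCompactSpace X] {A : Set ℝ} {V : TauFilt T}
    (hV : IsVFiltration T A V) {a c : ℝ} (hca : c ≤ a)
    (hc : ((V.step c).restrict (primeToZero n X)).FG) :
    ((V.step a).restrict (primeToZero n X)).FG := by
  refine SubMod.fg_of_le_spanOn fun x => ?_
  obtain ⟨W₁, hW₁, p, g, hg, H₁⟩ := ((V.step a).toMod_coherent_iff.1 (hV.coherent_step a)).1 x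
  obtain ⟨W₂, hW₂, q, h, hh, H₂⟩ := hc x
  obtain ⟨W₃, hW₃, L, -, H₃⟩ := hV.exists_eul_prod_mem a c x
  set Y := W₁ ⊓ (W₂ ⊓ W₃) with hY
  have hY1 : Y ≤ W₁ := inf_le_left
  have hY2 : Y ≤ W₂ := inf_le_right.trans inf_le_left
  have hY3 : Y ≤ W₃ := inf_le_right.trans inf_le_right
  let e : Fin p × Fin (L.length + 1) ⊕ Fin q → T.obj Y := Sum.elim
    (fun i => ((L.drop i.2).map (eul (Rees (FD n Y)))).prod • (T.res hY1 (g i.1) : T.obj Y))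
    (fun j => T.res hY2 (h j))
  set G := SubMod.spanOn ((T.restrict (zeroToLoc n X)).restrict (primeToZero n X)) Y e with hG
  have hgen : ∀ {Z : Opens X} (k : Z ≤ Y) i, T.res k (e i) ∈ G.carrier Z :=
    fun k i => SubMod.gen_mem_spanOn (M := (T.restrict (zeroToLoc n X)).restrict (primeToZero n X)) e k i
  -- `G` is stable by `^τR'_X` and contains `V_c`
  have hpoly : ∀ {Z : Opens X} (P : Polynomial (Rees (FD n Z))) (t : T.obj Z), t ∈ G.carrier Z →
      (polyToZero P : tauZero (Rees (FD n Z))) • t ∈ G.carrier Z := fun P t ht => G.smul_mem P ht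
  have hC : ∀ Z ≤ Y, ∀ t ∈ (V.step c).carrier Z, t ∈ G.carrier Z := by
    intro Z hZ t ht
    refine G.mem_of_loc (AbSheaf.Loc.and_stable (q := fun W _ => W ≤ Y) (H₂ Z (hZ.trans hY2) t ht)
      (fun h _ hs => h.trans hs) hZ) ?_
    rintro W _ ⟨⟨k, r, rfl⟩, hW⟩
    refine sum_mem fun j _ => G.smul_mem (r j) ?_
    have := hgen hW (Sum.inr j)
    rwa [show T.res hW (e (Sum.inr j)) = T.res k (h j) from T.res_res _ _ _] at this
  -- `G` is stable by `τð_τ`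
  have hstep : ∀ {Z : Opens X} (k : Z ≤ Y) i,
      (thetaZ : tauZero (Rees (FD n Z))) • T.res k (e i) ∈ G.carrier Z := by
    rintro Z k (⟨i, j⟩ | j)
    · have hres : ∀ j : Fin (L.length + 1), T.res k (e (Sum.inl (i, j))) =
          ((L.drop j).map (eul (Rees (FD n Z)))).prod • (T.res (k.trans hY1) (g i) : T.obj Z) :=
        fun j => (res_eul_prod_smul k _ _).trans (congrArg _ (T.res_res _ _ _))
      induction j using Fin.cases with
      | zero =>
        rw [hres]
        exact hC Z k _ ((V.step c).smul_mem _
          (H₃ Z (k.trans hY3) _ ((V.step a).res_mem (k.trans hY1) (hg i))))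
      | succ j =>
        have e1 : (thetaZ : tauZero (Rees (FD n Z))) • T.res k (e (Sum.inl (i, j.succ))) =
            T.res k (e (Sum.inl (i, j.castSucc))) - (polyToZero (Polynomial.C
              (algebraMap ℂ (Rees (FD n Z)) (L[j] : ℂ) * hbar)) : tauZero (Rees (FD n Z))) •
                T.res k (e (Sum.inl (i, j.succ))) := by
          rw [eq_sub_iff_add_eq, ← add_smul, polyToZero_C, map_mul]
          change eul (Rees (FD n Z)) L[j] • _ = _
          rw [hres, hres, Fin.val_castSucc, Fin.val_succ, List.drop_eq_getElem_cons j.2,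
            List.map_cons, List.prod_cons, mul_smul]
          rfl
        rw [e1]
        exact sub_mem (hgen k _) (hpoly _ _ (hgen k _))
    · exact hC Z k _ ((V.step c).smul_mem thetaZ
        ((V.step c).res_mem k ((V.step c).res_mem hY2 (hh j))))
  have htheta : ∀ Z ≤ Y, ∀ t ∈ G.carrier Z,
      (thetaZ : tauZero (Rees (FD n Z))) • (t : T.obj Z) ∈ G.carrier Z := by
    intro Z hZ t ht
    refine G.of_loc fun y hy => ?_
    obtain ⟨W, k, hW, l, r, er⟩ := (SubMod.mem_spanOn hZ).1 ht y hy
    refine ⟨W, k, hW, ?_⟩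
    refine (congrArg (· ∈ G.carrier W) ((res_theta_smul k t).trans
      (congrArg (fun s : T.obj W => (thetaZ : tauZero (Rees (FD n W))) • s) er))).mpr ?_
    change (thetaZ : tauZero (Rees (FD n W))) •
      (∑ i, (polyToZero (r i) : tauZero (Rees (FD n W))) • (T.res l (e i) : T.obj W)) ∈ G.carrier W
    rw [Finset.smul_sum]
    refine sum_mem fun i _ => ?_
    obtain ⟨p', hp'⟩ := exists_theta_mul_polyToZero (r i)
    rw [← mul_smul, hp', add_smul, mul_smul]
    exact add_mem (hpoly _ _ (hstep l i)) (hpoly _ _ (hgen l i))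
  have hzero : ∀ Z ≤ Y, ∀ (r : tauZero (Rees (FD n Z))) (t : T.obj Z), t ∈ G.carrier Z →
      r • t ∈ G.carrier Z := by
    intro Z hZ r
    refine tauZero_induct (P := fun r => ∀ (t : T.obj Z), t ∈ G.carrier Z → r • t ∈ G.carrier Z)
      r.2 ?_ ?_ ?_ ?_ ?_
    · intro b t ht
      have := hpoly (Polynomial.C b) t ht
      rwa [polyToZero_C] at this
    · exact htheta Z hZ
    · intro t ht
      have := hpoly Polynomial.X t ht
      rwa [polyToZero_X] at this
    · intro b b' hb hb' t ht
      rw [add_smul]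
      exact add_mem (hb t ht) (hb' t ht)
    · intro b b' hb hb' t ht
      rw [mul_smul]
      exact hb _ (hb' t ht)
  refine ⟨Y, ⟨hW₁, hW₂, hW₃⟩, _, inferInstance, e, ?_, fun Z hZ t ht => ?_⟩
  · rintro (i | j)
    · exact (V.step a).smul_mem _ ((V.step a).res_mem hY1 (hg i.1))
    · exact V.mono hca _ ((V.step c).res_mem hY2 (hh j))
  · refine G.mem_of_loc (AbSheaf.Loc.and_stable (q := fun W _ => W ≤ Y) (H₁ Z (hZ.trans hY1) t ht)
      (fun h _ hs => h.trans hs) hZ) ?_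
    rintro W _ ⟨⟨k, r, rfl⟩, hW⟩
    refine sum_mem fun i _ => hzero W hW (r i) _ ?_
    have := hgen hW (Sum.inl (i, Fin.last _))
    have e1 : e (Sum.inl (i, Fin.last _)) = T.res hY1 (g i) := by
      change ((L.drop L.length).map (eul (Rees (FD n Y)))).prod • (T.res hY1 (g i) : T.obj Y) = _
      rw [List.drop_length, List.map_nil, List.prod_nil, one_smul]
    rw [e1] at this
    rwa [show T.res hW (T.res hY1 (g i)) = T.res k (g i) from T.res_res _ _ _] at this

lemma polyToZero_comm_tauPow {S : Type w} [Ring S] [HasHbar S] (p : Polynomial S) (k : ℤ) :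
    Commute (polyToZero p : tauZero S).1 (tauPow k) := by
  induction p using Polynomial.induction_on with
  | C a => rw [polyToZero_C]; exact ofCoef_comm_tauPow a k
  | add p q hp hq => rw [map_add]; exact hp.add_left hq
  | monomial j a h =>
    rw [pow_succ, ← mul_assoc, map_mul, polyToZero_X]
    refine h.mul_left ?_
    rw [commute_iff_eq, ← tauPow_add, ← tauPow_add, add_comm]

/-- Multiplication by `τ^k`, as a `^τR'_X`-linear morphism. -/
noncomputable def tauPowHom (T : ModSheaf.{u, v, u} (TauLocPsh n X)) (k : ℤ) :
    ((T.restrict (zeroToLoc n X)).restrict (primeToZero n X)).Hom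
      ((T.restrict (zeroToLoc n X)).restrict (primeToZero n X)) where
  app U :=
    { toFun := fun s : T.obj U => (tauPow k : TauLoc (Rees (FD n U))) • s
      map_add' := smul_add _
      map_smul' := fun p (s : T.obj U) => by
        change (tauPow k : TauLoc (Rees (FD n U))) • (polyToZero (S := Rees (FD n U)) p).1 • s =
          (polyToZero (S := Rees (FD n U)) p).1 • (tauPow k : TauLoc (Rees (FD n U))) • s
        rw [← mul_smul, ← mul_smul]
        exact congrArg (fun r : TauLoc (Rees (FD n U)) => r • s)
          (polyToZero_comm_tauPow (S := Rees (FD n U)) p k).eq.symm }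
  app_res h s := (res_tauPow_smul h k s).symm

/-- If some `V_a` is coherent over `^τR'_X`, then every `V_b` is: up to a power of `τ`, it lies
between two submodules isomorphic to `V_a`. -/
theorem IsVFiltration.primeCoherent [LocallyCompactSpace X] {A : Set ℝ} {V : TauFilt T}
    (hV : IsVFiltration T A V) {a : ℝ} (ha : PrimeCoherent (V.step a)) (b : ℝ) :
    PrimeCoherent (V.step b) := by
  have hshift : ∀ k : ℤ, PrimeCoherent (V.step (a + k)) := fun k =>
    SubMod.coherent_of_equiv (tauPowHom T k) (tauPowHom T (-k))
      (fun U (s : T.obj U) => tauPow_smul_neg k s) (fun U (s : T.obj U) => tauPow_neg_smul k s)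
      (fun U s => hV.mem_step_add_iff a k) ha
  have h1 : a + (⌊b - a⌋ : ℤ) ≤ b := by linarith [Int.floor_le (b - a)]
  have h2 : b ≤ a + (⌈b - a⌉ : ℤ) := by linarith [Int.le_ceil (b - a)]
  exact SubMod.coherent_of_le (fun U => V.mono h2 U)
    (hV.fg_prime_of_le h1 ((SubMod.toMod_coherent_iff _).1 (hshift _)).1) (hshift _)

end Prime

/-! ### Restriction to `τ = ħ` and the irregular Hodge filtration -/

section Irregular

open HasHbar

variable {n : ℕ} {X : Type u} [TopologicalSpace X] [ChartedSpace (EuclideanSpace ℂ (Fin n)) X]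
  (M : TildeMod.{u, v} n X)

lemma TildeMod.cls_eq_zero {U : Opens X} (m : M.toModSheaf.obj U) :
    M.cls U m = 0 ↔ m ∈ (hbarSubOne M.toModSheaf).carrier U :=
  quotMk_eq_zero _ _

lemma TildeMod.exists_cls {U : Opens X} (s : M.fibre.obj U) :
    M.fibre.Loc (fun W t => ∃ m, M.cls W m = t) s := by
  intro x hx
  obtain ⟨V, h, hV, m, e⟩ := quot_lift (hbarSubOne M.toModSheaf).toSubSheaf s x hx
  exact ⟨V, h, hV, m, e.symm⟩

lemma TildeMod.cls_of_smul {U : Opens X} (k : ℕ) (P : EndO n U) (hP : P ∈ FD n U k)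
    (m : M.toModSheaf.obj U) : M.cls U (Rees.of (FD n U) k ⟨P, hP⟩ • m) =
      (⟨P, ⟨k, hP⟩⟩ : diffOp n U) • M.cls U m :=
  (M.toModSheaf.proj_smul (hbarSubOne M.toModSheaf) U (Rees.of (FD n U) k ⟨P, hP⟩) m).trans
    (ModSheaf.hbarOne_smul _ (hbar_smul_quot M.toModSheaf) k P hP _)

lemma TildeMod.cls_hbar_smul {U : Opens X} (m : M.toModSheaf.obj U) :
    M.cls U ((hbar : Rees (FD n U)) • m) = M.cls U m :=
  (M.toModSheaf.proj_smul (hbarSubOne M.toModSheaf) U (hbar : Rees (FD n U)) m).trans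
    (hbar_smul_quot M.toModSheaf U _)

lemma TildeMod.clsTau_apply {U : Opens X} (s : M.tau.obj U) (k : ℤ) :
    (M.clsTau U s).1 k = M.cls U (s.1 k) := rfl

lemma TildeMod.clsTau_res {U V : Opens X} (h : V ≤ U) (s : M.tau.obj U) :
    M.clsTau V (M.tau.res h s) = M.fibre.fam.res h (M.clsTau U s) :=
  Subtype.ext (funext fun k => (M.cls_res h (s.1 k)).symm)

/-- The section `τ^k ⊗ u` of `ℂ[τ, τ⁻¹] ⊗ 𝓜`. -/
noncomputable def TildeMod.fibreSingle {U : Opens X} (k : ℤ) (u : M.fibre.obj U) :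
    M.fibre.fam.obj U :=
  famSingle M.fibre.toAbSheaf U k u

lemma TildeMod.fibreSingle_apply {U : Opens X} (k i : ℤ) (u : M.fibre.obj U) :
    (M.fibreSingle k u).1 i = if i = k then u else 0 := by
  change (Pi.single k u : ℤ → M.fibre.obj U) i = _
  rw [Pi.single_apply]

lemma TildeMod.clsTau_single {U : Opens X} (k : ℤ) (m : M.toModSheaf.obj U) :
    M.clsTau U (M.single k m) = M.fibreSingle k (M.cls U m) :=
  Subtype.ext (funext fun i => by
    rw [M.clsTau_apply, M.single_apply, M.fibreSingle_apply]
    split_ifs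
    · rfl
    · exact map_zero _)

lemma TildeMod.res_fibreSingle {U V : Opens X} (h : V ≤ U) (k : ℤ) (u : M.fibre.obj U) :
    M.fibre.fam.res h (M.fibreSingle k u) = M.fibreSingle k (M.fibre.res h u) :=
  Subtype.ext (funext fun i => by
    change M.fibre.res h ((M.fibreSingle k u).1 i) = _
    rw [M.fibreSingle_apply, M.fibreSingle_apply]
    split_ifs
    · rfl
    · rw [map_zero])

/-- The subsheaf `(τ - ħ) ^τM`. -/
noncomputable def TildeMod.tauSubHbarImage : SubSheaf M.tau.toAbSheaf :=
  SubSheaf.gen _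
    (fun U => (DistribSMul.toAddMonoidHom (M.tau.obj U)
      (tauPow 1 - ofCoef hbar : TauLoc (Rees (FD n U)))).range)
    (fun h s => by
      rintro ⟨m, rfl⟩
      refine ⟨M.tau.res h m, ?_⟩
      rw [DistribSMul.toAddMonoidHom_apply, DistribSMul.toAddMonoidHom_apply, res_tau_smul,
        tauRes_tau_sub_hbar])

lemma TildeMod.mem_tauSubHbarImage {U : Opens X} {s : M.tau.obj U} :
    s ∈ M.tauSubHbarImage.carrier U ↔ M.tau.Loc (fun W t => ∃ m : M.tau.obj W,
      t = (tauPow 1 - ofCoef hbar : TauLoc (Rees (FD n W))) • m) s :=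
  ⟨fun H => H.mono fun _ _ ⟨m, e⟩ => ⟨m, e.symm⟩, fun H => H.mono fun _ _ ⟨m, e⟩ => ⟨m, e.symm⟩⟩

lemma TildeMod.clsTau_tau_sub_hbar_smul {U : Opens X} (s : M.tau.obj U) :
    M.clsTau U ((tauPow 1 - ofCoef hbar : TauLoc (Rees (FD n U))) • s) = 0 :=
  Subtype.ext (funext fun i => by
    rw [M.clsTau_apply, tau_tau_sub_hbar_apply, map_sub, M.cls_hbar_smul, sub_self]
    rfl)

/-- `^τM / (τ - ħ) ^τM = ℂ[τ, τ⁻¹] ⊗ 𝓜`: the kernel. -/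
lemma TildeMod.clsTau_eq_zero {U : Opens X} (s : M.tau.obj U) :
    M.clsTau U s = 0 ↔ s ∈ M.tauSubHbarImage.carrier U := by
  constructor
  · intro H
    have hk : ∀ k, s.1 k ∈ (hbarSubOne M.toModSheaf).carrier U := fun k =>
      (M.cls_eq_zero _).1 (congrFun (congrArg Subtype.val H) k)
    have hsingle : ∀ k, M.single k (s.1 k) ∈ M.tauSubHbarImage.carrier U := by
      intro k
      refine M.tauSubHbarImage.of_loc fun x hx => ?_
      obtain ⟨W, h, hW, m, e⟩ := hk k x hx
      refine ⟨W, h, hW, AbSheaf.Loc.of_self ⟨M.single (k - 1) (-m), ?_⟩⟩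
      rw [DistribSMul.toAddMonoidHom_apply, M.tau_sub_hbar_smul_single, sub_add_cancel,
        M.res_single, ← e, DistribSMul.toAddMonoidHom_apply, sub_smul]
      congr 1
      rw [smul_neg, sub_neg_eq_add, neg_add_eq_sub]
      exact congrArg _ (one_smul (Rees (FD n W)) m).symm
    refine M.tauSubHbarImage.of_loc fun x hx => ?_
    obtain ⟨W, h, hW, I, hI⟩ := M.exists_finset s x hx
    refine ⟨W, h, hW, ?_⟩
    rw [M.eq_sum_single hI]
    refine sum_mem fun k _ => ?_
    have := M.tauSubHbarImage.res_mem h (hsingle k)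
    rwa [M.res_single] at this
  · refine fun H => M.fibre.fam.sep _ fun x hx => ?_
    obtain ⟨W, h, hW, m, e⟩ := M.mem_tauSubHbarImage.1 H x hx
    exact ⟨W, h, hW, by rw [← M.clsTau_res, e, M.clsTau_tau_sub_hbar_smul]⟩

/-- The subsheaf of `𝓜` of the sections which are locally classes of sections `m` such that
`τ^k ⊗ m` belongs to `N ⊆ ^τM`. -/
noncomputable def TildeMod.irrStep (N : SubMod (M.tau.restrict (zeroToLoc n X))) (k : ℤ) :
    SubSheaf M.fibre.toAbSheaf :=
  SubSheaf.gen _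
    (fun U =>
      { carrier := {u | ∃ m, M.single k m ∈ N.carrier U ∧ M.cls U m = u}
        zero_mem' := ⟨0, by rw [M.single_zero]; exact zero_mem _, map_zero _⟩
        add_mem' := by
          rintro _ _ ⟨m, hm, rfl⟩ ⟨m', hm', rfl⟩
          exact ⟨m + m', by rw [M.single_add]; exact add_mem hm hm', map_add _ _ _⟩
        neg_mem' := by
          rintro _ ⟨m, hm, rfl⟩
          refine ⟨-m, ?_, map_neg _ _⟩
          have e : M.single k (-m) = -M.single k m := by
            rw [eq_neg_iff_add_eq_zero, ← M.single_add, neg_add_cancel, M.single_zero]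
          rw [e]
          exact neg_mem hm })
    (fun h u => by
      rintro ⟨m, hm, rfl⟩
      refine ⟨M.toModSheaf.res h m, ?_, (M.cls_res h m).symm⟩
      rw [← M.res_single]
      exact N.res_mem h hm)

variable {M} {N : SubMod (M.tau.restrict (zeroToLoc n X))}

lemma TildeMod.mem_irrStep {k : ℤ} {U : Opens X} {u : M.fibre.obj U} :
    u ∈ (M.irrStep N k).carrier U ↔
      M.fibre.Loc (fun W t => ∃ m, M.single k m ∈ N.carrier W ∧ M.cls W m = t) u := Iff.rfl

lemma SubMod.coef_smul_mem {T : ModSheaf.{u, v, u} (TauLocPsh n X)}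
    (N : SubMod (T.restrict (zeroToLoc n X))) {U : Opens X} (r : Rees (FD n U)) {s : T.obj U}
    (hs : s ∈ N.carrier U) : (ofCoef r : TauLoc (Rees (FD n U))) • s ∈ N.carrier U :=
  (N.sec U).smul_mem (coefZ r) hs

lemma SubMod.tauPow_smul_mem {T : ModSheaf.{u, v, u} (TauLocPsh n X)}
    (N : SubMod (T.restrict (zeroToLoc n X))) {U : Opens X} {k : ℤ} (hk : 0 ≤ k) {s : T.obj U}
    (hs : s ∈ N.carrier U) : (tauPow k : TauLoc (Rees (FD n U))) • s ∈ N.carrier U :=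
  (N.sec U).smul_mem (⟨tauPow k, tauPow_mem hk⟩ : tauZero (Rees (FD n U))) hs

/-- The filtration `F_k 𝓜` of `𝓜` defined by a submodule `N` of `^τM` such that
`^τM = ⋃_k τ^{-k} N`. -/
noncomputable def TildeMod.irrFilt (N : SubMod (M.tau.restrict (zeroToLoc n X)))
    (hN : ∀ (U : Opens X) (s : M.tau.obj U), M.tau.Loc (fun W t => ∃ k : ℕ,
      (tauPow (k : ℤ) : TauLoc (Rees (FD n W))) • t ∈ N.carrier W) s) : DFiltration M.fibre where
  step := M.irrStep N
  mono {j k} hjk U u hu := hu.mono fun W t ⟨m, hm, e⟩ => by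
    refine ⟨m, ?_, e⟩
    have := N.tauPow_smul_mem (sub_nonneg.2 hjk) hm
    rwa [M.tauPow_smul_single, add_sub_cancel] at this
  smul_mem {U} j P hP k u hu := (M.irrStep N (k + j)).of_loc fun x hx => by
    obtain ⟨W, h, hW, m, hm, e⟩ := hu x hx
    refine ⟨W, h, hW, AbSheaf.Loc.of_self ⟨Rees.of (FD n W) j ⟨EndO.res n h P, FD.res n h j P hP⟩ • m,
      ?_, ?_⟩⟩
    · rw [← M.of_smul_single]
      exact N.coef_smul_mem _ hm
    · refine (M.cls_of_smul j _ _ m).trans ?_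
      rw [e]
      exact (M.fibre.res_smul h (⟨P, ⟨j, hP⟩⟩ : diffOp n U) u).symm
  exhaustive U u := by
    refine AbSheaf.Loc.bind (M.exists_cls u) ?_
    rintro W _ ⟨m, rfl⟩ x hx
    obtain ⟨Z, h, hZ, k, hk⟩ := hN W (M.single 0 m) x hx
    refine ⟨Z, h, hZ, k, AbSheaf.Loc.of_self ⟨M.toModSheaf.res h m, ?_, (M.cls_res h m).symm⟩⟩
    rw [M.res_single, M.tauPow_smul_single, zero_add] at hk
    exact hk

/-- The image of `N` in `ℂ[τ, τ⁻¹] ⊗ 𝓜`. -/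
noncomputable def TildeMod.clsTauImage (N : SubMod (M.tau.restrict (zeroToLoc n X))) :
    SubSheaf M.fibre.fam :=
  SubSheaf.gen _ (fun U => (N.carrier U).map (M.clsTau U)) (fun h s => by
    rintro ⟨m, hm, rfl⟩
    exact ⟨M.tau.res h m, N.res_mem h hm, M.clsTau_res h m⟩)

/-- If `N` is graded, so is its image, with components `F_k 𝓜`. -/
lemma TildeMod.mem_clsTauImage_iff (hN : IsTauGraded M N) {U : Opens X} {s : M.fibre.fam.obj U} :
    s ∈ (TildeMod.clsTauImage N).carrier U ↔ ∀ k, s.1 k ∈ (M.irrStep N k).carrier U := by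
  constructor
  · intro H k x hx
    obtain ⟨W, h, hW, m, hm, e⟩ := H x hx
    exact ⟨W, h, hW, m.1 k, hN W m hm k, congrFun (congrArg Subtype.val e) k⟩
  · intro H
    have hsingle : ∀ k, M.fibreSingle k (s.1 k) ∈ (TildeMod.clsTauImage N).carrier U := by
      intro k x hx
      obtain ⟨W, h, hW, m, hm, e⟩ := H k x hx
      exact ⟨W, h, hW, M.single k m, hm, by rw [M.clsTau_single, e, M.res_fibreSingle]⟩
    refine (TildeMod.clsTauImage N).of_loc fun x hx => ?_
    obtain ⟨W, h, hW, hI⟩ := s.2 x hx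
    refine ⟨W, h, hW, ?_⟩
    have e : M.fibre.fam.res h s = ∑ k ∈ hI.toFinset, M.fibreSingle k (M.fibre.res h (s.1 k)) := by
      have hsum : ∀ (I : Finset ℤ) (i : ℤ),
          (∑ k ∈ I, M.fibreSingle k (M.fibre.res h (s.1 k))).1 i =
            ∑ k ∈ I, (M.fibreSingle k (M.fibre.res h (s.1 k))).1 i := by
        intro I i
        induction I using Finset.induction_on with
        | empty => rfl
        | insert k I hk ih => rw [Finset.sum_insert hk, Finset.sum_insert hk, ← ih]; rfl
      refine Subtype.ext (funext fun i => ?_)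
      rw [hsum]
      simp only [M.fibreSingle_apply]
      rw [Finset.sum_ite_eq]
      split_ifs with hi
      · rfl
      · by_contra hne
        exact hi (hI.mem_toFinset.2 hne)
    rw [e]
    refine sum_mem fun k _ => ?_
    have := (TildeMod.clsTauImage N).res_mem h (hsingle k)
    rwa [M.res_fibreSingle] at this

lemma DFiltration.mem_rees {Q : ModSheaf.{u, w, u} (DPsh n X)} {F : DFiltration Q} {U : Opens X}
    {s : Q.fam.obj U} : s ∈ F.rees.carrier U ↔ ∀ k, s.1 k ∈ (F.step k).carrier U := Iff.rfl

lemma DFiltration.ext_step {Q : ModSheaf.{u, w, u} (DPsh n X)} {F F' : DFiltration Q}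
    (h : ∀ k, F.step k = F'.step k) : F = F' := by
  obtain ⟨s, _, _, _⟩ := F
  obtain ⟨s', _, _, _⟩ := F'
  obtain rfl : s = s' := funext h
  rfl

lemma isReesOf_irrFilt (hgr : IsTauGraded M N) (hsat : IsTauHbarSaturated N) (hN) :
    IsReesOf M N (TildeMod.irrFilt N hN) := by
  refine ⟨fun U m hm => ?_, fun U s => ?_⟩
  · rw [M.clsTau_eq_zero, M.mem_tauSubHbarImage]
    exact ⟨fun H => (hsat U m).2 ⟨hm, H⟩, fun H => ((hsat U m).1 H).2⟩
  · rw [DFiltration.mem_rees]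
    exact (TildeMod.mem_clsTauImage_iff hgr).symm

/-- The filtration of `𝓜` is determined by its Rees module. -/
lemma IsReesOf.step_eq (hgr : IsTauGraded M N) {F : DFiltration M.fibre} (hF : IsReesOf M N F)
    (k : ℤ) : F.step k = M.irrStep N k := by
  have key : ∀ (U : Opens X) (s : M.fibre.fam.obj U),
      (∀ k, s.1 k ∈ (F.step k).carrier U) ↔ ∀ k, s.1 k ∈ (M.irrStep N k).carrier U := fun U s =>
    (hF.2 U s).trans (TildeMod.mem_clsTauImage_iff hgr)
  have hs : ∀ (G : ℤ → SubSheaf M.fibre.toAbSheaf) (U : Opens X) (u : M.fibre.obj U),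
      (∀ i, (M.fibreSingle k u).1 i ∈ (G i).carrier U) ↔ u ∈ (G k).carrier U := by
    intro G U u
    constructor
    · intro H
      have := H k
      rwa [M.fibreSingle_apply, if_pos rfl] at this
    · intro H i
      rw [M.fibreSingle_apply]
      split_ifs with h
      · rwa [h]
      · exact zero_mem _
  exact SubSheaf.ext fun U u => by
    rw [← hs (fun k => F.step k), key, hs (M.irrStep N)]

/-- The specialization `τ = ħ`: `R_X[τ] → R_X`. -/
noncomputable def evalTauHbar : (TauPrimePsh n X).Hom (ReesPsh n X) where
  app U := (Polynomial.eval₂RingHom' (RingHom.id (Rees (FD n U))) (hbar : Rees (FD n U))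
    fun a => HasHbar.comm a : Polynomial (Rees (FD n U)) →+* Rees (FD n U))
  app_res {U V} h p := by
    change Polynomial (Rees (FD n U)) at p
    change Polynomial.eval₂ (RingHom.id (Rees (FD n V))) hbar (Polynomial.map (reesRes n h) p) =
      reesRes n h (Polynomial.eval₂ (RingHom.id (Rees (FD n U))) hbar p)
    rw [Polynomial.eval₂_map, Polynomial.hom_eval₂, reesRes_hbar]
    rfl

lemma evalTauHbar_C {U : Opens X} (a : Rees (FD n U)) :
    (evalTauHbar (n := n)).app U (Polynomial.C a : Polynomial (Rees (FD n U))) = a :=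
  Polynomial.eval₂_C _ _

lemma evalTauHbar_X {U : Opens X} :
    (evalTauHbar (n := n)).app U (Polynomial.X : Polynomial (Rees (FD n U))) =
      (hbar : Rees (FD n U)) :=
  Polynomial.eval₂_X _ _

lemma TildeMod.clsTau_coef_smul {U : Opens X} (a : Rees (FD n U)) (s : M.tau.obj U) :
    M.clsTau U ((ofCoef a : TauLoc (Rees (FD n U))) • s) =
      grHom (M.fibre.restrict (ReesPsh.toD n X)) U a (M.clsTau U s) := by
  induction a using Rees.induct with
  | h0 =>
    rw [map_zero, map_zero]
    exact (congrArg _ (zero_smul (TauLoc (Rees (FD n U))) s)).trans (map_zero _)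
  | h k P =>
    refine Subtype.ext (funext fun i => ?_)
    rw [M.clsTau_apply, tau_of_apply, grHom_of]
    refine (M.cls_of_smul k P.1 P.2 _).trans ?_
    have e : (ReesPsh.toD n X).app U (Rees.of (FD n U) k P) = ⟨P.1, ⟨k, P.2⟩⟩ :=
      Subtype.ext (Rees.toAlg_of k P)
    exact congrArg (fun Q : diffOp n U => Q • M.cls U (s.1 (i - k))) e.symm
  | hadd a b ha hb =>
    rw [map_add, map_add, add_smul, map_add, ha, hb]
    rfl

/-- On `ℂ[τ, τ⁻¹] ⊗ 𝓜`, the actions of `τ` and of `ħ` coincide. -/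
lemma TildeMod.clsTau_prime_smul {U : Opens X} (p : Polynomial (Rees (FD n U))) (s : M.tau.obj U) :
    M.clsTau U ((polyToZero p : tauZero (Rees (FD n U))) • s) =
      grHom (M.fibre.restrict (ReesPsh.toD n X)) U (evalTauHbar.app U p) (M.clsTau U s) := by
  induction p using Polynomial.induction_on generalizing s with
  | C a =>
    rw [polyToZero_C, evalTauHbar_C]
    exact M.clsTau_coef_smul a s
  | add p q hp hq =>
    rw [map_add, add_smul, map_add, hp, hq]
    refine Eq.trans ?_ (congrArg (fun r => grHom (M.fibre.restrict (ReesPsh.toD n X)) U r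
      (M.clsTau U s)) (map_add (evalTauHbar.app U) p q).symm)
    exact (congrArg (fun f : AddMonoid.End _ => f (M.clsTau U s))
      (map_add (grHom (M.fibre.restrict (ReesPsh.toD n X)) U) _ _)).symm
  | monomial k a h =>
    rw [pow_succ, ← mul_assoc]
    generalize Polynomial.C a * Polynomial.X ^ k = q at h ⊢
    rw [map_mul, mul_smul, h]
    refine Eq.trans ?_ (congrArg (fun r => grHom (M.fibre.restrict (ReesPsh.toD n X)) U r
      (M.clsTau U s)) (map_mul (evalTauHbar.app U) q Polynomial.X).symm)
    refine Eq.trans ?_ (congrArg (fun f : AddMonoid.End _ => f (M.clsTau U s))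
      (map_mul (grHom (M.fibre.restrict (ReesPsh.toD n X)) U) _ _)).symm
    refine congrArg (grHom (M.fibre.restrict (ReesPsh.toD n X)) U (evalTauHbar.app U q)) ?_
    rw [polyToZero_X]
    refine Eq.trans ?_ (congrArg (fun r => grHom (M.fibre.restrict (ReesPsh.toD n X)) U r
      (M.clsTau U s)) (evalTauHbar_X (n := n) (U := U))).symm
    have e : M.clsTau U ((tauPow 1 - ofCoef hbar : TauLoc (Rees (FD n U))) • s) = 0 :=
      M.clsTau_tau_sub_hbar_smul s
    rw [sub_smul, map_sub, sub_eq_zero] at e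
    exact e.trans (M.clsTau_coef_smul _ s)

lemma polyToZero_comm_tauSubHbarZ {S : Type w} [Ring S] [HasHbar S] (p : Polynomial S) :
    Commute (polyToZero p) (tauSubHbarZ : tauZero S) := by
  have e : (tauSubHbarZ : tauZero S) = polyToZero (Polynomial.X - Polynomial.C hbar) := by
    rw [map_sub, polyToZero_X, polyToZero_C]
    rfl
  rw [e]
  refine Commute.map (Commute.sub_right (Polynomial.commute_X p).symm ?_) polyToZero
  rw [commute_iff_eq]
  ext k
  rw [Polynomial.coeff_mul_C, Polynomial.coeff_C_mul, (HasHbar.comm _).eq]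

/-- If `N` is coherent over `^τR'_X`, its restriction `N / (τ - ħ)N` to `τ = ħ` is a coherent
`R_X`-module. -/
theorem IsReesOf.isCoherent {F : DFiltration M.fibre} (hF : IsReesOf M N F)
    (hN : PrimeCoherent N) : F.IsCoherent := by
  refine SubMod.coherent_of_quotient (N := N.restrict (primeToZero n X)) (evalTauHbar (n := n))
    (fun U a => ⟨(Polynomial.C a : Polynomial (Rees (FD n U))), evalTauHbar_C a⟩)
    (fun U => M.clsTau U) (fun h s => M.clsTau_res h s) (fun U p s => M.clsTau_prime_smul p s)
    (fun U s => hF.2 U s) (fun x => ?_) hN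
  obtain ⟨V, hV, p, g, hg, H⟩ := ((SubMod.toMod_coherent_iff _).1 hN).1 x
  refine ⟨V, hV, p, fun j => (tauSubHbarZ : tauZero (Rees (FD n V))) • (g j : M.tau.obj V),
    fun j => ⟨(N.sec V).smul_mem _ (hg j), M.clsTau_tau_sub_hbar_smul _⟩, fun Z hZ s hs h => ?_⟩
  refine AbSheaf.Loc.bind (AbSheaf.Loc.and_stable (q := fun W _ => W ≤ V) ((hF.1 Z s hs).1 h)
    (fun h _ hs => h.trans hs) hZ) ?_
  rintro W _ ⟨⟨m, hm, rfl⟩, hW⟩ y hy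
  obtain ⟨Y, k, hY, l, c, e⟩ := H W hW m hm y hy
  refine ⟨Y, k, hY, l, c, ?_⟩
  refine (res_tau_smul k _ m).trans ?_
  rw [tauRes_tau_sub_hbar]
  refine (congrArg (fun t : M.tau.obj Y => (tauSubHbarZ : tauZero (Rees (FD n Y))) • t) e).trans ?_
  change (tauSubHbarZ : tauZero (Rees (FD n Y))) •
    (∑ i, (polyToZero (c i) : tauZero (Rees (FD n Y))) • (M.tau.res l (g i) : M.tau.obj Y)) = _
  rw [Finset.smul_sum]
  refine Finset.sum_congr rfl fun i _ => ?_
  have e2 : M.tau.res l ((tauSubHbarZ : tauZero (Rees (FD n V))) • (g i : M.tau.obj V)) =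
      (tauSubHbarZ : tauZero (Rees (FD n Y))) • (M.tau.res l (g i) : M.tau.obj Y) :=
    (res_tau_smul l _ _).trans (congrArg (fun r : TauLoc (Rees (FD n Y)) => r • M.tau.res l (g i))
      (tauRes_tau_sub_hbar l))
  change _ = (polyToZero (c i) : tauZero (Rees (FD n Y))) •
    M.tau.res l ((tauSubHbarZ : tauZero (Rees (FD n V))) • (g i : M.tau.obj V))
  rw [e2, ← mul_smul, ← mul_smul, (polyToZero_comm_tauSubHbarZ (S := Rees (FD n Y)) (c i)).eq]

end Irregular

/-! ### Strictly specializable morphisms -/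

section Strict

open HasHbar

variable {n : ℕ} {X : Type u} [TopologicalSpace X] [ChartedSpace (EuclideanSpace ℂ (Fin n)) X]
  {T T' : ModSheaf.{u, v, u} (TauLocPsh n X)}

/-- The sum `φ(P) + Q`, for a morphism `φ : T → T'` and sheaves of `V_0`-submodules `P ⊆ T` and
`Q ⊆ T'`. -/
noncomputable def SubMod.mapAdd (φ : T.Hom T') (P : SubMod (T.restrict (zeroToLoc n X)))
    (Q : SubMod (T'.restrict (zeroToLoc n X))) : SubMod (T'.restrict (zeroToLoc n X)) :=
  SubMod.gen (T'.restrict (zeroToLoc n X))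
    (fun U => (P.carrier U).map (φ.app U).toAddMonoidHom ⊔ Q.carrier U)
    (fun {U W} h s hs => by
      obtain ⟨_, ⟨t, ht, rfl⟩, v, hv, rfl⟩ := AddSubgroup.mem_sup.1 hs
      refine AddSubgroup.mem_sup.2 ⟨_, ⟨T.res h t, P.res_mem h ht, rfl⟩, T'.res h v,
        Q.res_mem h hv, ?_⟩
      exact (congrArg (· + T'.res h v) (φ.app_res h t)).trans (map_add (T'.res h) _ _).symm)
    (fun {U} r s hs => by
      obtain ⟨_, ⟨t, ht, rfl⟩, v, hv, rfl⟩ := AddSubgroup.mem_sup.1 hs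
      refine AddSubgroup.mem_sup.2 ⟨_, ⟨(zeroToLoc n X).app U r • t, P.smul_mem r ht, rfl⟩, _,
        Q.smul_mem r hv, ?_⟩
      refine (congrArg (· + _) ((φ.app U).map_smul ((zeroToLoc n X).app U r) t)).trans ?_
      exact (smul_add ((zeroToLoc n X).app U r) (φ.app U t) (v : T'.obj U)).symm)

variable {φ : T.Hom T'} {P P' : SubMod (T.restrict (zeroToLoc n X))}
  {Q Q' : SubMod (T'.restrict (zeroToLoc n X))}

lemma SubMod.mem_mapAdd {U : Opens X} {s : T'.obj U} : s ∈ (SubMod.mapAdd φ P Q).carrier U ↔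
    T'.Loc (fun W y => ∃ t ∈ P.carrier W, ∃ v ∈ Q.carrier W, y = φ.app W t + v) s := by
  constructor
  · intro h
    refine AbSheaf.Loc.mono h fun W y hy => ?_
    obtain ⟨_, ⟨t, ht, rfl⟩, v, hv, rfl⟩ := AddSubgroup.mem_sup.1 hy
    exact ⟨t, ht, v, hv, rfl⟩
  · intro h
    refine AbSheaf.Loc.mono (M := T'.toAbSheaf) h fun W y hy => ?_
    obtain ⟨t, ht, v, hv, rfl⟩ := hy
    exact AddSubgroup.mem_sup.2 ⟨_, ⟨t, ht, rfl⟩, v, hv, rfl⟩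

lemma SubMod.app_mem_mapAdd {U : Opens X} {t : T.obj U} (ht : t ∈ P.carrier U) :
    φ.app U t ∈ (SubMod.mapAdd φ P Q).carrier U :=
  SubMod.mem_mapAdd.2 fun x hx => ⟨U, le_rfl, hx, t, ht, 0, zero_mem _, by
    rw [add_zero]; exact T'.res_id _⟩

lemma SubMod.mem_mapAdd_right {U : Opens X} {v : T'.obj U} (hv : v ∈ Q.carrier U) :
    v ∈ (SubMod.mapAdd φ P Q).carrier U :=
  SubMod.mem_mapAdd.2 fun x hx => ⟨U, le_rfl, hx, 0, zero_mem _, v, hv, by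
    rw [map_zero, zero_add]; exact T'.res_id _⟩

lemma SubMod.mapAdd_mono (hP : ∀ U, P.carrier U ≤ P'.carrier U)
    (hQ : ∀ U, Q.carrier U ≤ Q'.carrier U) (U : Opens X) :
    (SubMod.mapAdd φ P Q).carrier U ≤ (SubMod.mapAdd φ P' Q').carrier U := fun _ hs =>
  SubMod.mem_mapAdd.2 (AbSheaf.Loc.mono (SubMod.mem_mapAdd.1 hs) fun _ _ ⟨t, ht, v, hv, e⟩ =>
    ⟨t, hP _ ht, v, hQ _ hv, e⟩)

variable {V : TauFilt T} {V' : TauFilt T'}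

lemma mem_grImage_iff (hφ : ∀ (a : ℝ) (U : Opens X), ∀ t ∈ (V.step a).carrier U,
      φ.app U t ∈ (V'.step a).carrier U) {a : ℝ} {U : Opens X} {y : T'.obj U}
    (hy : y ∈ (V'.step a).carrier U) : V'.grMk a U ⟨y, hy⟩ ∈ (grImage φ V V' a).carrier U ↔
      y ∈ (SubMod.mapAdd φ (V.step a) (V'.ltSub a)).carrier U := by
  have key : ∀ {W : Opens X} (h : W ≤ U) (t : T.obj W) (ht : t ∈ (V.step a).carrier W),
      (V'.gr a).res h (V'.grMk a U ⟨y, hy⟩) = V'.grMk a W ⟨φ.app W t, hφ a W t ht⟩ ↔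
        T'.res h y - φ.app W t ∈ (V'.ltSub a).carrier W := by
    intro W h t ht
    let s₁ : (V'.step a).toMod.obj W := ⟨T'.res h y, (V'.step a).res_mem h hy⟩
    let s₂ : (V'.step a).toMod.obj W := ⟨φ.app W t, hφ a W t ht⟩
    have e : (V'.gr a).res h (V'.grMk a U ⟨y, hy⟩) = V'.grMk a W s₁ := quotMk_res _ h _
    refine (Eq.congr e rfl).trans ?_
    change V'.grMk a W s₁ = V'.grMk a W s₂ ↔ _
    rw [← sub_eq_zero, ← map_sub]
    exact V'.grMk_eq_zero (s₁ - s₂)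
  constructor
  · intro H
    refine SubMod.mem_mapAdd.2 fun x hx => ?_
    obtain ⟨W, h, hW, t, ht, _, e⟩ := H x hx
    exact ⟨W, h, hW, t, ht, _, (key h t ht).1 e, (add_sub_cancel _ _).symm⟩
  · intro H x hx
    obtain ⟨W, h, hW, t, ht, v, hv, e⟩ := SubMod.mem_mapAdd.1 H x hx
    refine ⟨W, h, hW, t, ht, hφ a W t ht, (key h t ht).2 ?_⟩
    rw [e, add_sub_cancel_left]
    exact hv

/-- Strict specializability of `φ`, in terms of sections: `ħ` is injective on
`V'_a / (φ(V_a) + V'_{<a})`. -/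
lemma IsSpecializableHom.mem_of_hbar (h : IsSpecializableHom φ V V')
    (hφ : ∀ (a : ℝ) (U : Opens X), ∀ t ∈ (V.step a).carrier U,
      φ.app U t ∈ (V'.step a).carrier U) {a : ℝ} {U : Opens X} {y : T'.obj U}
    (hy : y ∈ (V'.step a).carrier U)
    (hb : (hbarZ : tauZero (Rees (FD n U))) • y ∈
      (SubMod.mapAdd φ (V.step a) (V'.ltSub a)).carrier U) :
    y ∈ (SubMod.mapAdd φ (V.step a) (V'.ltSub a)).carrier U := by
  rw [← mem_grImage_iff hφ hy]
  have h1 := (mem_grImage_iff hφ ((V'.step a).smul_mem (hbarZ : tauZero (Rees (FD n U))) hy)).2 hb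
  have h2 := (congrArg (· ∈ (grImage φ V V' a).carrier U)
    (grMk_smul V' (hbarZ : tauZero (Rees (FD n U))) hy)).mp h1
  refine (quotMk_eq_zero _ _).1 (h a Polynomial.X Polynomial.X_ne_zero U
    ((V'.gr a).proj (grImage φ V V' a) U (V'.grMk a U ⟨y, hy⟩)) ?_)
  rw [Polynomial.aeval_X]
  exact ((V'.gr a).proj_smul (grImage φ V V' a) U (hbarZ : tauZero (Rees (FD n U))) _).symm.trans
    ((quotMk_eq_zero _ _).2 h2)

end Strict

section StrictInduction

open HasHbar

variable {n : ℕ} {X : Type u} [TopologicalSpace X] [ChartedSpace (EuclideanSpace ℂ (Fin n)) X]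
  [LocallyCompactSpace X] {T T' : ModSheaf.{u, v, u} (TauLocPsh n X)} {φ : T.Hom T'}
  {A A' : Set ℝ} {V : TauFilt T} {V' : TauFilt T'}

lemma IsVFiltration.hom_app_mem (hV : IsVFiltration T A V) (hV' : IsVFiltration T' A' V')
    (φ : T.Hom T') (a : ℝ) (U : Opens X) (t : T.obj U) (ht : t ∈ (V.step a).carrier U) :
    φ.app U t ∈ (V'.step a).carrier U :=
  φ.toSemilin.app_mem_step hV hV' a ht

lemma max_mem_of_mem {J : Set ℝ} {a b : ℝ} (ha : a ∈ J) (hb : b ∈ J) : max a b ∈ J := by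
  rcases max_choice a b with h | h <;> rw [h] <;> assumption

/-- Assume that `ħ` is injective on `V'_d / (φ(V_d) + V'_c)` for `d < b`. If `t ∈ V_b` and
`φ(t) ∈ V'_d` with `d < b`, the class of `φ(t)` in this quotient is killed by a power of
`τð_τ + bħ` (for large `d < b`) and by a product of operators `τð_τ + eħ` with `e ≤ d`; hence it
vanishes. -/
lemma IsVFiltration.loc_app_mem_mapAdd (hV : IsVFiltration T A V) (hV' : IsVFiltration T' A' V')
    {b c : ℝ}
    (hb : ∀ d ∈ addInt A ∪ addInt A', d < b → ∀ (U : Opens X) (y : T'.obj U),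
      y ∈ (V'.step d).carrier U → (hbarZ : tauZero (Rees (FD n U))) • y ∈
        (SubMod.mapAdd φ (V.step d) (V'.step c)).carrier U →
      y ∈ (SubMod.mapAdd φ (V.step d) (V'.step c)).carrier U)
    {U : Opens X} {t : T.obj U} (ht : t ∈ (V.step b).carrier U)
    (h : φ.app U t ∈ (V'.ltSub b).carrier U) :
    T'.Loc (fun W y => ∃ d ∈ addInt A ∪ addInt A', d < b ∧
      y ∈ (SubMod.mapAdd φ (V.step d) (V'.step c)).carrier W) (φ.app U t) := by
  intro x hx
  obtain ⟨W₁, k₁, hW₁, d₁, hd₁, hdb₁, e₁⟩ := hV'.loc_of_mem_ltSub h x hx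
  obtain ⟨W₂, hW₂, N, e₂⟩ := hV.exists_eul_pow_mem b x
  have e₂ := e₂ (W₂ ⊓ U) inf_le_left _ ((V.step b).res_mem inf_le_right ht)
  obtain ⟨W₃, k₃, hW₃, d₂, hd₂, hdb₂, e₃⟩ := hV.loc_of_mem_ltSub e₂ x ⟨hW₂, hx⟩
  have hdb := max_lt hdb₁ hdb₂
  have hd : max d₁ d₂ ∈ addInt A ∪ addInt A' := max_mem_of_mem (Or.inr hd₁) (Or.inl hd₂)
  have hd1 := le_max_left d₁ d₂
  have hd2 := le_max_right d₁ d₂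
  generalize max d₁ d₂ = d at hdb hd hd1 hd2
  obtain ⟨W₄, hW₄, L, hL, e₄⟩ := hV'.exists_eul_prod_mem d c x
  have j₁ : W₁ ⊓ W₃ ⊓ W₄ ≤ W₁ := inf_le_left.trans inf_le_left
  have j₃ : W₁ ⊓ W₃ ⊓ W₄ ≤ W₃ := inf_le_left.trans inf_le_right
  have j₄ : W₁ ⊓ W₃ ⊓ W₄ ≤ W₄ := inf_le_right
  have hxW : x ∈ W₁ ⊓ W₃ ⊓ W₄ := ⟨⟨hW₁, hW₃⟩, hW₄⟩
  generalize W₁ ⊓ W₃ ⊓ W₄ = W at j₁ j₃ j₄ hxW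
  refine ⟨W, j₁.trans k₁, hxW, d, hd, hdb, ?_⟩
  have h₁ := V'.mono hd1 _ ((V'.step d₁).res_mem j₁ e₁)
  rw [AbSheaf.res_res] at h₁
  have h₃ := V.mono hd2 _ ((V.step d₂).res_mem j₃ e₃)
  have e₅ : T.res j₃ (T.res k₃ (eul (Rees (FD n (W₂ ⊓ U))) b ^ N • T.res inf_le_right t)) =
      eul (Rees (FD n W)) b ^ N • T.res (j₁.trans k₁) t := by
    rw [T.res_res]
    have e := res_eul_prod_smul (T := T) (j₃.trans k₃) (List.replicate N b) (T.res inf_le_right t)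
    rw [List.map_replicate, List.map_replicate, List.prod_replicate, List.prod_replicate,
      T.res_res] at e
    exact e
  have h₃ := (congrArg (· ∈ (V.step d).carrier W) e₅).mp h₃
  refine mem_of_eul_pow_of_prod ((V'.step d).sec W) ((SubMod.mapAdd φ (V.step d) (V'.step c)).sec W)
    (fun y hy => hb d hd hdb W y hy) (L := L) (b := b) (N := N)
    (fun e he => ((hL e he).2.trans_lt hdb).ne) h₁ ?_
    (SubMod.mem_mapAdd_right (e₄ W j₄ _ h₁))
  have e₆ : φ.app W (eul (Rees (FD n W)) b ^ N • T.res (j₁.trans k₁) t) =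
      eul (Rees (FD n W)) b ^ N • T'.res (j₁.trans k₁) (φ.app U t) := by
    refine ((φ.app W).map_smul ((eul (Rees (FD n W)) b ^ N).1 : TauLoc (Rees (FD n W))) _).trans ?_
    rw [φ.app_res]
    rfl
  exact (congrArg (· ∈ (SubMod.mapAdd φ (V.step d) (V'.step c)).carrier W) e₆).mp
    (SubMod.app_mem_mapAdd h₃)

/-- If `φ` is strictly specializable, `ħ` is injective on `V'_b / (φ(V_b) + V'_c)`. -/
lemma IsSpecializableHom.mem_mapAdd_of_hbar (h : IsSpecializableHom φ V V')
    (hV : IsVFiltration T A V) (hV' : IsVFiltration T' A' V') (c : ℝ) :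
    ∀ b ∈ addInt A ∪ addInt A', ∀ (U : Opens X) (y : T'.obj U),
      y ∈ (V'.step b).carrier U → (hbarZ : tauZero (Rees (FD n U))) • y ∈
        (SubMod.mapAdd φ (V.step b) (V'.step c)).carrier U →
      y ∈ (SubMod.mapAdd φ (V.step b) (V'.step c)).carrier U := by
  refine (hV.wellBounded.union hV'.wellBounded).induction c
    (fun b _ hbc U y hy _ => SubMod.mem_mapAdd_right (V'.mono hbc U hy)) ?_
  intro b hb hcb ih U y hy hyb
  have h1 := h.mem_of_hbar (hV.hom_app_mem hV' φ) hy (SubMod.mapAdd_mono (fun _ => le_rfl)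
    (fun W v hv => V'.mem_ltSub_of_lt hcb hv) U hyb)
  refine (SubMod.mapAdd φ (V.step b) (V'.step c)).of_loc fun x hx => ?_
  -- `y = φ(t) + y'` with `y' ∈ V'_d`, `d < b`, and `ħy = φ(t₁) + v` with `v ∈ V'_c`
  obtain ⟨W₁, k₁, hW₁, t, ht, y', hy', e⟩ := SubMod.mem_mapAdd.1 h1 x hx
  obtain ⟨W₂, k₂, hW₂, t₁, ht₁, v, hv, e₁⟩ := SubMod.mem_mapAdd.1 hyb x hx
  obtain ⟨W₃, k₃, hW₃, d₁, hd₁, hdb₁, e₃⟩ := hV'.loc_of_mem_ltSub hy' x hW₁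
  have j₂ : W₂ ⊓ W₃ ≤ W₂ := inf_le_left
  have j₃ : W₂ ⊓ W₃ ≤ W₃ := inf_le_right
  have hxW : x ∈ W₂ ⊓ W₃ := ⟨hW₂, hW₃⟩
  generalize W₂ ⊓ W₃ = W at j₂ j₃ hxW
  have q : T'.res (j₂.trans k₂) y = φ.app W (T.res (j₃.trans k₃) t) + T'.res (j₃.trans k₃) y' := by
    have := congrArg (T'.res (j₃.trans k₃)) e
    rw [map_add, AbSheaf.res_res] at this
    rw [φ.app_res]
    exact this
  have q₁ : (hbarZ : tauZero (Rees (FD n W))) • T'.res (j₂.trans k₂) y =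
      φ.app W (T.res j₂ t₁) + T'.res j₂ v := by
    have := congrArg (T'.res j₂) e₁
    rw [map_add] at this
    rw [φ.app_res]
    refine Eq.trans ?_ this
    refine Eq.symm ((T'.res_res k₂ j₂ _).trans ((res_tau_smul (j₂.trans k₂) _ y).trans ?_))
    exact congrArg (fun r : TauLoc (Rees (FD n W)) => r • T'.res (j₂.trans k₂) y)
      (tauRes_hbar (j₂.trans k₂))
  have hy₂ : T'.res (j₃.trans k₃) y' ∈ (V'.step d₁).carrier W := by
    have := (V'.step d₁).res_mem j₃ e₃
    rwa [AbSheaf.res_res] at this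
  have ht₂ := (V.step b).res_mem (j₃.trans k₃) ht
  have ht₃ := (V.step b).res_mem j₂ ht₁
  have hv₂ := (V'.step c).res_mem j₂ hv
  change T.res (j₃.trans k₃) t ∈ _ at ht₂
  change T.res j₂ t₁ ∈ _ at ht₃
  change T'.res j₂ v ∈ _ at hv₂
  have goal : T'.res (j₂.trans k₂) y ∈
      (SubMod.mapAdd φ (V.step b) (V'.step c)).carrier W := by
    generalize T'.res (j₂.trans k₂) y = y₀ at *
    generalize T'.res (j₃.trans k₃) y' = y₂ at *
    generalize T.res (j₃.trans k₃) t = t₂ at *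
    generalize T.res j₂ t₁ = t₃ at *
    generalize T'.res j₂ v = v₂ at *
    subst q
    refine add_mem (SubMod.app_mem_mapAdd ht₂) ?_
    have q₂ : φ.app W (t₃ - (hbarZ : tauZero (Rees (FD n W))) • t₂) =
        (hbarZ : tauZero (Rees (FD n W))) • y₂ - v₂ := by
      rw [smul_add] at q₁
      have := (φ.app W).map_smul (hbarZ : tauZero (Rees (FD n W))).1 t₂
      rw [map_sub, show φ.app W ((hbarZ : tauZero (Rees (FD n W))) • t₂) =
        (hbarZ : tauZero (Rees (FD n W))) • φ.app W t₂ from this, sub_eq_sub_iff_add_eq_add,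
        add_comm _ (_ • φ.app W t₂)]
      exact q₁.symm
    have h2 := hV.loc_app_mem_mapAdd hV' (φ := φ) (b := b) (c := c)
      (fun d hd hdb => ih d hd hdb)
      (sub_mem ht₃ ((V.step b).smul_mem (hbarZ : tauZero (Rees (FD n W))) ht₂))
      ((congrArg (· ∈ (V'.ltSub b).carrier W) q₂).mpr (sub_mem
        (V'.mem_ltSub_of_lt hdb₁ ((V'.step d₁).smul_mem (hbarZ : tauZero (Rees (FD n W))) hy₂))
        (V'.mem_ltSub_of_lt hcb hv₂)))
    refine (SubMod.mapAdd φ (V.step b) (V'.step c)).of_loc fun z hz => ?_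
    obtain ⟨Z, k, hZ, d₂, hd₂, hdb₂, e₂⟩ := h2 z hz
    refine ⟨Z, k, hZ, ?_⟩
    have hdb := max_lt hdb₁ hdb₂
    have hd : max d₁ d₂ ∈ addInt A ∪ addInt A' := max_mem_of_mem (Or.inr hd₁) hd₂
    refine SubMod.mapAdd_mono (V.mono hdb.le) (fun _ => le_rfl) Z
      (ih _ hd hdb Z _ (V'.mono (le_max_left _ _) _ ((V'.step d₁).res_mem k hy₂)) ?_)
    have e₄ := SubMod.mapAdd_mono (φ := φ) (V.mono (le_max_right d₁ d₂)) (fun _ => le_rfl) Z e₂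
    have e₅ : (hbarZ : tauZero (Rees (FD n Z))) • T'.res k y₂ =
        T'.res k (φ.app W (t₃ - (hbarZ : tauZero (Rees (FD n W))) • t₂)) + T'.res k v₂ := by
      rw [q₂, ← map_add, sub_add_cancel]
      exact ((res_tau_smul k _ y₂).trans (congrArg (fun r : TauLoc (Rees (FD n Z)) =>
        r • T'.res k y₂) (tauRes_hbar k))).symm
    exact (congrArg (· ∈ (SubMod.mapAdd φ (V.step (max d₁ d₂)) (V'.step c)).carrier Z) e₅).mpr
      (add_mem e₄ (SubMod.mem_mapAdd_right ((V'.step c).res_mem k hv₂)))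
  exact ⟨W, j₂.trans k₂, hxW, goal⟩

/-- If `φ` is strictly specializable, `V'_a ∩ φ(T) ⊆ φ(V_a) + V'_c` for all `c ≤ a`. -/
theorem IsSpecializableHom.app_mem_mapAdd (h : IsSpecializableHom φ V V')
    (hV : IsVFiltration T A V) (hV' : IsVFiltration T' A' V') {a c : ℝ} (hca : c ≤ a)
    {U : Opens X} {t : T.obj U} (ht : φ.app U t ∈ (V'.step a).carrier U) :
    φ.app U t ∈ (SubMod.mapAdd φ (V.step a) (V'.step c)).carrier U := by
  have key : ∀ b ∈ addInt A ∪ addInt A', ∀ (W : Opens X), ∀ t ∈ (V.step b).carrier W,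
      φ.app W t ∈ (V'.step a).carrier W →
      φ.app W t ∈ (SubMod.mapAdd φ (V.step a) (V'.step c)).carrier W := by
    refine (hV.wellBounded.union hV'.wellBounded).induction a
      (fun b _ hba W t ht _ => SubMod.app_mem_mapAdd (V.mono hba W ht)) ?_
    intro b _ hab ih W t ht hta
    have h1 := hV.loc_app_mem_mapAdd hV' (φ := φ) (b := b) (c := c)
      (fun d hd _ => h.mem_mapAdd_of_hbar hV hV' c d hd) ht (V'.mem_ltSub_of_lt hab hta)
    refine (SubMod.mapAdd φ (V.step a) (V'.step c)).of_loc (AbSheaf.Loc.bind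
      (AbSheaf.Loc.and_stable (q := fun Z y => y ∈ (V'.step a).carrier Z) h1 (fun k _ => (V'.step a).res_mem k) hta) ?_)
    rintro Z y ⟨⟨d, hd, hdb, e⟩, hy⟩
    refine AbSheaf.Loc.mono (AbSheaf.Loc.and_stable
      (q := fun Z y => y ∈ (V'.step a).carrier Z) (SubMod.mem_mapAdd.1 e) (fun k _ => (V'.step a).res_mem k) hy) ?_
    rintro Y _ ⟨⟨t', ht', v, hv, rfl⟩, hy⟩
    exact add_mem (ih d hd hdb Y t' ht' ((add_mem_cancel_right (V'.mono hca Y hv)).1 hy))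
      (SubMod.mem_mapAdd_right hv)
  refine (SubMod.mapAdd φ (V.step a) (V'.step c)).of_loc fun x hx => ?_
  obtain ⟨W, k, hW, b, hb, e⟩ := hV.exhaustive U t x hx
  refine ⟨W, k, hW, ?_⟩
  have e1 := φ.app_res k t
  have h2 := key b (Or.inl hb) W _ e ((congrArg (· ∈ (V'.step a).carrier W) e1).mpr
    ((V'.step a).res_mem k ht))
  exact (congrArg (· ∈ (SubMod.mapAdd φ (V.step a) (V'.step c)).carrier W) e1).mp h2

end StrictInduction

section Saturation

open HasHbar

variable {n : ℕ} {X : Type u} [TopologicalSpace X] [ChartedSpace (EuclideanSpace ℂ (Fin n)) X]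
  {T T' : ModSheaf.{u, v, u} (TauLocPsh n X)} {φ : T.Hom T'}
  {A A' : Set ℝ} {V : TauFilt T} {V' : TauFilt T'}

/-- The whole sheaf, as a submodule. -/
def SubMod.whole {R : RingPsh.{u, w} X} (M : ModSheaf.{u, v, w} R) : SubMod M where
  carrier _ := ⊤
  res_mem _ _ _ := AddSubgroup.mem_top _
  of_loc _ := AddSubgroup.mem_top _
  smul_mem _ _ _ := AddSubgroup.mem_top _

lemma SubMod.mem_whole {R : RingPsh.{u, w} X} {M : ModSheaf.{u, v, w} R} {U : Opens X}
    (s : M.obj U) : s ∈ (SubMod.whole M).carrier U := AddSubgroup.mem_top _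

/-- If `φ` is strictly specializable, `τ - ħ` is injective on `T' / (φ(T) + V'_a)`: if `z ∈ V'_b`
with `b > a` and `(τ - ħ)z ∈ φ(T) + V'_a`, then `ħz ∈ φ(V_b) + V'_{<b}` as `τz ∈ V'_{b-1}`. -/
lemma IsSpecializableHom.mem_of_tau_sub_hbar [LocallyCompactSpace X]
    (h : IsSpecializableHom φ V V') (hV : IsVFiltration T A V) (hV' : IsVFiltration T' A' V')
    {a : ℝ} {U : Opens X} {z : T'.obj U}
    (hz : (tauSubHbarZ : tauZero (Rees (FD n U))) • z ∈
      (SubMod.mapAdd φ (SubMod.whole _) (V'.step a)).carrier U) :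
    z ∈ (SubMod.mapAdd φ (SubMod.whole _) (V'.step a)).carrier U := by
  have hres : ∀ {W Z : Opens X} (k : Z ≤ W) (z : T'.obj W),
      T'.res k ((tauSubHbarZ : tauZero (Rees (FD n W))) • z) =
        (tauSubHbarZ : tauZero (Rees (FD n Z))) • T'.res k z := fun k z =>
    (res_tau_smul k _ z).trans (congrArg (fun r : TauLoc (Rees (FD n _)) => r • T'.res k z)
      (tauRes_tau_sub_hbar k))
  set K := SubMod.mapAdd φ (SubMod.whole _) (V'.step a) with hK
  have key : ∀ b ∈ addInt A', ∀ (W : Opens X) (z : T'.obj W), z ∈ (V'.step b).carrier W →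
      (tauSubHbarZ : tauZero (Rees (FD n W))) • z ∈ K.carrier W → z ∈ K.carrier W := by
    refine hV'.wellBounded.induction a
      (fun b _ hba W z hz _ => SubMod.mem_mapAdd_right (V'.mono hba W hz)) ?_
    intro b _ hab ih W z hz hzK
    have h1 : (hbarZ : tauZero (Rees (FD n W))) • z ∈
        (SubMod.mapAdd φ (V.step b) (V'.ltSub b)).carrier W := by
      refine (SubMod.mapAdd φ (V.step b) (V'.ltSub b)).of_loc fun x hx => ?_
      obtain ⟨Z, k, hZ, s, -, v, hv, e⟩ := SubMod.mem_mapAdd.1 hzK x hx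
      refine ⟨Z, k, hZ, ?_⟩
      have e := (hres k z).symm.trans e
      have hz' := (V'.step b).res_mem k hz
      have hτ : (tauPow 1 : TauLoc (Rees (FD n Z))) • T'.res k z ∈ (V'.step (b - 1)).carrier Z :=
        hV'.tauPow_smul_mem (by push_cast; exact le_rfl) hz'
      have e1 : (hbarZ : tauZero (Rees (FD n Z))) • T'.res k z =
          (tauPow 1 : TauLoc (Rees (FD n Z))) • T'.res k z - (φ.app Z s + v) := by
        refine eq_sub_of_add_eq ?_
        rw [← e, add_comm]
        change (tauPow 1 - ofCoef hbar : TauLoc (Rees (FD n Z))) • T'.res k z +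
          (ofCoef hbar : TauLoc (Rees (FD n Z))) • T'.res k z = _
        rw [← add_smul, sub_add_cancel]
      have hφs : φ.app Z s ∈ (V'.step b).carrier Z := by
        have e2 : φ.app Z s = (tauSubHbarZ : tauZero (Rees (FD n Z))) • T'.res k z - v :=
          eq_sub_of_add_eq e.symm
        exact (congrArg (· ∈ (V'.step b).carrier Z) e2).mpr
          (sub_mem ((V'.step b).smul_mem (tauSubHbarZ : tauZero (Rees (FD n Z))) hz')
            (V'.mono hab.le Z hv))
      have hφs' := SubMod.mapAdd_mono (φ := φ) (fun _ => le_rfl)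
        (fun Y y hy => V'.mem_ltSub_of_lt (a := b) (sub_one_lt b) hy) Z
        (h.app_mem_mapAdd hV hV' (sub_one_lt b).le hφs)
      have e3 : T'.res k ((hbarZ : tauZero (Rees (FD n W))) • z) =
          (hbarZ : tauZero (Rees (FD n Z))) • T'.res k z :=
        (res_tau_smul k _ z).trans (congrArg (fun r : TauLoc (Rees (FD n Z)) => r • T'.res k z)
          (tauRes_hbar k))
      refine (congrArg (· ∈ (SubMod.mapAdd φ (V.step b) (V'.ltSub b)).carrier Z)
        (e3.trans e1)).mpr (sub_mem (SubMod.mem_mapAdd_right ?_) (add_mem hφs'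
          (SubMod.mem_mapAdd_right (V'.mem_ltSub_of_lt hab hv))))
      exact V'.mem_ltSub_of_lt (sub_one_lt b) hτ
    refine K.of_loc fun x hx => ?_
    obtain ⟨Z, k, hZ, t, -, z', hz', e⟩ :=
      SubMod.mem_mapAdd.1 (h.mem_of_hbar (hV.hom_app_mem hV' φ) hz h1) x hx
    refine ⟨Z, k, hZ, ?_⟩
    refine (congrArg (· ∈ K.carrier Z) e).mpr
      (add_mem (SubMod.app_mem_mapAdd (SubMod.mem_whole _)) ?_)
    have h2 : (tauSubHbarZ : tauZero (Rees (FD n Z))) • z' ∈ K.carrier Z := by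
      have e4 : (tauSubHbarZ : tauZero (Rees (FD n Z))) • z' =
          T'.res k ((tauSubHbarZ : tauZero (Rees (FD n W))) • z) -
            φ.app Z ((tauSubHbarZ : tauZero (Rees (FD n Z))) • t) := by
        refine eq_sub_of_add_eq ?_
        rw [hres, show T'.res k z = _ from e, add_comm, smul_add]
        exact congrArg (· + _) ((φ.app Z).map_smul (tauSubHbarZ : tauZero (Rees (FD n Z))).1 t)
      exact (congrArg (· ∈ K.carrier Z) e4).mpr (sub_mem (K.res_mem k hzK)
        (SubMod.app_mem_mapAdd (SubMod.mem_whole _)))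
    refine K.of_loc fun y hy => ?_
    obtain ⟨Y, l, hY, d, hd, hdb, e5⟩ := hV'.loc_of_mem_ltSub hz' y hy
    refine ⟨Y, l, hY, ih d hd hdb Y _ e5 ?_⟩
    exact (congrArg (· ∈ K.carrier Y) (hres l z')).mp (K.res_mem l h2)
  refine K.of_loc fun x hx => ?_
  obtain ⟨W, k, hW, b, hb, e⟩ := hV'.exhaustive U z x hx
  exact ⟨W, k, hW, key b hb W _ e ((congrArg (· ∈ K.carrier W) (hres k z)).mp (K.res_mem k hz))⟩

end Saturation

/-! ### Strictly filtered morphisms -/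

section StrictlyFiltered

open HasHbar

variable {n : ℕ} {X : Type u} [TopologicalSpace X] [ChartedSpace (EuclideanSpace ℂ (Fin n)) X]
  {M : TildeMod.{u, v} n X}

lemma tau_polyToZero_apply_eq_zero {U : Opens X} (p : Polynomial (Rees (FD n U)))
    {s : M.tau.obj U} {d : ℤ} (hs : ∀ i < d, s.1 i = 0) :
    ∀ i < d, ((polyToZero p : tauZero (Rees (FD n U))) • s : M.tau.obj U).1 i = 0 := by
  induction p using Polynomial.induction_on generalizing s with
  | C a =>
    rw [polyToZero_C]
    change ∀ i < d, ((ofCoef a : TauLoc (Rees (FD n U))) • s : M.tau.obj U).1 i = 0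
    induction a using Rees.induct with
    | h0 =>
      intro i _
      rw [map_zero]
      exact congrFun (congrArg Subtype.val (zero_smul (TauLoc (Rees (FD n U))) s)) i
    | h k P =>
      intro i hi
      rw [tau_of_apply, hs _ (by omega), smul_zero]
    | hadd a b ha hb =>
      intro i hi
      rw [map_add, add_smul, tau_add_apply, ha i hi, hb i hi, add_zero]
  | add p q hp hq =>
    intro i hi
    rw [map_add, add_smul, tau_add_apply, hp hs i hi, hq hs i hi, add_zero]
  | monomial k a h =>
    rw [pow_succ, ← mul_assoc]
    generalize Polynomial.C a * Polynomial.X ^ k = q at h ⊢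
    rw [map_mul, mul_smul]
    refine h ?_
    intro i hi
    rw [polyToZero_X]
    change ((tauPow 1 : TauLoc (Rees (FD n U))) • s).1 i = 0
    rw [tau_tauPow_apply, hs _ (by omega)]

/-- If `N` is of finite type over `^τR'_X`, its sections have, locally, no component of large
negative degree: `R_X` and `τ` do not lower the degree. -/
lemma SubMod.FG.exists_apply_eq_zero {N : SubMod (M.tau.restrict (zeroToLoc n X))}
    (hN : (N.restrict (primeToZero n X)).FG) (x : X) : ∃ W : Opens X, x ∈ W ∧ ∃ d : ℤ,
      ∀ Z ≤ W, ∀ s : M.tau.obj Z, s ∈ N.carrier Z → ∀ i < d, s.1 i = 0 := by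
  obtain ⟨V, hV, p, g, hg, H⟩ := hN x
  obtain ⟨W, h, hW, e⟩ := exists_nhds_forall hV
    (P := fun i W h => ∃ I : Finset ℤ, ∀ k ∉ I, (M.tau.res h (g i)).1 k = 0)
    (fun i W W' h h' ⟨I, hI⟩ => ⟨I, fun k hk => by
      rw [← M.tau.res_res h h', tau_res_apply, hI k hk, map_zero]⟩)
    (fun i => M.exists_finset (g i) x hV)
  choose I hI using e
  obtain ⟨d, hd⟩ := (Finset.univ.biUnion I).bddBelow
  refine ⟨W, hW, d, fun Z hZ s hs i hi => M.toModSheaf.sep _ fun y hy => ?_⟩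
  obtain ⟨Y, l, hY, k, r, er⟩ := H Z (hZ.trans h) s hs y hy
  refine ⟨Y, l, hY, ?_⟩
  rw [← tau_res_apply]
  refine (congrArg (fun t : M.tau.obj Y => t.1 i) er).trans ?_
  refine (tau_sum_apply M Finset.univ (fun j =>
    ((polyToZero (r j) : tauZero (Rees (FD n Y))) • M.tau.res k (g j) : M.tau.obj Y)) i).trans ?_
  refine Finset.sum_eq_zero fun j _ => tau_polyToZero_apply_eq_zero (r j) (d := d) ?_ i hi
  intro i hi
  rw [← M.tau.res_res h (l.trans hZ), tau_res_apply, hI j i fun H => ?_, map_zero]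
  exact absurd (hd (Finset.mem_coe.2 (Finset.mem_biUnion.2 ⟨j, Finset.mem_univ j, H⟩))) (not_le.2 hi)

variable {M₁ M₂ : TildeMod.{u, v} n X} {f : M₁.Hom M₂}
  {A₁ A₂ : Set ℝ} {V₁ : TauFilt M₁.tau} {V₂ : TauFilt M₂.tau}

lemma TildeMod.Hom.tau_single (f : M₁.Hom M₂) {U : Opens X} (k : ℤ) (m : M₁.toModSheaf.obj U) :
    f.tau.app U (M₁.single k m) = M₂.single k (f.app U m) :=
  tau_ext M₂ fun i => by
    change f.app U ((M₁.single k m).1 i) = _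
    rw [M₁.single_apply, M₂.single_apply]
    split_ifs
    · rfl
    · exact map_zero _

lemma TildeMod.Hom.clsTau_tau (f : M₁.Hom M₂) {U : Opens X} (t : M₁.tau.obj U) (k : ℤ) :
    (M₂.clsTau U (f.tau.app U t)).1 k = f.fibre.app U (M₁.cls U (t.1 k)) :=
  (f.fibre_cls U (t.1 k)).symm

/-- The section `u` of `𝓜₂` is the image by `λ|_{ħ=1}` of a section, over the same open set, of the
term `F_k 𝓜₁` defined by `V₁_a`. -/
def TildeMod.Hom.InImage (f : M₁.Hom M₂) (V₁ : TauFilt M₁.tau) (a : ℝ) (k : ℤ) (W : Opens X)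
    (u : M₂.fibre.obj W) : Prop :=
  ∃ m ∈ (M₁.irrStep (V₁.step a) k).carrier W, f.fibre.app W m = u

variable [LocallyCompactSpace X]

/-- The case of a section of `V₂_a ∩ ((τ - ħ)V₂_a + φ(^τM₁))`, where `φ = ^τλ`: modulo `V₂_c`, the
term in `φ(^τM₁)` is in `φ(V₁_a)`, and `V₂_c` has no component of degree `k` if `c` is small. -/
lemma IsSpecializableHom.loc_inImage_of_eq (h : IsSpecializableHom f.tau V₁ V₂)
    (hV₁ : IsVFiltration M₁.tau A₁ V₁) (hV₂ : IsVFiltration M₂.tau A₂ V₂) {a : ℝ}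
    (ha : PrimeCoherent (V₂.step a)) {k : ℤ} {U : Opens X} {s y : M₂.tau.obj U}
    {t : M₁.tau.obj U} (hs : s ∈ (V₂.step a).carrier U) (hy : y ∈ (V₂.step a).carrier U)
    (e : s = (tauPow 1 - ofCoef hbar : TauLoc (Rees (FD n U))) • y + f.tau.app U t) :
    M₂.fibre.Loc (f.InImage V₁ a k) ((M₂.clsTau U s).1 k) := by
  have ht : f.tau.app U t ∈ (V₂.step a).carrier U := by
    have e1 : f.tau.app U t = s - (tauPow 1 - ofCoef hbar : TauLoc (Rees (FD n U))) • y :=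
      eq_sub_of_add_eq' e.symm
    exact (congrArg (· ∈ (V₂.step a).carrier U) e1).mpr (sub_mem hs
      ((V₂.step a).smul_mem (tauSubHbarZ : tauZero (Rees (FD n U))) hy))
  intro x hx
  obtain ⟨W₁, hW₁, d, hd⟩ :=
    SubMod.FG.exists_apply_eq_zero ((SubMod.toMod_coherent_iff _).1 ha).1 x
  obtain ⟨l, hl⟩ := exists_nat_gt (k - d)
  have hla : a + (-(l : ℤ) : ℤ) ≤ a := by
    push_cast
    linarith [(Nat.cast_nonneg l : (0 : ℝ) ≤ l)]
  obtain ⟨W₂, k₂, hW₂, t', ht', v, hv, e'⟩ :=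
    SubMod.mem_mapAdd.1 (h.app_mem_mapAdd hV₁ hV₂ hla ht) x hx
  refine ⟨W₂ ⊓ W₁, inf_le_left.trans k₂, ⟨hW₂, hW₁⟩, M₁.cls _ ((M₁.tau.res inf_le_left t').1 k),
    AbSheaf.Loc.of_self ⟨_, hV₁.isTauGraded a _ _ ((V₁.step a).res_mem inf_le_left ht') k, rfl⟩,
    ?_⟩
  have hv0 : (M₂.tau.res (inf_le_left : W₂ ⊓ W₁ ≤ W₂) v).1 k = 0 := by
    have h1 := (hV₂.mem_step_add_iff a (-(l : ℤ))).1 ((V₂.step _).res_mem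
      (inf_le_left : W₂ ⊓ W₁ ≤ W₂) hv)
    have h2 := hd _ inf_le_right _ h1 (k - l) (by omega)
    rw [tau_tauPow_apply, sub_neg_eq_add, sub_add_cancel] at h2
    exact h2
  have e2 : (M₂.clsTau U s).1 k = (M₂.clsTau U (f.tau.app U t)).1 k := by
    rw [e, map_add, M₂.clsTau_tau_sub_hbar_smul, zero_add]
  have e3 : M₂.tau.res (inf_le_left.trans k₂ : W₂ ⊓ W₁ ≤ U) (f.tau.app U t) =
      f.tau.app _ (M₁.tau.res inf_le_left t') + M₂.tau.res inf_le_left v := by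
    rw [← M₂.tau.res_res k₂ inf_le_left, f.tau.app_res, ← map_add]
    exact congrArg _ e'
  rw [e2]
  have e4 := congrArg (fun s : M₂.fibre.fam.obj (W₂ ⊓ W₁) => s.1 k)
    ((M₂.clsTau_res (inf_le_left.trans k₂ : W₂ ⊓ W₁ ≤ U) (f.tau.app U t)).symm.trans
      (congrArg (M₂.clsTau _) e3))
  refine Eq.trans ?_ e4.symm
  rw [map_add]
  refine Eq.trans ?_ (congrArg₂ (· + ·) (f.clsTau_tau _ k).symm
    ((congrArg (M₂.cls _) hv0).trans (map_zero _)).symm)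
  exact (add_zero _).symm

/-- If `m₂` and `λ(m₁)` have the same class in `𝓜₂`, then `τ^k ⊗ m₂ - φ(τ^k ⊗ m₁) = (τ - ħ)z`, and
`z ∈ φ(^τM₁) + V₂_a` by injectivity of `τ - ħ`. -/
lemma IsSpecializableHom.loc_inImage_of_cls_eq (h : IsSpecializableHom f.tau V₁ V₂)
    (hV₁ : IsVFiltration M₁.tau A₁ V₁) (hV₂ : IsVFiltration M₂.tau A₂ V₂) {a : ℝ}
    (ha : PrimeCoherent (V₂.step a)) {k : ℤ} {U : Opens X} {m₂ : M₂.toModSheaf.obj U}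
    {m₁ : M₁.toModSheaf.obj U} (hm₂ : M₂.single k m₂ ∈ (V₂.step a).carrier U)
    (e : M₂.cls U m₂ = M₂.cls U (f.app U m₁)) :
    M₂.fibre.Loc (f.InImage V₁ a k) (M₂.cls U m₂) := by
  have h0 : M₂.single k m₂ - f.tau.app U (M₁.single k m₁) ∈ M₂.tauSubHbarImage.carrier U := by
    rw [← M₂.clsTau_eq_zero, map_sub, f.tau_single, M₂.clsTau_single, M₂.clsTau_single, e, sub_self]
  refine AbSheaf.Loc.bind (p := fun W t => M₂.fibre.Loc (f.InImage V₁ a k) t) (fun x hx => ?_)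
    fun _ _ h => h
  obtain ⟨W, l, hW, z, ez⟩ := M₂.mem_tauSubHbarImage.1 h0 x hx
  rw [map_sub, ← f.tau.app_res, M₂.res_single, M₁.res_single] at ez
  have hm := (V₂.step a).res_mem l hm₂
  have hm := (congrArg (· ∈ (V₂.step a).carrier W) (M₂.res_single l k m₂)).mp hm
  have hz : (tauSubHbarZ : tauZero (Rees (FD n W))) • z ∈
      (SubMod.mapAdd f.tau (SubMod.whole _) (V₂.step a)).carrier W :=
    (congrArg (· ∈ (SubMod.mapAdd f.tau (SubMod.whole _) (V₂.step a)).carrier W) ez).mp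
      (sub_mem (SubMod.mem_mapAdd_right hm) (SubMod.app_mem_mapAdd (SubMod.mem_whole _)))
  refine ⟨W, l, hW, ?_⟩
  refine AbSheaf.Loc.bind (p := fun W t => M₂.fibre.Loc (f.InImage V₁ a k) t) (fun x hx => ?_)
    fun _ _ h => h
  obtain ⟨Z, j, hZ, s, -, y, hy, e'⟩ :=
    SubMod.mem_mapAdd.1 (h.mem_of_tau_sub_hbar hV₁ hV₂ hz) x hx
  refine ⟨Z, j, hZ, ?_⟩
  have ez2 := congrArg (M₂.tau.res j) ez
  rw [map_sub, ← f.tau.app_res, M₂.res_single, M₁.res_single, res_tau_smul, tauRes_tau_sub_hbar,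
    show M₂.tau.res j z = _ from e', smul_add] at ez2
  have hm' := (V₂.step a).res_mem j hm
  have hm' := (congrArg (· ∈ (V₂.step a).carrier Z) (M₂.res_single j k _)).mp hm'
  have e5 := h.loc_inImage_of_eq hV₁ hV₂ ha (k := k) (t :=
    (tauPow 1 - ofCoef hbar : TauLoc (Rees (FD n Z))) • s +
      M₁.single k (M₁.toModSheaf.res j (M₁.toModSheaf.res l m₁))) hm' hy (by
    rw [map_add]
    have := (f.tau.app Z).map_smul (tauPow 1 - ofCoef hbar : TauLoc (Rees (FD n Z))) s
    refine (eq_add_of_sub_eq ez2).trans ?_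
    rw [add_comm (_ • f.tau.app Z s), add_assoc]
    exact congrArg (fun q => _ + (q + _)) this.symm)
  have e6 : M₂.fibre.res j (M₂.fibre.res l (M₂.cls U m₂)) =
      (M₂.clsTau Z (M₂.single k (M₂.toModSheaf.res j (M₂.toModSheaf.res l m₂)))).1 k := by
    rw [M₂.cls_res, M₂.cls_res, M₂.clsTau_apply, M₂.single_apply_self]
  exact (congrArg (M₂.fibre.Loc (f.InImage V₁ a k)) e6).mpr e5

/-- If `^τλ` is strictly specializable, the morphism `λ|_{ħ=1}` is strictly filtered. -/
theorem IsSpecializableHom.loc_inImage_iff (h : IsSpecializableHom f.tau V₁ V₂)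
    (hV₁ : IsVFiltration M₁.tau A₁ V₁) (hV₂ : IsVFiltration M₂.tau A₂ V₂) {a : ℝ}
    (ha : PrimeCoherent (V₂.step a)) {k : ℤ} {U : Opens X} {u : M₂.fibre.obj U} :
    M₂.fibre.Loc (f.InImage V₁ a k) u ↔
      u ∈ (M₂.irrStep (V₂.step a) k).carrier U ∧ u ∈ f.fibre.image.carrier U := by
  constructor
  · intro H
    refine ⟨(M₂.irrStep (V₂.step a) k).mem_of_loc H ?_, H.mono fun W t ⟨m, _, e⟩ => ⟨m, e⟩⟩
    rintro W _ ⟨w, hw, rfl⟩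
    refine fun x hx => ?_
    obtain ⟨Z, l, hZ, m, hm, e⟩ := hw x hx
    refine ⟨Z, l, hZ, f.app Z m, ?_, ?_⟩
    · rw [← f.tau_single]
      exact hV₁.hom_app_mem hV₂ f.tau a Z _ hm
    · rw [← f.fibre.app_res]
      exact (f.fibre_cls Z m).symm.trans (congrArg _ e)
  · rintro ⟨hu, hi⟩
    refine AbSheaf.Loc.bind (p := fun W t => M₂.fibre.Loc (f.InImage V₁ a k) t) (fun x hx => ?_)
      fun _ _ h => h
    obtain ⟨W₁, l₁, hW₁, m₂, hm₂, e₂⟩ := hu x hx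
    obtain ⟨W₂, l₂, hW₂, w, ew⟩ := hi x hx
    obtain ⟨W₃, l₃, hW₃, m₁, e₁⟩ := M₁.exists_cls w x hW₂
    refine ⟨W₁ ⊓ W₃, inf_le_left.trans l₁, ⟨hW₁, hW₃⟩, ?_⟩
    have hm := (V₂.step a).res_mem (inf_le_left : W₁ ⊓ W₃ ≤ W₁) hm₂
    have hm := (congrArg (· ∈ (V₂.step a).carrier _) (M₂.res_single _ k m₂)).mp hm
    have e3 : M₂.fibre.res (inf_le_left.trans l₁ : W₁ ⊓ W₃ ≤ U) u =
        M₂.cls _ (M₂.toModSheaf.res (inf_le_left : W₁ ⊓ W₃ ≤ W₁) m₂) := by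
      rw [← M₂.cls_res, e₂, M₂.fibre.res_res]
    have e4 : M₂.fibre.res (inf_le_left.trans l₁ : W₁ ⊓ W₃ ≤ U) u =
        M₂.cls _ (f.app _ (M₁.toModSheaf.res (inf_le_right : W₁ ⊓ W₃ ≤ W₃) m₁)) := by
      rw [← f.fibre_cls, ← M₁.cls_res, e₁, f.fibre.app_res, f.fibre.app_res,
        show f.fibre.app W₂ w = _ from ew, M₂.fibre.res_res, M₂.fibre.res_res]
    rw [e3]
    exact h.loc_inImage_of_cls_eq hV₁ hV₂ ha hm (e3.symm.trans e4)

end StrictlyFiltered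

/-! ### The family of irregular Hodge filtrations -/

section Family

variable {n : ℕ} {X : Type u} [TopologicalSpace X] [ChartedSpace (EuclideanSpace ℂ (Fin n)) X]
  {M : TildeMod.{u, v} n X} {A : Set ℝ} {V : TauFilt M.tau}

lemma IsVFiltration.loc_tauPow_smul_mem (hV : IsVFiltration M.tau A V) (a : ℝ) {U : Opens X}
    (s : M.tau.obj U) : M.tau.Loc (fun W t => ∃ k : ℕ,
      (tauPow (k : ℤ) : TauLoc (Rees (FD n W))) • t ∈ (V.step a).carrier W) s :=
  (hV.exhaustive U s).mono fun W t ⟨b, _, ht⟩ => by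
    obtain ⟨k, hk⟩ := exists_nat_ge (b - a)
    exact ⟨k, hV.tauPow_smul_mem (by push_cast; linarith) ht⟩

lemma IsVFiltration.irrStep_add (hV : IsVFiltration M.tau A V) (a : ℝ) (k j : ℤ) :
    M.irrStep (V.step (a + k)) j = M.irrStep (V.step a) (j + k) := by
  refine SubSheaf.ext fun U u => ?_
  rw [TildeMod.mem_irrStep, TildeMod.mem_irrStep]
  have h : ∀ (W : Opens X) (m : M.toModSheaf.obj W),
      M.single j m ∈ (V.step (a + k)).carrier W ↔ M.single (j + k) m ∈ (V.step a).carrier W := by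
    intro W m
    rw [hV.mem_step_add_iff, M.tauPow_smul_single]
  simp only [h]

lemma TildeMod.irrStep_mono {N N' : SubMod (M.tau.restrict (zeroToLoc n X))}
    (h : ∀ U, N.carrier U ≤ N'.carrier U) (k : ℤ) (U : Opens X) :
    (M.irrStep N k).carrier U ≤ (M.irrStep N' k).carrier U := fun _ hu =>
  AbSheaf.Loc.mono hu fun W _ ⟨m, hm, e⟩ => ⟨m, h W hm, e⟩

theorem IsVFiltration.existsUnique_isReesOf [LocallyCompactSpace X]
    (hV : IsVFiltration M.tau A V) {a : ℝ} (ha : PrimeCoherent (V.step a)) :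
    ∃! F : DFiltration M.fibre, F.IsCoherent ∧ IsReesOf M (V.step a) F := by
  have h : IsReesOf M (V.step a) _ := isReesOf_irrFilt (hV.isTauGraded a)
    (hV.isTauHbarSaturated a) fun U s => hV.loc_tauPow_smul_mem a s
  refine ⟨_, ⟨h.isCoherent ha, h⟩, fun F hF => DFiltration.ext_step fun k => ?_⟩
  rw [hF.2.step_eq (hV.isTauGraded a), h.step_eq (hV.isTauGraded a)]

end Family

end IrrHodge

theorem mainTheorem7 (n : ℕ) (X : Type u) [TopologicalSpace X] [T2Space X]
    [ChartedSpace (EuclideanSpace ℂ (Fin n)) X]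
    [IsManifold (modelWithCornersSelf ℂ (EuclideanSpace ℂ (Fin n))) ω X] :
    (∀ M : TildeMod.{u, v} n X, M.toModSheaf.Coherent → HbarTorsionFree M.toModSheaf →
      ∀ (A : Set ℝ) (V : TauFilt M.tau), IsVFiltration M.tau A V →
        (∀ a : ℝ, (V.step a).toMod.Coherent ∧ IsTauGraded M (V.step a) ∧
          IsTauHbarSaturated (V.step a) ∧ IsTauLattice (V.step a)) ∧
        ((∃ a : ℝ, PrimeCoherent (V.step a)) →
          (∀ a : ℝ, PrimeCoherent (V.step a)) ∧
          (∀ a : ℝ, ∃! F : DFiltration M.fibre, F.IsCoherent ∧ IsReesOf M (V.step a) F) ∧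
          ∀ F : ℝ → DFiltration M.fibre, (∀ a, IsReesOf M (V.step a) (F a)) →
            (∀ (a : ℝ) (k j : ℤ), (F (a + k)).step j = (F a).step (j + k)) ∧
            (∀ a b : ℝ, a ≤ b → ∀ (j : ℤ) (U : Opens X),
              ((F a).step j).carrier U ≤ ((F b).step j).carrier U) ∧
            ∃! Firr : ℝ → SubSheaf M.fibre.toAbSheaf,
              (∀ (a : ℝ) (k : ℤ), Firr (a + k) = (F a).step k) ∧
              ∀ a b : ℝ, a ≤ b → ∀ U : Opens X, (Firr a).carrier U ≤ (Firr b).carrier U)) ∧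
    ∀ (M₁ M₂ : TildeMod.{u, v} n X) (f : M₁.Hom M₂),
      M₁.toModSheaf.Coherent → HbarTorsionFree M₁.toModSheaf →
      M₂.toModSheaf.Coherent → HbarTorsionFree M₂.toModSheaf →
      ∀ (A₁ A₂ : Set ℝ) (V₁ : TauFilt M₁.tau) (V₂ : TauFilt M₂.tau),
        IsVFiltration M₁.tau A₁ V₁ → IsVFiltration M₂.tau A₂ V₂ →
        (∃ a : ℝ, PrimeCoherent (V₁.step a)) → (∃ a : ℝ, PrimeCoherent (V₂.step a)) →
        HbarTorsionFree f.toHom.coker → IsSpecializableHom f.tau V₁ V₂ →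
        ∀ (F₁ : ℝ → DFiltration M₁.fibre) (F₂ : ℝ → DFiltration M₂.fibre),
          (∀ a, IsReesOf M₁ (V₁.step a) (F₁ a)) → (∀ a, IsReesOf M₂ (V₂.step a) (F₂ a)) →
          ∀ (a : ℝ) (k : ℤ) (U : Opens X) (s : M₂.fibre.obj U),
            M₂.fibre.Loc (fun W t => ∃ m ∈ ((F₁ a).step k).carrier W, f.fibre.app W m = t) s ↔
              s ∈ ((F₂ a).step k).carrier U ∧ s ∈ f.fibre.image.carrier U := by
  have : LocallyCompactSpace X := ChartedSpace.locallyCompactSpace (EuclideanSpace ℂ (Fin n)) X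
  refine ⟨fun M _ _ A V hV => ⟨fun a => ⟨hV.coherent_step a, hV.isTauGraded a,
    hV.isTauHbarSaturated a, hV.isTauLattice a⟩, ?_⟩, ?_⟩
  · rintro ⟨a₀, ha₀⟩
    refine ⟨fun a => hV.primeCoherent ha₀ a,
      fun a => hV.existsUnique_isReesOf (hV.primeCoherent ha₀ a), fun F hF => ?_⟩
    have hstep : ∀ (a : ℝ) (k : ℤ), (F a).step k = M.irrStep (V.step a) k := fun a k =>
      (hF a).step_eq (hV.isTauGraded a) k
    have hadd : ∀ (a : ℝ) (k j : ℤ), (F (a + k)).step j = (F a).step (j + k) := fun a k j => by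
      rw [hstep, hstep, hV.irrStep_add]
    have hmono : ∀ a b : ℝ, a ≤ b → ∀ (j : ℤ) (U : Opens X),
        ((F a).step j).carrier U ≤ ((F b).step j).carrier U := fun a b hab j U => by
      rw [hstep, hstep]
      exact TildeMod.irrStep_mono (V.mono hab) j U
    refine ⟨hadd, hmono, fun b => (F b).step 0, ⟨fun a k => ?_, fun a b hab U => hmono a b hab 0 U⟩,
      fun G hG => funext fun b => ?_⟩
    · exact (hadd a k 0).trans (by rw [zero_add])
    · simpa using hG.1 b 0
  · intro M₁ M₂ f _ _ _ _ A₁ A₂ V₁ V₂ hV₁ hV₂ _ ⟨a₂, ha₂⟩ _ hf F₁ F₂ hF₁ hF₂ a k U s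
    rw [(hF₁ a).step_eq (hV₁.isTauGraded a), (hF₂ a).step_eq (hV₂.isTauGraded a)]
    exact hf.loc_inImage_iff hV₁ hV₂ (hV₂.primeCoherent ha₂ a)
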